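/- Let $(D,0)=(V(f),0)\subset(\mathbb{C}^n,0)$ be a germ of a free divisor: $f\in\mathcal{O}_{\mathbb{C}^n,0}$ is a non-zero reduced germ with $f(0)=0$, and the module $\mathrm{Der}(-\log D)=\{\delta\in\mathrm{Der}_{\mathbb{C}^n,0} : \delta(f)\in(f)\}$ is free over $\mathcal{O}_{\mathbb{C}^n,0}$. For a local Artin $\mathbb{C}$-algebra $A$ with residue field $\mathbb{C}$ and maximal ideal $\mathfrak{m}_A$, put $S=\mathrm{Spec}\,A$. An *admissible deformation* of $(D,0)$ over $S$ is a closed subgerm $X\subset\mathbb{C}^n\times S$ at the closed point over the origin, flat over $S$, together with an isomorphism of $(D,0)$ with the central fibre $X_s\subset\mathbb{C}^n$, such that restriction to the central fibre induces a bijection $$\mathrm{Der}(-\log X/S)/\mathfrak{m}_A\mathrm{Der}(-\log X/S)\;\to\;\mathrm{Der}(-\log X_s),$$ where $\mathrm{Der}(-\log X/S)$ consists of the vector fields on $\mathbb{C}^n\times S$ without components in the $S$-direction that preserve the ideal of $X$, and $\mathrm{Der}(-\log X_s)$ of the vector fields on $(\mathbb{C}^n,0)$ that preserve the ideal of $X_s$.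 Let $\mathbf{FD}_D(A)$ be the set of isomorphism classes of admissible deformations of $(D,0)$ over $\mathrm{Spec}\,A$, where isomorphisms are isomorphisms of total spaces over $S$ compatible with the embeddings of $D$; it is a functor of $A$ by base change. A *hull* of a set-valued functor $F$ on such algebras (a formally versal deformation, when $F=\mathbf{FD}_D$) is a complete Noetherian local $\mathbb{C}$-algebra $R$ with residue field $\mathbb{C}$ together with a natural transformation $\mathrm{Hom}(R,-)\to F$ that is smooth (for every surjection $B\to A$ the map $\mathrm{Hom}(R,B)\to \mathrm{Hom}(R,A)\times_{F(A)}F(B)$ is surjective) and bijective on $\mathbb{C}[\epsilon]/(\epsilon^2)$. 1. If $(D,0)$ is a germ of a free divisor defined by a polynomial that is weighted homogeneous with respect to positive integer weights of the variables, then $\mathbf{FD}_D$ has a hull. 2. In particular, if $D=V(p)\subset\mathbb{C}^n$, with $p$ a squarefree polynomial and $0\in D$, is a linear free divisor (that is, $(D,0)$ is a germ of a free divisor and the module of polynomial vector fields $\delta$ with $\delta(p)\in(p)$ has a basis over $\mathbb{C}[x_1,\dots,x_n]$ consisting of vector fields whose coefficients are homogeneous linear forms), then $\mathbf{FD}_D$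 has a hull. -/

import Mathlib

set_option linter.unusedSectionVars false
noncomputable section
namespace FreeDiv
open scoped TensorProduct
open IsLocalRing CategoryTheory

/-! ### The ring of germs of holomorphic functions at the origin -/

/-- A formal power series in `n` variables is convergent if it converges absolutely on some closed
polydisc of radius `r > 0` about the origin. -/
def IsConvergent {n : ℕ} (φ : MvPowerSeries (Fin n) ℂ) : Prop :=
  ∃ r : ℝ, 0 < r ∧ Summable fun m : Fin n →₀ ℕ => ‖MvPowerSeries.coeff m φ‖ * r ^ m.degree

theorem summable_of_le {n : ℕ} {φ : MvPowerSeries (Fin n) ℂ} {r s : ℝ} (hs : 0 < s) (h : s ≤ r)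
    (H : Summable fun m : Fin n →₀ ℕ => ‖MvPowerSeries.coeff m φ‖ * r ^ m.degree) :
    Summable fun m : Fin n →₀ ℕ => ‖MvPowerSeries.coeff m φ‖ * s ^ m.degree :=
  H.of_nonneg_of_le (fun m => by positivity) (fun m => by gcongr)

theorem IsConvergent.add {n : ℕ} {φ ψ : MvPowerSeries (Fin n) ℂ} (hφ : IsConvergent φ)
    (hψ : IsConvergent ψ) : IsConvergent (φ + ψ) := by
  obtain ⟨r, hr, h1⟩ := hφ
  obtain ⟨s, hs, h2⟩ := hψ
  refine ⟨min r s, lt_min hr hs, ((summable_of_le (lt_min hr hs) (min_le_left _ _) h1).add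
    (summable_of_le (lt_min hr hs) (min_le_right _ _) h2)).of_nonneg_of_le
    (fun m => by positivity) (fun m => ?_)⟩
  rw [← add_mul, map_add]
  gcongr
  exact norm_add_le _ _

theorem summable_mul {n : ℕ} {φ ψ : MvPowerSeries (Fin n) ℂ} {t : ℝ} (ht : 0 < t)
    (a : Summable fun m : Fin n →₀ ℕ => ‖MvPowerSeries.coeff m φ‖ * t ^ m.degree)
    (b : Summable fun m : Fin n →₀ ℕ => ‖MvPowerSeries.coeff m ψ‖ * t ^ m.degree) :
    Summable fun m : Fin n →₀ ℕ => ‖MvPowerSeries.coeff m (φ * ψ)‖ * t ^ m.degree := by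
  classical
  have key := summable_sum_mul_antidiagonal_of_summable_mul (A := Fin n →₀ ℕ)
    (f := fun m => ‖MvPowerSeries.coeff m φ‖ * t ^ m.degree)
    (g := fun m => ‖MvPowerSeries.coeff m ψ‖ * t ^ m.degree)
    (a.mul_of_nonneg b (fun m => by positivity) (fun m => by positivity))
  refine Summable.of_nonneg_of_le (fun m => by positivity) (fun m => ?_) key
  have h : ∀ p ∈ Finset.HasAntidiagonal.antidiagonal m,
      ‖MvPowerSeries.coeff p.1 φ * MvPowerSeries.coeff p.2 ψ‖ * t ^ m.degree =
      ‖MvPowerSeries.coeff p.1 φ‖ * t ^ p.1.degree *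
        (‖MvPowerSeries.coeff p.2 ψ‖ * t ^ p.2.degree) := fun p hp => by
    rw [← Finset.HasAntidiagonal.mem_antidiagonal.mp hp, map_add, pow_add, norm_mul]
    ring
  rw [MvPowerSeries.coeff_mul, ← Finset.sum_congr rfl h, ← Finset.sum_mul]
  exact mul_le_mul_of_nonneg_right (norm_sum_le _ _) (by positivity)

theorem IsConvergent.mul {n : ℕ} {φ ψ : MvPowerSeries (Fin n) ℂ} (hφ : IsConvergent φ)
    (hψ : IsConvergent ψ) : IsConvergent (φ * ψ) := by
  obtain ⟨r, hr, h1⟩ := hφ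
  obtain ⟨s, hs, h2⟩ := hψ
  have ht := lt_min hr hs
  exact ⟨min r s, ht, summable_mul ht (summable_of_le ht (min_le_left _ _) h1)
    (summable_of_le ht (min_le_right _ _) h2)⟩

theorem isConvergent_monomial {n : ℕ} (d : Fin n →₀ ℕ) (c : ℂ) :
    IsConvergent (MvPowerSeries.monomial d c) := by
  classical
  refine ⟨1, one_pos, summable_of_ne_finset_zero (s := {d}) fun m hm => ?_⟩
  simp only [Finset.mem_singleton] at hm
  simp [MvPowerSeries.coeff_monomial, hm]

/-- The `ℂ`-algebra of convergent power series in `n` variables. -/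
def convergentSeries (n : ℕ) : Subalgebra ℂ (MvPowerSeries (Fin n) ℂ) where
  carrier := {φ | IsConvergent φ}
  mul_mem' := IsConvergent.mul
  add_mem' := IsConvergent.add
  algebraMap_mem' c := isConvergent_monomial 0 c

/-- `O n` is the local ring of germs at the origin of holomorphic functions on `ℂⁿ`, as the ring
of convergent power series. -/
abbrev O (n : ℕ) : Type := convergentSeries n

/-- The germ of the coordinate function `x_i`. -/
def coord {n : ℕ} (i : Fin n) : O n := ⟨MvPowerSeries.X i, isConvergent_monomial _ 1⟩

/-- The germ at the origin of a polynomial. -/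
def germ {n : ℕ} : MvPolynomial (Fin n) ℂ →ₐ[ℂ] O n := MvPolynomial.aeval coord

/-! ### Logarithmic vector fields and free divisors -/

/-- For an `R`-algebra `T` and an ideal `I` of `T`, the module of `R`-linear vector fields
(derivations of `T` over `R`) that are logarithmic along `V(I)`. For `R = ℂ`, `T = O n` and
`I = (f)` this is the stalk at the origin of `Der(-log D)`, `D = V(f)`. For a local Artin algebra
`A`, `S = Spec A` and `T = A ⊗ O n`, the `A`-linear derivations of `T` are the germs of vector
fields on `ℂⁿ × S` without components in the direction of `S`, and this is `Der(-log X/S)` for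
`X = V(I)`. -/
def logDer (R T : Type) [CommRing R] [CommRing T] [Algebra R T] (I : Ideal T) :
    Submodule T (Derivation R T T) where
  carrier := {δ | ∀ g ∈ I, δ g ∈ I}
  add_mem' h₁ h₂ g hg := I.add_mem (h₁ g hg) (h₂ g hg)
  zero_mem' _ _ := I.zero_mem
  smul_mem' c _ h g hg := I.mul_mem_left c (h g hg)

/-- The germ `f` is a reduced equation of a germ at the origin of a free divisor in `ℂⁿ`: it is
non-zero, it vanishes at the origin, `O n / (f)` is reduced, and the module of germs of vector
fields `δ` with `δ(f) ∈ (f)` is free over `O n`. -/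
structure IsFreeDivisorGerm {n : ℕ} (f : O n) : Prop where
  ne_zero : f ≠ 0
  vanishes : MvPowerSeries.constantCoeff (f : MvPowerSeries (Fin n) ℂ) = 0
  reduced : (Ideal.span {f}).IsRadical
  free : Module.Free (O n) (logDer ℂ (O n) (Ideal.span {f}))

/-- The polynomial `p` is a reduced equation of a linear free divisor in `ℂⁿ` through the origin:
the divisor is free there, and the module over `ℂ[x_1, ..., x_n]` of polynomial logarithmic vector
fields has a basis all of whose members have homogeneous linear coefficients. The coefficient of
`∂/∂x_j` in a vector field `δ` is `δ(x_j)`. -/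
structure IsLinearFreeDivisor {n : ℕ} (p : MvPolynomial (Fin n) ℂ) : Prop where
  squarefree : Squarefree p
  free : IsFreeDivisorGerm (germ p)
  linear : ∃ (ι : Type) (b : Module.Basis ι (MvPolynomial (Fin n) ℂ)
      (logDer ℂ (MvPolynomial (Fin n) ℂ) (Ideal.span {p}))),
    ∀ i j, MvPolynomial.IsHomogeneous ((b i).1 (MvPolynomial.X j)) 1

/-! ### Local Artin algebras -/

/-- The objects of the category of local Artin `ℂ`-algebras with residue field `ℂ`. These are
exactly the local `ℂ`-algebras of finite dimension. -/
structure Art where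
  carrier : Type
  [commRing : CommRing carrier]
  [algebra : Algebra ℂ carrier]
  [isLocalRing : IsLocalRing carrier]
  [finite : Module.Finite ℂ carrier]

attribute [instance] Art.commRing Art.algebra Art.isLocalRing Art.finite

instance : CoeSort Art Type := ⟨Art.carrier⟩

/-- Morphisms are `ℂ`-algebra homomorphisms; they are automatically local. -/
instance : Category Art where
  Hom A B := A →ₐ[ℂ] B
  id A := AlgHom.id ℂ A
  comp f g := g.comp f

section
variable (A : Type) [CommRing A] [Algebra ℂ A] [IsLocalRing A] [Module.Finite ℂ A]

theorem residue_bijective :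
    Function.Bijective (Algebra.ofId ℂ (ResidueField A)) := by
  have : Module.Finite ℂ (ResidueField A) := inferInstance
  exact IsAlgClosed.algebraMap_bijective_of_isIntegral

/-- The map from a local Artin algebra onto its residue field `ℂ`. -/
def residueHom : A →ₐ[ℂ] ℂ :=
  (AlgEquiv.ofBijective _ (residue_bijective A)).symm.toAlgHom.comp
    (IsScalarTower.toAlgHom ℂ A (ResidueField A))

variable {A}
theorem residueHom_eq_zero {a : A} : residueHom A a = 0 ↔ a ∈ maximalIdeal A := by
  simp [residueHom]

theorem residueHom_unique (g : A →ₐ[ℂ] ℂ) : g = residueHom A := by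
  have h : ∀ a ∈ maximalIdeal A, g a = 0 := fun a ha => by
    by_contra h
    have hmem : a - algebraMap ℂ A (g a) ∈ nonunits A := fun hu => by
      have := hu.map g
      simp at this
    have h2 : algebraMap ℂ A (g a) ∈ maximalIdeal A := by
      simpa using (maximalIdeal A).sub_mem ha (show _ ∈ maximalIdeal A from hmem)
    exact h2 ((IsUnit.mk0 _ h).map (algebraMap ℂ A))
  ext a
  have ha : a - algebraMap ℂ A (residueHom A a) ∈ maximalIdeal A :=
    residueHom_eq_zero.mp (by simp)
  have := h _ ha
  simpa [sub_eq_zero] using this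

theorem isNilpotent_maximalIdeal : IsNilpotent (maximalIdeal A) := by
  have : IsArtinianRing A := IsArtinianRing.of_finite ℂ A
  rw [← jacobson_eq_maximalIdeal (⊥ : Ideal A) bot_ne_top]
  exact IsArtinianRing.isNilpotent_jacobson_bot
end

/-! ### Auxiliary facts on modules over local Artin rings -/

theorem nilpotent_nakayama {A M : Type} [CommRing A] [AddCommGroup M] [Module A M]
    {m : Ideal A} (hm : IsNilpotent m) {N : Submodule A M}
    (h : ⊤ ≤ N ⊔ m • (⊤ : Submodule A M)) : N = ⊤ := by
  have key : ∀ k : ℕ, ⊤ ≤ N ⊔ m ^ k • (⊤ : Submodule A M) := by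
    intro k
    induction k with
    | zero => simp
    | succ k ih =>
      have h1 : m • (⊤ : Submodule A M) ≤ N ⊔ m ^ (k + 1) • (⊤ : Submodule A M) := by
        calc m • (⊤ : Submodule A M) ≤ m • (N ⊔ m ^ k • (⊤ : Submodule A M)) :=
              Submodule.smul_mono le_rfl ih
          _ ≤ _ := by
            rw [Submodule.smul_sup, pow_succ', ← Submodule.smul_assoc, smul_eq_mul]
            exact sup_le_sup Submodule.smul_le_right le_rfl
      exact h.trans (sup_le le_sup_left h1)
  obtain ⟨k, hk⟩ := hm
  have := key k
  rw [hk] at this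
  simpa using this

theorem mem_smul_ker {A M P : Type} [CommRing A] [IsLocalRing A] [AddCommGroup M] [Module A M]
    [AddCommGroup P] [Module A P] [Module.Flat A P] (hm : IsNilpotent (maximalIdeal A))
    (φ : M →ₗ[A] P)
    (h : ∀ μ, φ μ ∈ maximalIdeal A • (⊤ : Submodule A P) →
      ∃ κ, φ κ = 0 ∧ μ - κ ∈ maximalIdeal A • (⊤ : Submodule A M))
    {κ : M} (hκ : φ κ = 0) (hκ' : κ ∈ maximalIdeal A • (⊤ : Submodule A M)) :
    κ ∈ maximalIdeal A • LinearMap.ker φ := by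
  have hB : ∀ b : LinearMap.range φ, (b : P) ∈ maximalIdeal A • (⊤ : Submodule A P) →
      b ∈ maximalIdeal A • (⊤ : Submodule A (LinearMap.range φ)) := by
    rintro ⟨_, μ, rfl⟩ hb
    obtain ⟨κ, h1, h2⟩ := h μ hb
    have h3 : φ.rangeRestrict (μ - κ) ∈ maximalIdeal A • (⊤ : Submodule A (LinearMap.range φ)) := by
      have := Submodule.mem_map_of_mem (f := φ.rangeRestrict) h2
      rw [Submodule.map_smul''] at this
      exact Submodule.smul_mono le_rfl le_top this
    convert h3 using 1
    ext; simp [h1]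
  let W := ResidueField A ⊗[A] LinearMap.range φ
  let b := Module.Basis.ofVectorSpace (ResidueField A) W
  have hsurj := TensorProduct.mk_surjective A (LinearMap.range φ) (ResidueField A)
    Ideal.Quotient.mk_surjective
  have hv : ∀ i, ∃ v : M, (1 : ResidueField A) ⊗ₜ[A] φ.rangeRestrict v = b i := fun i => by
    obtain ⟨⟨_, v, rfl⟩, hv⟩ := hsurj (b i)
    exact ⟨v, hv⟩
  choose v hv using hv
  have hker : ∀ {Q : Type} [AddCommGroup Q] [Module A Q] (q : Q),
      (1 : ResidueField A) ⊗ₜ[A] q = 0 ↔ q ∈ maximalIdeal A • (⊤ : Submodule A Q) := by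
    intro Q _ _ q
    rw [← LinearMap.ker_tensorProductMk]
    rfl
  have hinj : Function.Injective
      ((LinearMap.range φ).subtype.baseChange (ResidueField A)) := by
    rw [injective_iff_map_eq_zero]
    intro w hw
    obtain ⟨c, rfl⟩ := hsurj w
    have hw' : (1 : ResidueField A) ⊗ₜ[A] (c : P) = 0 := by simpa using hw
    exact (hker c).mpr (hB c ((hker _).mp hw'))
  have hli : LinearIndependent A (fun i => φ (v i)) := by
    apply Module.IsLocalRing.linearIndependent_of_flat
    have := b.linearIndependent.map' ((LinearMap.range φ).subtype.baseChange (ResidueField A))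
      (LinearMap.ker_eq_bot.mpr hinj)
    have e : (LinearMap.range φ).subtype.baseChange (ResidueField A) ∘ b =
        TensorProduct.mk A (ResidueField A) P 1 ∘ fun i => φ (v i) := by
      ext i
      simp only [Function.comp_apply, ← hv]
      rfl
    rw [e] at this
    exact this
  have hspan : Submodule.span A (Set.range v) ⊔ LinearMap.ker φ = ⊤ := by
    apply nilpotent_nakayama hm
    intro μ _
    have hW : ∀ w : W, ∃ s ∈ Submodule.span A (Set.range v),
        w = (1 : ResidueField A) ⊗ₜ[A] φ.rangeRestrict s := by
      intro w
      induction b.mem_span w using Submodule.span_induction with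
      | mem x hx =>
        obtain ⟨i, rfl⟩ := hx
        exact ⟨v i, Submodule.subset_span ⟨i, rfl⟩, (hv i).symm⟩
      | zero => exact ⟨0, zero_mem _, by simp⟩
      | add x y _ _ hx hy =>
        obtain ⟨s, hs, rfl⟩ := hx
        obtain ⟨t, ht, rfl⟩ := hy
        exact ⟨s + t, add_mem hs ht, by rw [map_add, TensorProduct.tmul_add]⟩
      | smul c x _ hx =>
        obtain ⟨s, hs, rfl⟩ := hx
        obtain ⟨c, rfl⟩ := Ideal.Quotient.mk_surjective c
        refine ⟨c • s, Submodule.smul_mem _ _ hs, ?_⟩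
        rw [map_smul, TensorProduct.tmul_smul]
        rfl
    obtain ⟨s, hs, hμ⟩ := hW (1 ⊗ₜ[A] φ.rangeRestrict μ)
    rw [← sub_eq_zero, ← TensorProduct.tmul_sub, hker, ← map_sub] at hμ
    have h4 : φ (μ - s) ∈ maximalIdeal A • (⊤ : Submodule A P) := by
      have := Submodule.mem_map_of_mem (f := (LinearMap.range φ).subtype) hμ
      rw [Submodule.map_smul''] at this
      exact Submodule.smul_mono le_rfl le_top this
    obtain ⟨κ', h5, h6⟩ := h _ h4
    have : μ = (s + κ') + (μ - s - κ') := by abel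
    rw [this]
    exact add_mem (Submodule.mem_sup_left (add_mem (Submodule.mem_sup_left hs)
      (Submodule.mem_sup_right h5))) (Submodule.mem_sup_right h6)
  have h7 : κ ∈ maximalIdeal A • Submodule.span A (Set.range v) ⊔
      maximalIdeal A • LinearMap.ker φ := by
    rw [← Submodule.smul_sup, hspan]
    exact hκ'
  obtain ⟨s, hs, k, hk, rfl⟩ := Submodule.mem_sup.mp h7
  have hk0 : φ k = 0 := Submodule.smul_le_right hk
  have hs0 : φ s = 0 := by simpa [hk0] using hκ
  have : s = 0 := by
    obtain ⟨c, rfl⟩ := (Finsupp.mem_span_range_iff_exists_finsupp).mp (Submodule.smul_le_right hs)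
    have hc : c = 0 := by
      apply (linearIndependent_iff.mp hli) c
      simpa [Finsupp.linearCombination_apply, map_finsuppSum] using hs0
    simp [hc]
  simpa [this] using hk

/-! ### Restriction to the central fibre -/

section Fibre
variable {A S : Type} [CommRing A] [Algebra ℂ A] [IsLocalRing A] [Module.Finite ℂ A]
  [CommRing S] [Algebra ℂ S]

variable (A S) in
/-- Let `S = O n`. Since `A` is finite over `ℂ`, `A ⊗ S` is the local ring of `ℂⁿ × Spec A` at its
closed point over the origin. This is the restriction `A ⊗ S → S` of functions to the central
fibre; its kernel is generated by the maximal ideal of `A`. -/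
def fibreMap : A ⊗[ℂ] S →ₐ[ℂ] S :=
  Algebra.TensorProduct.lift ((Algebra.ofId ℂ S).comp (residueHom A)) (AlgHom.id ℂ S)
    fun _ _ => Commute.all _ _

@[simp]
theorem fibreMap_tmul (a : A) (s : S) : fibreMap A S (a ⊗ₜ s) = residueHom A a • s := by
  simp [fibreMap, Algebra.smul_def, Algebra.ofId_apply]

theorem fibreMap_surjective : Function.Surjective (fibreMap A S) := fun s => ⟨1 ⊗ₜ s, by simp⟩

theorem fibreMap_smul (a : A) (z : A ⊗[ℂ] S) :
    fibreMap A S (a • z) = residueHom A a • fibreMap A S z := by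
  induction z using TensorProduct.induction_on with
  | zero => simp
  | tmul b s => simp [TensorProduct.smul_tmul', mul_smul]
  | add x y hx hy => rw [smul_add, map_add, hx, hy, map_add, smul_add]

theorem sub_fibreMap_mem (z : A ⊗[ℂ] S) :
    z - 1 ⊗ₜ fibreMap A S z ∈ maximalIdeal A • (⊤ : Submodule A (A ⊗[ℂ] S)) := by
  induction z using TensorProduct.induction_on with
  | zero => simp
  | tmul a s =>
    have : a ⊗ₜ[ℂ] s - 1 ⊗ₜ fibreMap A S (a ⊗ₜ s) =
        (a - algebraMap ℂ A (residueHom A a)) • ((1 : A) ⊗ₜ[ℂ] s) := by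
      rw [fibreMap_tmul, sub_smul, TensorProduct.smul_tmul', TensorProduct.smul_tmul',
        TensorProduct.tmul_smul, TensorProduct.smul_tmul']
      simp [Algebra.smul_def]
    rw [this]
    exact Submodule.smul_mem_smul (residueHom_eq_zero.mp (by simp)) trivial
  | add x y hx hy =>
    rw [map_add, TensorProduct.tmul_add, add_sub_add_comm]
    exact add_mem hx hy

theorem fibreMap_eq_zero {z : A ⊗[ℂ] S} (h : z ∈ maximalIdeal A • (⊤ : Submodule A (A ⊗[ℂ] S))) :
    fibreMap A S z = 0 := by
  refine Submodule.smul_induction_on h (fun r hr n _ => ?_) (fun x y hx hy => ?_)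
  · rw [fibreMap_smul, residueHom_eq_zero.mpr hr, zero_smul]
  · rw [map_add, hx, hy, add_zero]

/-- The restriction of a relative vector field to the central fibre. -/
def restrictDer (δ : Derivation A (A ⊗[ℂ] S) (A ⊗[ℂ] S)) : Derivation ℂ S S :=
  Derivation.mk' ((fibreMap A S).toLinearMap ∘ₗ (δ : A ⊗[ℂ] S →ₗ[A] A ⊗[ℂ] S).restrictScalars ℂ ∘ₗ
    (Algebra.TensorProduct.includeRight : S →ₐ[ℂ] A ⊗[ℂ] S).toLinearMap) fun a b => by
      have : ((1 : A) ⊗ₜ[ℂ] (a * b)) = (1 ⊗ₜ a) * (1 ⊗ₜ b) := by simp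
      simp [this, -Algebra.TensorProduct.tmul_mul_tmul]

theorem restrictDer_apply (δ : Derivation A (A ⊗[ℂ] S) (A ⊗[ℂ] S)) (s : S) :
    restrictDer δ s = fibreMap A S (δ (1 ⊗ₜ s)) := rfl

theorem restrictDer_fibreMap (δ : Derivation A (A ⊗[ℂ] S) (A ⊗[ℂ] S)) (z : A ⊗[ℂ] S) :
    restrictDer δ (fibreMap A S z) = fibreMap A S (δ z) := by
  rw [restrictDer_apply, ← sub_eq_zero, ← map_sub, ← map_sub]
  apply fibreMap_eq_zero
  have := Submodule.mem_map_of_mem (f := (δ : A ⊗[ℂ] S →ₗ[A] A ⊗[ℂ] S))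
    (neg_mem (sub_fibreMap_mem z))
  rw [Submodule.map_smul'', neg_sub] at this
  exact Submodule.smul_mono le_rfl le_top this

/-- The extension of a vector field that is constant along the base. -/
def extendDer (A : Type) [CommRing A] [Algebra ℂ A] (d : Derivation ℂ S S) :
    Derivation A (A ⊗[ℂ] S) (A ⊗[ℂ] S) :=
  Derivation.mk' ((d : S →ₗ[ℂ] S).baseChange A) fun x y => by
    induction x using TensorProduct.induction_on with
    | zero => simp
    | add x x' hx hx' => simp only [add_mul, map_add, hx, hx', add_smul, smul_add]; abel
    | tmul a s =>
      induction y using TensorProduct.induction_on with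
      | zero => simp
      | add y y' hy hy' => simp only [mul_add, map_add, hy, hy', add_smul, smul_add]; abel
      | tmul b t =>
        simp [TensorProduct.tmul_add, mul_comm b a]

theorem extendDer_tmul (d : Derivation ℂ S S) (a : A) (s : S) :
    extendDer A d (a ⊗ₜ s) = a ⊗ₜ d s := rfl

theorem der_sum_apply {B T ι : Type} [CommRing B] [CommRing T] [Algebra B T] (s : Finset ι)
    (D : ι → Derivation B T T) (x : T) : (∑ i ∈ s, D i) x = ∑ i ∈ s, D i x := by
  classical
  induction s using Finset.induction_on with
  | empty => simp
  | insert i s hi ih => rw [Finset.sum_insert hi, Finset.sum_insert hi, Derivation.add_apply, ih]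

theorem der_ext {B : Type} [CommRing B] [Algebra ℂ B] {δ δ' : Derivation B (B ⊗[ℂ] S) (B ⊗[ℂ] S)}
    (h : ∀ s : S, δ (1 ⊗ₜ s) = δ' (1 ⊗ₜ s)) : δ = δ' := by
  ext z
  induction z using TensorProduct.induction_on with
  | zero => simp
  | add x y hx hy => rw [map_add, map_add, hx, hy]
  | tmul a s =>
    have : a ⊗ₜ[ℂ] s = a • ((1 : B) ⊗ₜ[ℂ] s) := by simp [TensorProduct.smul_tmul']
    rw [this, Derivation.map_smul, Derivation.map_smul, h]

theorem exists_der_decomp {ι : Type} [Fintype ι] (b : Module.Basis ι ℂ A)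
    (δ : Derivation A (A ⊗[ℂ] S) (A ⊗[ℂ] S)) :
    ∃ d : ι → Derivation ℂ S S, δ = ∑ i, b i • extendDer A (d i) := by
  let p (i : ι) : A ⊗[ℂ] S →ₗ[ℂ] S := TensorProduct.lid ℂ S ∘ₗ (b.coord i).rTensor S
  have hp : ∀ i a s, p i (a ⊗ₜ s) = b.coord i a • s := fun i a s => by simp [p]
  have hmul : ∀ i (s : S) (z : A ⊗[ℂ] S), p i ((1 ⊗ₜ s) * z) = s * p i z := by
    intro i s z
    induction z using TensorProduct.induction_on with
    | zero => simp
    | add x y hx hy => rw [mul_add, map_add, hx, hy, map_add, mul_add]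
    | tmul a t => rw [Algebra.TensorProduct.tmul_mul_tmul, hp, hp, one_mul, mul_smul_comm]
  have hsum : ∀ z : A ⊗[ℂ] S, z = ∑ i, b i ⊗ₜ p i z := by
    intro z
    induction z using TensorProduct.induction_on with
    | zero => simp
    | add x y hx hy =>
      simp only [map_add, TensorProduct.tmul_add, Finset.sum_add_distrib, ← hx, ← hy]
    | tmul a t =>
      simp only [hp, ← TensorProduct.smul_tmul, ← TensorProduct.sum_tmul]
      rw [show ∑ i, b.coord i a • b i = a from b.sum_repr a]
  let d (i : ι) : Derivation ℂ S S := Derivation.mk' (p i ∘ₗ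
    (δ : A ⊗[ℂ] S →ₗ[A] A ⊗[ℂ] S).restrictScalars ℂ ∘ₗ
    (Algebra.TensorProduct.includeRight : S →ₐ[ℂ] A ⊗[ℂ] S).toLinearMap) fun s t => by
      have : ((1 : A) ⊗ₜ[ℂ] (s * t)) = (1 ⊗ₜ s) * (1 ⊗ₜ t) := by simp
      simp [this, hmul, -Algebra.TensorProduct.tmul_mul_tmul]
  refine ⟨d, der_ext fun s => ?_⟩
  conv_lhs => rw [hsum (δ (1 ⊗ₜ s))]
  rw [der_sum_apply]
  refine Finset.sum_congr rfl fun i _ => ?_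
  rw [Derivation.smul_apply, extendDer_tmul, TensorProduct.smul_tmul', smul_eq_mul, mul_one]
  rfl

theorem mem_smul_of_restrictDer_eq_zero {δ : Derivation A (A ⊗[ℂ] S) (A ⊗[ℂ] S)}
    (h : restrictDer δ = 0) :
    δ ∈ maximalIdeal A • (⊤ : Submodule A (Derivation A (A ⊗[ℂ] S) (A ⊗[ℂ] S))) := by
  obtain ⟨d, hd⟩ := exists_der_decomp (Module.finBasis ℂ A) δ
  set b := Module.finBasis ℂ A
  have h0 : ∀ s, ∑ i, residueHom A (b i) • d i s = 0 := fun s => by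
    have := DFunLike.congr_fun h s
    rw [restrictDer_apply, hd, der_sum_apply, map_sum] at this
    simpa [fibreMap_smul, extendDer_tmul] using this
  have h1 : δ = ∑ i, (b i - algebraMap ℂ A (residueHom A (b i))) • extendDer A (d i) := by
    rw [Finset.sum_congr rfl fun i _ => sub_smul (b i) _ (extendDer A (d i)),
      Finset.sum_sub_distrib, ← hd]
    rw [eq_comm, sub_eq_self]
    refine der_ext fun s => ?_
    rw [der_sum_apply]
    simp only [Derivation.smul_apply, extendDer_tmul, algebraMap_smul, ← TensorProduct.tmul_smul,
      ← TensorProduct.tmul_sum, h0]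
    simp
  rw [h1]
  exact sum_mem fun i _ => Submodule.smul_mem_smul (residueHom_eq_zero.mp (by simp)) trivial

/-- Let `X = V(I)` be a subgerm of `ℂⁿ × Spec A`, with central fibre `X_s` defined by the image of `I`
in `S = O n`, and let `m` be the maximal ideal of `A`. The condition is that restriction to the
central fibre induces a bijection from `Der(-log X/Spec A) / m Der(-log X/Spec A)` onto
`Der(-log X_s)`: the first clause is surjectivity, the second one is injectivity. -/
def IsAdmissible (I : Ideal (A ⊗[ℂ] S)) : Prop :=
  (∀ d ∈ logDer ℂ S (I.map (fibreMap A S)),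
    ∃ δ ∈ logDer A (A ⊗[ℂ] S) I, restrictDer δ = d) ∧
  ∀ δ ∈ logDer A (A ⊗[ℂ] S) I, restrictDer δ = 0 →
    δ ∈ maximalIdeal A • (logDer A (A ⊗[ℂ] S) I).restrictScalars A

theorem exists_of_mem_map {I : Ideal (A ⊗[ℂ] S)} {s : S} (hs : s ∈ I.map (fibreMap A S)) :
    ∃ z ∈ I, fibreMap A S z = s := by
  simpa using (Ideal.mem_map_iff_of_surjective _ fibreMap_surjective).mp hs

theorem restrictDer_mem {I : Ideal (A ⊗[ℂ] S)} {δ : Derivation A (A ⊗[ℂ] S) (A ⊗[ℂ] S)}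
    (hδ : δ ∈ logDer A (A ⊗[ℂ] S) I) : restrictDer δ ∈ logDer ℂ S (I.map (fibreMap A S)) := by
  intro s hs
  obtain ⟨z, hz, rfl⟩ := exists_of_mem_map hs
  rw [restrictDer_fibreMap]
  exact Ideal.mem_map_of_mem _ (hδ z hz)

theorem flat_pi (A Q ι : Type) [CommRing A] [AddCommGroup Q] [Module A Q] [Module.Flat A Q]
    [Finite ι] : Module.Flat A (ι → Q) := by
  classical
  have := Fintype.ofFinite ι
  exact Module.Flat.of_linearEquiv (DFinsupp.linearEquivFunOnFintype (R := A)
    (M := fun _ : ι => Q)).symm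

theorem isAdmissible_of_surjective {I : Ideal (A ⊗[ℂ] S)} (hfg : I.FG)
    [Module.Flat A ((A ⊗[ℂ] S) ⧸ I)]
    (h : ∀ d ∈ logDer ℂ S (I.map (fibreMap A S)),
      ∃ δ ∈ logDer A (A ⊗[ℂ] S) I, restrictDer δ = d) : IsAdmissible I := by
  refine ⟨h, fun δ hδ hδ0 => ?_⟩
  obtain ⟨G, rfl⟩ := hfg
  set I := Ideal.span (G : Set (A ⊗[ℂ] S)) with hI
  have hgen : ∀ δ : Derivation A (A ⊗[ℂ] S) (A ⊗[ℂ] S), (∀ g ∈ G, δ g ∈ I) → ∀ g ∈ I, δ g ∈ I := by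
    intro δ h g hg
    induction hg using Submodule.span_induction with
    | mem x hx => exact h x hx
    | zero => simp
    | add x y _ _ hx hy => rw [map_add]; exact add_mem hx hy
    | smul a x hx' hx =>
      rw [smul_eq_mul, Derivation.leibniz]
      exact add_mem (I.mul_mem_left _ hx) (I.mul_mem_right _ hx')
  let φ : Derivation A (A ⊗[ℂ] S) (A ⊗[ℂ] S) →ₗ[A] (G → (A ⊗[ℂ] S) ⧸ I) :=
    { toFun := fun δ g => Ideal.Quotient.mk I (δ g)
      map_add' := fun x y => by ext; simp
      map_smul' := fun a x => by ext; rfl }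
  have hφ : LinearMap.ker φ = (logDer A (A ⊗[ℂ] S) I).restrictScalars A := by
    ext δ
    constructor
    · intro h
      refine hgen δ fun g hg => Ideal.Quotient.eq_zero_iff_mem.mp ?_
      exact congrFun (LinearMap.mem_ker.mp h) ⟨g, hg⟩
    · intro h
      rw [LinearMap.mem_ker]
      ext g
      exact Ideal.Quotient.eq_zero_iff_mem.mpr (h g (Ideal.subset_span g.2))
  rw [← hφ]
  have : Module.Flat A (G → (A ⊗[ℂ] S) ⧸ I) := flat_pi _ _ _
  refine mem_smul_ker isNilpotent_maximalIdeal φ (fun μ hμ => ?_)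
    (LinearMap.mem_ker.mp (hφ ▸ hδ)) (mem_smul_of_restrictDer_eq_zero hδ0)
  have hμg : ∀ g ∈ G, fibreMap A S (μ g) ∈ I.map (fibreMap A S) := fun g hg => by
    have h1 : Ideal.Quotient.mk I (μ g) ∈ maximalIdeal A • (⊤ : Submodule A ((A ⊗[ℂ] S) ⧸ I)) := by
      have := Submodule.mem_map_of_mem
        (f := (LinearMap.proj ⟨g, hg⟩ : (G → (A ⊗[ℂ] S) ⧸ I) →ₗ[A] _)) hμ
      rw [Submodule.map_smul''] at this
      exact Submodule.smul_mono le_rfl le_top this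
    have h2 : (⊤ : Submodule A ((A ⊗[ℂ] S) ⧸ I)) =
        (⊤ : Submodule A (A ⊗[ℂ] S)).map (Ideal.Quotient.mkₐ A I).toLinearMap := by
      rw [Submodule.map_top, eq_comm, LinearMap.range_eq_top]
      exact Ideal.Quotient.mk_surjective
    rw [h2, ← Submodule.map_smul''] at h1
    obtain ⟨z, hz, hz'⟩ := h1
    have h3 : μ g - z ∈ I := by
      rw [← Ideal.Quotient.eq]
      exact hz'.symm
    have := Ideal.mem_map_of_mem (fibreMap A S) h3
    rwa [map_sub, fibreMap_eq_zero hz, sub_zero] at this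
  have hlog : restrictDer μ ∈ logDer ℂ S (I.map (fibreMap A S)) := by
    intro s hs
    obtain ⟨z, hz, rfl⟩ := exists_of_mem_map hs
    rw [restrictDer_fibreMap]
    clear hs
    induction hz using Submodule.span_induction with
    | mem x hx => exact hμg x hx
    | zero => simp
    | add x y _ _ hx hy => rw [map_add, map_add]; exact add_mem hx hy
    | smul a x hx' hx =>
      rw [smul_eq_mul, Derivation.leibniz, smul_eq_mul, smul_eq_mul, map_add, map_mul, map_mul]
      exact add_mem (Ideal.mul_mem_left _ _ hx)
        (Ideal.mul_mem_right _ _ (Ideal.mem_map_of_mem _ hx'))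
  obtain ⟨κ, hκ, hκ'⟩ := h _ hlog
  refine ⟨κ, LinearMap.mem_ker.mp (hφ ▸ hκ), mem_smul_of_restrictDer_eq_zero ?_⟩
  ext s
  have := DFunLike.congr_fun hκ' s
  rw [restrictDer_apply, restrictDer_apply] at this
  simp [restrictDer_apply, this]

end Fibre

/-! ### Base change -/

section BaseChange
variable {A B S : Type} [CommRing A] [Algebra ℂ A] [IsLocalRing A] [Module.Finite ℂ A]
  [CommRing B] [Algebra ℂ B] [IsLocalRing B] [Module.Finite ℂ B] [CommRing S] [Algebra ℂ S]

variable (S) in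
/-- The map of ambient rings `A ⊗ S → B ⊗ S` given by a change of base. -/
def changeMap (g : A →ₐ[ℂ] B) : A ⊗[ℂ] S →ₐ[ℂ] B ⊗[ℂ] S :=
  Algebra.TensorProduct.map g (AlgHom.id ℂ S)

theorem fibreMap_comp_changeMap (g : A →ₐ[ℂ] B) :
    (fibreMap B S).comp (changeMap S g) = fibreMap A S := by
  have : ∀ a, residueHom B (g a) = residueHom A a := fun a =>
    DFunLike.congr_fun (residueHom_unique ((residueHom B).comp g)) a
  apply AlgHom.ext
  intro z
  induction z using TensorProduct.induction_on with
  | zero => simp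
  | add x y hx hy => rw [map_add, hx, hy, map_add]
  | tmul a s => simp [changeMap, this]

theorem fibreMap_changeMap (g : A →ₐ[ℂ] B) (z : A ⊗[ℂ] S) :
    fibreMap B S (changeMap S g z) = fibreMap A S z :=
  DFunLike.congr_fun (fibreMap_comp_changeMap g) z

theorem map_map_changeMap (g : A →ₐ[ℂ] B) (I : Ideal (A ⊗[ℂ] S)) :
    (I.map (changeMap S g)).map (fibreMap B S) = I.map (fibreMap A S) := by
  rw [← fibreMap_comp_changeMap g]
  exact Ideal.map_mapₐ (changeMap S g) (fibreMap B S)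

section Generic
variable {Q Q' : Type} [Algebra A B] [IsScalarTower ℂ A B] [CommRing Q] [Algebra A Q]
  [CommRing Q'] [Algebra B Q']

theorem exists_changeEquiv (π : A ⊗[ℂ] S →ₐ[A] Q) (π' : B ⊗[ℂ] S →ₐ[B] Q')
    (h : Function.Surjective π) (h' : Function.Surjective π')
    (hker : RingHom.ker π' = (RingHom.ker π).map (changeMap S (IsScalarTower.toAlgHom ℂ A B))) :
    ∃ e : Q' ≃ₐ[B] B ⊗[A] Q, ∀ b s, e (π' (b ⊗ₜ s)) = b ⊗ₜ π (1 ⊗ₜ s) := by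
  let _ : Algebra ℂ Q := Algebra.compHom Q (algebraMap ℂ A)
  let _ : Algebra ℂ Q' := Algebra.compHom Q' (algebraMap ℂ B)
  let _ : Algebra A Q' := Algebra.compHom Q' (algebraMap A B)
  have : IsScalarTower ℂ A Q := IsScalarTower.of_algebraMap_eq fun _ => rfl
  have : IsScalarTower A B Q' := IsScalarTower.of_algebraMap_eq fun _ => rfl
  let c : (A ⊗[ℂ] S) →ₐ[A] (B ⊗[ℂ] S) := Algebra.TensorProduct.map (Algebra.ofId A B) (AlgHom.id ℂ S)
  let u : B ⊗[ℂ] S →ₐ[B] B ⊗[A] Q :=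
    Algebra.TensorProduct.lift (Algebra.ofId B _)
      (((Algebra.TensorProduct.includeRight : Q →ₐ[A] B ⊗[A] Q).comp
        π).restrictScalars ℂ |>.comp Algebra.TensorProduct.includeRight) fun _ _ => Commute.all _ _
  have hu : ∀ b s, u (b ⊗ₜ s) = b ⊗ₜ π (1 ⊗ₜ s) := fun b s => by
    simp [u, Algebra.ofId_apply, Algebra.TensorProduct.algebraMap_apply]
  have huc : ∀ z, u (c z) = 1 ⊗ₜ π z := fun z => by
    induction z using TensorProduct.induction_on with
    | zero => simp
    | add x y hx hy => rw [map_add, map_add, hx, hy, map_add, TensorProduct.tmul_add]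
    | tmul a s =>
      have h1 : a ⊗ₜ[ℂ] s = a • ((1 : A) ⊗ₜ[ℂ] s) := by
        rw [TensorProduct.smul_tmul', smul_eq_mul, mul_one]
      change u (algebraMap A B a ⊗ₜ s) = _
      rw [hu, h1, map_smul π, TensorProduct.tmul_smul, TensorProduct.smul_tmul', Algebra.smul_def,
        mul_one]
  have hI : ∀ z ∈ RingHom.ker π', u z = 0 := fun z hz => by
    rw [hker] at hz
    refine Submodule.span_induction (fun x hx => ?_) (map_zero u)
      (fun x y _ _ hx hy => by rw [map_add, hx, hy, add_zero])
      (fun a x _ hx => by rw [smul_eq_mul, map_mul, hx, mul_zero]) hz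
    obtain ⟨z, hz, rfl⟩ := hx
    change u (c z) = 0
    rw [huc, show π z = 0 from hz, TensorProduct.tmul_zero]
  have hw : ∀ z ∈ RingHom.ker π, ((π'.restrictScalars A).comp c) z = 0 := fun z hz => by
    have : c z ∈ RingHom.ker π' := hker ▸ Ideal.mem_map_of_mem (changeMap S _) hz
    exact this
  let w : Q →ₐ[A] Q' := (Ideal.Quotient.liftₐ _ _ hw).comp
    (Ideal.quotientKerAlgEquivOfSurjective h).symm.toAlgHom
  have hwπ : ∀ z, w (π z) = π' (c z) := fun z => by
    have : (Ideal.quotientKerAlgEquivOfSurjective h).symm (π z) =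
        Ideal.Quotient.mk (RingHom.ker π) z := by
      rw [AlgEquiv.symm_apply_eq]; rfl
    change Ideal.Quotient.liftₐ _ _ hw ((Ideal.quotientKerAlgEquivOfSurjective h).symm (π z)) = _
    rw [this]
    rfl
  let V : B ⊗[A] Q →ₐ[B] Q' :=
    Algebra.TensorProduct.lift (Algebra.ofId B _) w fun _ _ => Commute.all _ _
  have hV : ∀ b z, V (b ⊗ₜ π z) = b • π' (c z) := fun b z => by
    rw [Algebra.smul_def, ← hwπ]; exact Algebra.TensorProduct.lift_tmul ..
  let U : Q' →ₐ[B] B ⊗[A] Q := (Ideal.Quotient.liftₐ _ u hI).comp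
    (Ideal.quotientKerAlgEquivOfSurjective h').symm.toAlgHom
  have hU : ∀ z, U (π' z) = u z := fun z => by
    have : (Ideal.quotientKerAlgEquivOfSurjective h').symm (π' z) =
        Ideal.Quotient.mk (RingHom.ker π') z := by
      rw [AlgEquiv.symm_apply_eq]; rfl
    change Ideal.Quotient.liftₐ _ _ hI ((Ideal.quotientKerAlgEquivOfSurjective h').symm (π' z)) = _
    rw [this]
    rfl
  refine ⟨AlgEquiv.ofAlgHom U V ?_ ?_, fun b s => (hU _).trans (hu b s)⟩
  · apply AlgHom.ext
    intro y
    induction y using TensorProduct.induction_on with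
    | zero => simp
    | add x y hx hy => rw [map_add, hx, hy, map_add]
    | tmul b x =>
      obtain ⟨z, rfl⟩ := h x
      change U (V (b ⊗ₜ π z)) = b ⊗ₜ π z
      rw [hV, map_smul, hU, huc, TensorProduct.smul_tmul', smul_eq_mul, mul_one]
  · apply AlgHom.ext
    intro x
    obtain ⟨z, rfl⟩ := h' x
    change V (U (π' z)) = π' z
    rw [hU]
    induction z using TensorProduct.induction_on with
    | zero => simp
    | add x y hx hy => rw [map_add, map_add, hx, hy, map_add]
    | tmul b s =>
      rw [hu, hV, ← map_smul]
      congr 1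
      simp [c, TensorProduct.smul_tmul']

theorem flat_change (π : A ⊗[ℂ] S →ₐ[A] Q) (π' : B ⊗[ℂ] S →ₐ[B] Q')
    (h : Function.Surjective π) (h' : Function.Surjective π')
    (hker : RingHom.ker π' = (RingHom.ker π).map (changeMap S (IsScalarTower.toAlgHom ℂ A B)))
    [Module.Flat A Q] : Module.Flat B Q' := by
  obtain ⟨e, -⟩ := exists_changeEquiv π π' h h' hker
  exact Module.Flat.of_linearEquiv e.toLinearEquiv

end Generic

theorem restrictDer_change (g : A →ₐ[ℂ] B) (δ : Derivation A (A ⊗[ℂ] S) (A ⊗[ℂ] S)) :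
  ∃ δ' : Derivation B (B ⊗[ℂ] S) (B ⊗[ℂ] S), ∀ z, δ' (changeMap S g z) = changeMap S g (δ z) := by
  obtain ⟨d, hd⟩ := exists_der_decomp (Module.finBasis ℂ A) δ
  refine ⟨∑ i, g (Module.finBasis ℂ A i) • extendDer B (d i), fun z => ?_⟩
  conv_rhs => rw [hd]
  rw [der_sum_apply, der_sum_apply, map_sum]
  refine Finset.sum_congr rfl fun i _ => ?_
  rw [Derivation.smul_apply, Derivation.smul_apply]
  induction z using TensorProduct.induction_on with
  | zero => simp
  | add x y hx hy => rw [map_add, map_add, smul_add, hx, hy, map_add, smul_add, map_add]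
  | tmul a s =>
    rw [extendDer_tmul, TensorProduct.smul_tmul']
    simp only [changeMap, Algebra.TensorProduct.map_tmul, AlgHom.coe_id, id_eq, extendDer_tmul,
      TensorProduct.smul_tmul', smul_eq_mul, map_mul]

end BaseChange

theorem IsAdmissible.change {A B S : Type} [CommRing A] [Algebra ℂ A] [IsLocalRing A]
    [Module.Finite ℂ A] [CommRing B] [Algebra ℂ B] [IsLocalRing B] [Module.Finite ℂ B]
    [CommRing S] [Algebra ℂ S] (g : A →ₐ[ℂ] B) {I : Ideal (A ⊗[ℂ] S)} (hI : IsAdmissible I)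
    (hfg : I.FG) [Module.Flat B ((B ⊗[ℂ] S) ⧸ I.map (changeMap S g))] :
    IsAdmissible (I.map (changeMap S g)) := by
  refine isAdmissible_of_surjective (hfg.map _) fun d hd => ?_
  rw [map_map_changeMap] at hd
  obtain ⟨δ, hδ, rfl⟩ := hI.1 d hd
  obtain ⟨δ', h⟩ := restrictDer_change g δ
  refine ⟨δ', fun z hz => ?_, ?_⟩
  · induction hz using Submodule.span_induction with
    | mem x hx =>
      obtain ⟨y, hy, rfl⟩ := hx
      change δ' (changeMap S g y) ∈ _
      rw [h]
      exact Ideal.mem_map_of_mem _ (hδ y hy)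
    | zero => simp
    | add x y _ _ hx hy => rw [map_add]; exact add_mem hx hy
    | smul a x hx' hx =>
      rw [smul_eq_mul, Derivation.leibniz]
      exact add_mem (Ideal.mul_mem_left _ _ hx) (Ideal.mul_mem_right _ _ hx')
  · ext s
    have h1 := h (1 ⊗ₜ s)
    rw [show changeMap S g (1 ⊗ₜ s) = 1 ⊗ₜ s by simp [changeMap]] at h1
    rw [restrictDer_apply, restrictDer_apply, h1, fibreMap_changeMap]

variable {S : Type} [CommRing S] [Algebra ℂ S]

/-! ### Admissible deformations -/

/-- An admissible deformation over `Spec A` of the germ `V(D)`, for `S = O n`. The total space is a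
closed subgerm `X` of `ℂⁿ × Spec A`, flat over `Spec A`, together with an isomorphism `special`
between `V(D)` and the central fibre `X_s` (given on rings of functions), such that the condition on
logarithmic vector fields holds. Ideals of rings of germs are finitely generated, so the field `fg`
only records that a germ of a complex space is cut out by finitely many equations. -/
structure Deformation (D : Ideal S) (A : Art) where
  ideal : Ideal (A ⊗[ℂ] S)
  fg : ideal.FG
  flat : Module.Flat A ((A ⊗[ℂ] S) ⧸ ideal)
  special : (S ⧸ D) ≃ₐ[ℂ] S ⧸ ideal.map (fibreMap A S)
  admissible : IsAdmissible ideal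

namespace Deformation
variable {D : Ideal S} {A B C : Art}

/-- The closed embedding of the special fibre `V(D)` in the total space, on rings of functions. -/
def embedding (X : Deformation D A) : ((A ⊗[ℂ] S) ⧸ X.ideal) →ₐ[ℂ] S ⧸ D :=
  X.special.symm.toAlgHom.comp
    (Ideal.quotientMapₐ (X.ideal.map (fibreMap A S)) (fibreMap A S) Ideal.le_comap_map)

theorem embedding_mk (X : Deformation D A) (z : A ⊗[ℂ] S) :
    X.embedding (Ideal.Quotient.mk _ z) = X.special.symm (Ideal.Quotient.mk _ (fibreMap A S z)) :=
  rfl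

/-- Isomorphism of deformations over the same base: an isomorphism of total spaces over `Spec A` that
is compatible with the embeddings of `V(D)`. -/
def Iso (X Y : Deformation D A) : Prop :=
  ∃ τ : ((A ⊗[ℂ] S) ⧸ Y.ideal) ≃ₐ[A] ((A ⊗[ℂ] S) ⧸ X.ideal),
    ∀ z, X.embedding (τ z) = Y.embedding z

theorem Iso.refl (X : Deformation D A) : X.Iso X := ⟨AlgEquiv.refl, fun _ => rfl⟩

theorem Iso.symm {X Y : Deformation D A} : X.Iso Y → Y.Iso X := fun ⟨τ, h⟩ =>
  ⟨τ.symm, fun z => by rw [← h, AlgEquiv.apply_symm_apply]⟩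

theorem Iso.trans {X Y Z : Deformation D A} : X.Iso Y → Y.Iso Z → X.Iso Z :=
  fun ⟨τ, h⟩ ⟨τ', h'⟩ => ⟨τ'.trans τ, fun z => by rw [AlgEquiv.trans_apply, h, h']⟩

theorem iso_of_eq {X Y : Deformation D A} (h : X.ideal = Y.ideal)
    (h' : ∀ z : A ⊗[ℂ] S, X.embedding (Ideal.Quotient.mk _ z) =
      Y.embedding (Ideal.Quotient.mk _ z)) : X.Iso Y := by
  refine ⟨Ideal.quotientEquivAlgOfEq A h.symm, fun z => ?_⟩
  obtain ⟨z, rfl⟩ := Ideal.Quotient.mk_surjective z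
  exact h' z

instance setoid (D : Ideal S) (A : Art) : Setoid (Deformation D A) :=
  ⟨Iso, Iso.refl, Iso.symm, Iso.trans⟩

theorem ker_mkA (A : Type) [CommRing A] [Algebra ℂ A] (I : Ideal (A ⊗[ℂ] S)) :
    RingHom.ker (Ideal.Quotient.mkₐ A I) = I := by
  ext z
  exact Ideal.Quotient.eq_zero_iff_mem

theorem flat_baseChange (X : Deformation D A) (g : A →ₐ[ℂ] B) :
    Module.Flat B ((B ⊗[ℂ] S) ⧸ X.ideal.map (changeMap S g)) := by
  algebraize [g.toRingHom]
  have : IsScalarTower ℂ A B := IsScalarTower.of_algebraMap_eq fun x => (g.commutes x).symm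
  have := X.flat
  refine flat_change (A := A) (Ideal.Quotient.mkₐ A X.ideal) (Ideal.Quotient.mkₐ B _)
    Ideal.Quotient.mk_surjective Ideal.Quotient.mk_surjective ?_
  rw [ker_mkA, ker_mkA]
  rfl

/-- The pull-back of an admissible deformation along `Spec B → Spec A`. -/
def baseChange (X : Deformation D A) (g : A →ₐ[ℂ] B) : Deformation D B where
  ideal := X.ideal.map (changeMap S g)
  fg := X.fg.map _
  flat := X.flat_baseChange g
  special := X.special.trans (Ideal.quotientEquivAlgOfEq ℂ (map_map_changeMap g X.ideal).symm)
  admissible := by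
    have := X.flat_baseChange g
    exact X.admissible.change g X.fg

theorem special_symm_baseChange (X : Deformation D A) (g : A →ₐ[ℂ] B) (s : S) :
    (X.baseChange g).special.symm (Ideal.Quotient.mk _ s) =
      X.special.symm (Ideal.Quotient.mk _ s) := rfl

theorem embedding_baseChange (X : Deformation D A) (g : A →ₐ[ℂ] B) (z : B ⊗[ℂ] S) :
    (X.baseChange g).embedding (Ideal.Quotient.mk _ z) =
      X.special.symm (Ideal.Quotient.mk _ (fibreMap B S z)) := rfl

theorem Iso.baseChange {X Y : Deformation D A} (h : X.Iso Y) (g : A →ₐ[ℂ] B) :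
    (X.baseChange g).Iso (Y.baseChange g) := by
  obtain ⟨τ, hτ⟩ := h
  algebraize [g.toRingHom]
  have : IsScalarTower ℂ A B := IsScalarTower.of_algebraMap_eq fun x => (g.commutes x).symm
  have key : ∀ Z : Deformation D A, ∃ e : ((B ⊗[ℂ] S) ⧸ (Z.baseChange g).ideal) ≃ₐ[B]
      B ⊗[A] ((A ⊗[ℂ] S) ⧸ Z.ideal),
      ∀ b s, e (Ideal.Quotient.mk _ (b ⊗ₜ s)) = b ⊗ₜ Ideal.Quotient.mk _ (1 ⊗ₜ s) := by
    intro Z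
    refine exists_changeEquiv (A := A) (Ideal.Quotient.mkₐ A Z.ideal) (Ideal.Quotient.mkₐ B _)
      Ideal.Quotient.mk_surjective Ideal.Quotient.mk_surjective ?_
    rw [ker_mkA, ker_mkA]
    rfl
  have key2 : ∀ (Z : Deformation D A) (e : ((B ⊗[ℂ] S) ⧸ (Z.baseChange g).ideal) ≃ₐ[B]
      B ⊗[A] ((A ⊗[ℂ] S) ⧸ Z.ideal)),
      (∀ b s, e (Ideal.Quotient.mk _ (b ⊗ₜ s)) = b ⊗ₜ Ideal.Quotient.mk _ (1 ⊗ₜ s)) →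
      ∀ b z, (Z.baseChange g).embedding (e.symm (b ⊗ₜ z)) = residueHom B b • Z.embedding z := by
    intro Z e he b z
    obtain ⟨z, rfl⟩ := Ideal.Quotient.mk_surjective z
    have h1 : ∀ z, e (Ideal.Quotient.mk _ (changeMap S g z)) =
        (1 : B) ⊗ₜ[A] Ideal.Quotient.mk Z.ideal z := by
      intro z
      induction z using TensorProduct.induction_on with
      | zero => simp
      | add x y hx hy =>
        rw [map_add (changeMap S g), map_add (Ideal.Quotient.mk _), map_add e, hx, hy,
          map_add (Ideal.Quotient.mk _), TensorProduct.tmul_add]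
      | tmul a s =>
        have h2 : Ideal.Quotient.mk Z.ideal (a ⊗ₜ s) =
            a • Ideal.Quotient.mk Z.ideal ((1 : A) ⊗ₜ s) := by
          have : a ⊗ₜ[ℂ] s = a • ((1 : A) ⊗ₜ[ℂ] s) := by
            rw [TensorProduct.smul_tmul', smul_eq_mul, mul_one]
          rw [this]; rfl
        rw [h2, TensorProduct.tmul_smul, TensorProduct.smul_tmul', Algebra.smul_def, mul_one]
        exact he _ _
    have h3 : e.symm (b ⊗ₜ Ideal.Quotient.mk Z.ideal z) =
        Ideal.Quotient.mk _ (b • changeMap S g z) := by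
      rw [AlgEquiv.symm_apply_eq]
      change _ = e (b • Ideal.Quotient.mk _ (changeMap S g z))
      rw [map_smul, h1, TensorProduct.smul_tmul', smul_eq_mul, mul_one]
    rw [h3, embedding_baseChange, embedding_mk, fibreMap_smul, fibreMap_changeMap]
    exact map_smul Z.special.symm (residueHom B b) (Ideal.Quotient.mk _ (fibreMap A S z))
  obtain ⟨eX, hX⟩ := key X
  obtain ⟨eY, hY⟩ := key Y
  refine ⟨(eY.trans (Algebra.TensorProduct.congr AlgEquiv.refl τ)).trans eX.symm, fun z => ?_⟩
  obtain ⟨y, rfl⟩ := eY.symm.surjective z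
  simp only [AlgEquiv.trans_apply, AlgEquiv.apply_symm_apply]
  induction y using TensorProduct.induction_on with
  | zero => simp
  | add x y hx hy => simp only [map_add, hx, hy]
  | tmul b x =>
    rw [Algebra.TensorProduct.congr_apply, Algebra.TensorProduct.map_tmul, key2 Y eY hY, ← hτ]
    exact key2 X eX hX _ _

theorem baseChange_id (X : Deformation D A) : (X.baseChange (AlgHom.id ℂ A)).Iso X := by
  have : changeMap S (AlgHom.id ℂ A) = AlgHom.id ℂ _ := by ext <;> simp [changeMap]
  refine iso_of_eq ?_ fun z => ?_
  swap
  · rw [embedding_baseChange, embedding_mk]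
  change X.ideal.map (changeMap S (AlgHom.id ℂ A)) = _
  rw [this]
  exact Ideal.map_id _

theorem baseChange_comp (X : Deformation D A) (g : A →ₐ[ℂ] B) (h : B →ₐ[ℂ] C) :
    (X.baseChange (h.comp g)).Iso ((X.baseChange g).baseChange h) := by
  have : changeMap S (h.comp g) = (changeMap S h).comp (changeMap S g) := by
    ext <;> simp [changeMap]
  refine iso_of_eq ?_ fun z => ?_
  swap
  · rw [embedding_baseChange, embedding_baseChange, special_symm_baseChange]
  change X.ideal.map (changeMap S (h.comp g)) = (X.ideal.map (changeMap S g)).map (changeMap S h)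
  rw [this]
  exact (Ideal.map_mapₐ (changeMap S g) (changeMap S h)).symm

end Deformation

/-- The functor of isomorphism classes of admissible deformations of the germ `V(D)`, on local Artin
algebras. -/
def FD (D : Ideal S) : Art ⥤ Type where
  obj A := Quotient (Deformation.setoid D A)
  map {A B} g := ↾(Quotient.map (fun X : Deformation D A => X.baseChange (show A →ₐ[ℂ] B from g))
    fun _ _ h => h.baseChange _)
  map_id A := by
    ext x
    induction x using Quotient.ind
    exact Quotient.sound (Deformation.baseChange_id _)
  map_comp g h := by
    ext x
    induction x using Quotient.ind
    exact Quotient.sound (Deformation.baseChange_comp _ _ _)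

/-! ### Hulls -/

/-- The functor `A ↦ Hom(R, A)` on local Artin algebras. If `R` is a complete local algebra with
residue field `ℂ`, every algebra homomorphism from `R` to such an `A` is local and continuous. -/
def homFunctor (R : Type) [CommRing R] [Algebra ℂ R] : Art ⥤ Type where
  obj A := R →ₐ[ℂ] A
  map {A B} g := ↾(fun u : R →ₐ[ℂ] A => (show A →ₐ[ℂ] B from g).comp u)

instance : Module.Finite ℂ (DualNumber ℂ) := inferInstanceAs (Module.Finite ℂ (ℂ × ℂ))

/-- The ring of dual numbers `ℂ[ε]`, `ε² = 0`. -/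
def dualNumbers : Art := ⟨DualNumber ℂ⟩

/-- A morphism of functors `F → G` is smooth if `F(B) → F(A) ×_{G(A)} G(B)` is surjective for every
surjection `B → A` of local Artin algebras. -/
def IsSmooth {F G : Art ⥤ Type} (η : F ⟶ G) : Prop :=
  ∀ (B A : Art) (p : B ⟶ A), Function.Surjective (show B →ₐ[ℂ] A from p) →
    ∀ (a : F.obj A) (y : G.obj B), η.app A a = G.map p y →
      ∃ x : F.obj B, F.map p x = a ∧ η.app B x = y

/-- The functor `F` has a hull: there are a complete Noetherian local `ℂ`-algebra `R` with residue
field `ℂ` and a smooth morphism `Hom(R, -) → F` that is bijective on tangent spaces, i.e. on the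
values at the dual numbers. -/
def HasHull (F : Art ⥤ Type) : Prop :=
  ∃ (R : Type) (_ : CommRing R) (_ : Algebra ℂ R) (_ : IsLocalRing R) (_ : IsNoetherianRing R)
    (_ : IsAdicComplete (maximalIdeal R) R) (_ : Function.Bijective (algebraMap ℂ (ResidueField R)))
    (η : homFunctor R ⟶ F), IsSmooth η ∧ Function.Bijective (η.app dualNumbers)

end FreeDiv
end

/-! Deformations of free divisors have a hull when the divisor is weighted homogeneous.

Over an Artin base `A`, a deformation of the hypersurface germ `f = 0` is given by one equation `F`
that restricts to `f`. Two equations give isomorphic deformations exactly when they differ by a unit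
and by a gauge transformation, a product of exponentials of vector fields over `A` that vanish on the
central fibre (`IsGermFrame.exists_eq_fdMk`, `IsGermFrame.exists_gauge_of_fdMk_eq`). A map of germs has to
be determined by the images of the coordinates; this rests on Hadamard's lemma and on the
separatedness of `O` and `O / (f)` in the adic topology. For weighted homogeneous `f` the latter is
proved by formal division followed by an estimate on polydiscs on which one monomial of `f`
dominates (`exists_rnorm_le_mul`, `mem_span_of_forall_mem_sup`). Gauge transformations lift along
surjections of the base, because vector fields do (`exists_gauge_lift`). So an extension of a
deformation with equation `F` may be given by an equation that extends `F`.

The hull comes from a criterion (`hasHull_of_cover`). Suppose that a family over a complete local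
algebra `P` induces every deformation, in the strong sense that classifying maps lift along small
extensions. Such a family is smooth (`isSmooth_of_isSmallExt`), but some of its tangent vectors may
be trivial. If `F(B ×_ℂ ℂ[ε]) → F(B) × F(ℂ[ε])` is injective, moving a map `P → B` in a trivial
direction does not change the induced deformation. Dividing `P` by equations that cut out a
complement of the trivial directions therefore preserves smoothness and makes the map on tangent vectors
bijective (`exists_equations_of_smooth`). The injectivity holds because infinitesimal coordinate
changes over the dual numbers can be used over any base (`IsGermFrame.injective_dualExt`).

The covering family is an explicit one. The logarithmic vector fields of a weighted homogeneous free
divisor are generated by finitely many weighted homogeneous `δ_i`, with `δ_i f = α_i f`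
(`exists_homogeneous_generators`). The variations of `f`, `δ_i` and `α_i` that preserve the weights
form a finite dimensional space (`finite_variations`). In linear coordinates on this space the
condition that the varied `δ_i` is logarithmic along the varied `f` with the varied factor `α_i` is
a system of polynomial equations of degree at most two. Over the completed ring of its solutions the
varied `f` is an admissible deformation, because generators of the logarithmic vector fields extend
(`isAdmissible_of_generators`).

To lift a classifying map along a small extension, consider an admissible deformation that extends a
member `F` of this family. Up to a unit and a gauge transformation it has the form `F + κ g`. By
admissibility the Euler field lifts to it. Comparing homogeneous components, every component of `g`
of degree different from that of `f` can be removed by a coordinate change, because the Euler field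
acts on such a component by a factor other than the degree of `f` (`exists_gauge_homogeneous`).
Admissibility also lifts the `δ_i`, and the homogeneous components of the corrections of `δ_i` and
`α_i` are the required variations (`IsHomFamily.exists_param`).

A linear free divisor `p = 0` is homogeneous, so that all weights can be taken to be one. The
logarithmic vector fields have a basis of linear fields, hence with `p ∂_j` its homogeneous
components `p_d ∂_j` are logarithmic. So `p` divides all `p_d ∂p/∂x_j`, and therefore `p_d`, because
`p` is squarefree (`IsLinearFreeDivisor.exists_isHomogeneous`). -/

set_option linter.unusedSectionVars false
noncomputable section
namespace FreeDiv
open scoped TensorProduct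
open IsLocalRing CategoryTheory

/-! ### Convergent power series -/

section Convergent
open MvPowerSeries
open scoped NNReal ENNReal
variable {n : ℕ}

/-- Coefficientwise domination, up to a shift of exponents and a geometric factor, preserves
convergence. -/
theorem IsConvergent.of_norm_coeff_le {φ ψ : MvPowerSeries (Fin n) ℂ} (hφ : IsConvergent φ)
    (C : ℝ) (e : Fin n →₀ ℕ)
    (h : ∀ m, ‖coeff m ψ‖ ≤ C * 2 ^ m.degree * ‖coeff (m + e) φ‖) : IsConvergent ψ := by
  obtain ⟨r, hr, hs⟩ := hφ
  refine ⟨r / 2, by positivity, ?_⟩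
  have h1 := (hs.comp_injective (add_left_injective e)).mul_left (C * (r ^ e.degree)⁻¹)
  refine h1.of_nonneg_of_le (fun m => by positivity) fun m => ?_
  have h2 : r ^ e.degree ≠ 0 := by positivity
  calc ‖coeff m ψ‖ * (r / 2) ^ m.degree
      ≤ (C * 2 ^ m.degree * ‖coeff (m + e) φ‖) * (r / 2) ^ m.degree := by gcongr; exact h m
    _ = _ := by
      simp only [Function.comp_apply, map_add, pow_add, div_pow]
      field_simp

/-- The partial derivative `∂/∂x_i` on germs of holomorphic functions. -/
def pd (i : Fin n) : Derivation ℂ (O n) (O n) :=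
  Derivation.mk'
    { toFun := fun φ => ⟨MvPowerSeries.pderiv ℂ i φ.1, φ.2.of_norm_coeff_le 1 (Finsupp.single i 1)
        fun m => by
          rw [coeff_pderiv, norm_mul, mul_comm, one_mul]
          gcongr
          have h1 : m i + 1 ≤ 2 ^ m i := Nat.lt_two_pow_self
          have h2 : m i ≤ m.degree := Finsupp.le_degree i m
          have h3 : (2 : ℝ) ^ m i ≤ 2 ^ m.degree := pow_le_pow_right₀ (by norm_num) h2
          calc ‖((m i : ℂ) + 1)‖ = ((m i + 1 : ℕ) : ℝ) := by
                rw [← Nat.cast_succ, Complex.norm_natCast]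
            _ ≤ 2 ^ m i := by exact_mod_cast h1
            _ ≤ _ := h3⟩
      map_add' := fun φ ψ => Subtype.ext (map_add (MvPowerSeries.pderiv ℂ i) φ.1 ψ.1)
      map_smul' := fun c φ => Subtype.ext ((MvPowerSeries.pderiv ℂ i).map_smul c φ.1) }
    fun φ ψ => Subtype.ext ((MvPowerSeries.pderiv ℂ i).leibniz φ.1 ψ.1)

theorem coe_pd (i : Fin n) (φ : O n) : (pd i φ : MvPowerSeries (Fin n) ℂ) =
    MvPowerSeries.pderiv ℂ i φ.1 := rfl

theorem pd_coord (i j : Fin n) : pd i (coord j : O n) = if i = j then 1 else 0 := by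
  apply Subtype.ext
  rw [coe_pd]
  change MvPowerSeries.pderiv ℂ i (X j) = _
  split_ifs with h
  · subst h; exact pderiv_X_self
  · exact pderiv_X_of_ne (Ne.symm h)

/-- The part of a power series consisting of the monomials whose first variable is `x_i`, divided
by `x_i`. -/
def hadamardPart (φ : MvPowerSeries (Fin n) ℂ) (i : Fin n) : MvPowerSeries (Fin n) ℂ :=
  fun m => if ∀ j < i, m j = 0 then coeff (m + Finsupp.single i 1) φ else 0

theorem coeff_hadamardPart (φ : MvPowerSeries (Fin n) ℂ) (i : Fin n) (m : Fin n →₀ ℕ) :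
    coeff m (hadamardPart φ i) =
      if ∀ j < i, m j = 0 then coeff (m + Finsupp.single i 1) φ else 0 := rfl

theorem eq_C_add_sum_X_mul (φ : MvPowerSeries (Fin n) ℂ) :
    φ = C (constantCoeff φ) + ∑ i, X i * hadamardPart φ i := by
  classical
  ext m
  rw [map_add, map_sum, coeff_C]
  have hX : ∀ i, coeff m (X i * hadamardPart φ i) =
      if Finsupp.single i 1 ≤ m then coeff (m - Finsupp.single i 1) (hadamardPart φ i) else 0 := by
    intro i
    rw [X_def, coeff_monomial_mul, one_mul]
  by_cases hm : m = 0
  · subst hm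
    rw [if_pos rfl, Finset.sum_eq_zero, add_zero, coeff_zero_eq_constantCoeff_apply]
    intro i _
    rw [hX, if_neg]
    intro h
    simpa using h i
  · rw [if_neg hm, zero_add]
    have hne : (Finset.univ.filter fun i => m i ≠ 0).Nonempty := by
      by_contra h
      rw [Finset.not_nonempty_iff_eq_empty, Finset.filter_eq_empty_iff] at h
      exact hm (Finsupp.ext fun i => by simpa using h (Finset.mem_univ i))
    set i₀ := (Finset.univ.filter fun i => m i ≠ 0).min' hne with hi₀
    have h0 : m i₀ ≠ 0 := (Finset.mem_filter.mp (Finset.min'_mem _ hne)).2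
    have hlt : ∀ j < i₀, m j = 0 := fun j hj => by
      by_contra h
      exact absurd (Finset.min'_le _ j (Finset.mem_filter.mpr ⟨Finset.mem_univ _, h⟩))
        (not_le.mpr hj)
    have hle : ∀ i, Finsupp.single i 1 ≤ m ↔ m i ≠ 0 := fun i => by
      rw [Finsupp.single_le_iff, Nat.one_le_iff_ne_zero]
    rw [Finset.sum_eq_single i₀]
    · rw [hX, if_pos ((hle _).mpr h0), coeff_hadamardPart, if_pos,
        tsub_add_cancel_of_le ((hle _).mpr h0)]
      intro j hj
      simp [hlt j hj]
    · intro i _ hi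
      rw [hX]
      split_ifs with h
      · rw [coeff_hadamardPart, if_neg]
        intro h'
        rcases lt_or_gt_of_ne hi with h1 | h1
        · exact (hle i).mp h (hlt i h1)
        · have := h' i₀ h1
          rw [Finsupp.tsub_apply, Finsupp.single_eq_of_ne (by exact hi.symm), tsub_zero] at this
          exact h0 this
      · rfl
    · intro h; exact absurd (Finset.mem_univ _) h

theorem IsConvergent.hadamardPart {φ : MvPowerSeries (Fin n) ℂ} (hφ : IsConvergent φ) (i : Fin n) :
    IsConvergent (hadamardPart φ i) := by
  refine hφ.of_norm_coeff_le 1 (Finsupp.single i 1) fun m => ?_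
  rw [coeff_hadamardPart, one_mul]
  split_ifs
  · exact le_mul_of_one_le_left (norm_nonneg _) (one_le_pow₀ (by norm_num))
  · rw [norm_zero]; positivity

theorem coe_algebraMap (c : ℂ) : (algebraMap ℂ (O n) c : MvPowerSeries (Fin n) ℂ) = C c :=
  MvPowerSeries.algebraMap_apply (σ := Fin n) (R := ℂ) (A := ℂ)

/-- The value of a germ at the origin. -/
def evalZero (n : ℕ) : O n →ₐ[ℂ] ℂ :=
  AlgHom.mk ((constantCoeff (σ := Fin n) (R := ℂ)).comp (convergentSeries n).val.toRingHom)
    fun c => by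
      change constantCoeff (algebraMap ℂ (O n) c).1 = c
      rw [coe_algebraMap, constantCoeff_C]

theorem evalZero_apply (φ : O n) : evalZero n φ = constantCoeff φ.1 := rfl

theorem evalZero_coord (i : Fin n) : evalZero n (coord i) = 0 := constantCoeff_X i

/-- Hadamard's lemma for germs of holomorphic functions. -/
theorem exists_eq_add_sum_coord (φ : O n) :
    ∃ t : Fin n → O n, φ = algebraMap ℂ (O n) (evalZero n φ) + ∑ i, coord i * t i := by
  refine ⟨fun i => ⟨hadamardPart φ.1 i, φ.2.hadamardPart i⟩, Subtype.ext ?_⟩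
  have := eq_C_add_sum_X_mul φ.1
  rw [Subalgebra.coe_add, AddSubmonoidClass.coe_finsetSum, coe_algebraMap]
  exact this

/-! ### The weighted `ℓ¹`-norm of a power series -/

/-- The monomial `ρ ^ m` for a polyradius `ρ`. -/
def rmon (ρ : Fin n → ℝ≥0) (m : Fin n →₀ ℕ) : ℝ≥0∞ := ∏ i, (ρ i : ℝ≥0∞) ^ m i

/-- The weighted `ℓ¹`-norm of a power series with respect to the polyradius `ρ`, with values in
`[0, ∞]`. -/
def rnorm (ρ : Fin n → ℝ≥0) (φ : MvPowerSeries (Fin n) ℂ) : ℝ≥0∞ :=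
  ∑' m, ‖coeff m φ‖ₑ * rmon ρ m

theorem rmon_add (ρ : Fin n → ℝ≥0) (m m' : Fin n →₀ ℕ) :
    rmon ρ (m + m') = rmon ρ m * rmon ρ m' := by
  simp [rmon, pow_add, Finset.prod_mul_distrib]

theorem rmon_ne_top (ρ : Fin n → ℝ≥0) (m : Fin n →₀ ℕ) : rmon ρ m ≠ ⊤ :=
  ENNReal.prod_ne_top fun _ _ => ENNReal.pow_ne_top ENNReal.coe_ne_top

theorem rmon_mono {ρ σ : Fin n → ℝ≥0} (h : ρ ≤ σ) (m : Fin n →₀ ℕ) : rmon ρ m ≤ rmon σ m :=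
  Finset.prod_le_prod' fun i _ => by gcongr; exact h i

theorem rmon_const (r : ℝ≥0) (m : Fin n →₀ ℕ) : rmon (fun _ => r) m = (r : ℝ≥0∞) ^ m.degree := by
  rw [rmon, Finset.prod_pow_eq_pow_sum, Finsupp.degree_eq_sum]

theorem rnorm_mono {ρ σ : Fin n → ℝ≥0} (h : ρ ≤ σ) (φ : MvPowerSeries (Fin n) ℂ) :
    rnorm ρ φ ≤ rnorm σ φ :=
  ENNReal.tsum_le_tsum fun m => mul_le_mul_right (rmon_mono h m) _

theorem rnorm_add_le (ρ : Fin n → ℝ≥0) (φ ψ : MvPowerSeries (Fin n) ℂ) :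
    rnorm ρ (φ + ψ) ≤ rnorm ρ φ + rnorm ρ ψ := by
  rw [rnorm, rnorm, rnorm, ← ENNReal.tsum_add]
  refine ENNReal.tsum_le_tsum fun m => ?_
  rw [← add_mul, map_add]
  gcongr
  exact enorm_add_le _ _

theorem rnorm_mul_le (ρ : Fin n → ℝ≥0) (φ ψ : MvPowerSeries (Fin n) ℂ) :
    rnorm ρ (φ * ψ) ≤ rnorm ρ φ * rnorm ρ ψ := by
  classical
  have h1 : rnorm ρ φ * rnorm ρ ψ = ∑' p : (Fin n →₀ ℕ) × (Fin n →₀ ℕ),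
      (‖coeff p.1 φ‖ₑ * rmon ρ p.1) * (‖coeff p.2 ψ‖ₑ * rmon ρ p.2) := by
    rw [ENNReal.tsum_prod', rnorm, ← ENNReal.tsum_mul_right]
    congr 1
    ext m
    rw [rnorm, ← ENNReal.tsum_mul_left]
  rw [h1, ← (Finset.HasAntidiagonal.sigmaAntidiagonalEquivProd (A := Fin n →₀ ℕ)).tsum_eq, ENNReal.tsum_sigma', rnorm]
  refine ENNReal.tsum_le_tsum fun m => ?_
  rw [coeff_mul, tsum_fintype]
  calc ‖∑ p ∈ Finset.HasAntidiagonal.antidiagonal m, coeff p.1 φ * coeff p.2 ψ‖ₑ * rmon ρ m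
      ≤ (∑ p ∈ Finset.HasAntidiagonal.antidiagonal m, ‖coeff p.1 φ * coeff p.2 ψ‖ₑ) * rmon ρ m := by
        gcongr; exact enorm_sum_le _ _
    _ = ∑ p ∈ Finset.HasAntidiagonal.antidiagonal m,
        (‖coeff p.1 φ‖ₑ * rmon ρ p.1) * (‖coeff p.2 ψ‖ₑ * rmon ρ p.2) := by
        rw [Finset.sum_mul]
        refine Finset.sum_congr rfl fun p hp => ?_
        rw [← Finset.HasAntidiagonal.mem_antidiagonal.mp hp, rmon_add, enorm_mul]
        ring
    _ = _ := by
        rw [← Finset.sum_coe_sort]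
        rfl

theorem rnorm_monomial (ρ : Fin n → ℝ≥0) (m : Fin n →₀ ℕ) (c : ℂ) :
    rnorm ρ (monomial m c) = ‖c‖ₑ * rmon ρ m := by
  classical
  rw [rnorm, tsum_eq_single m]
  · rw [coeff_monomial_same]
  · intro m' h
    rw [coeff_monomial_ne h, enorm_zero, zero_mul]

theorem rnorm_one (ρ : Fin n → ℝ≥0) : rnorm ρ 1 = 1 := by
  rw [← monomial_zero_one, rnorm_monomial]
  simp [rmon]

theorem rnorm_pow_le (ρ : Fin n → ℝ≥0) (φ : MvPowerSeries (Fin n) ℂ) (k : ℕ) :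
    rnorm ρ (φ ^ k) ≤ rnorm ρ φ ^ k := by
  induction k with
  | zero => rw [pow_zero, pow_zero, rnorm_one]
  | succ k ih =>
    rw [pow_succ, pow_succ]
    exact (rnorm_mul_le _ _ _).trans (by gcongr)

theorem rnorm_prod_le (ρ : Fin n → ℝ≥0) {ι : Type*} (s : Finset ι)
    (φ : ι → MvPowerSeries (Fin n) ℂ) : rnorm ρ (∏ i ∈ s, φ i) ≤ ∏ i ∈ s, rnorm ρ (φ i) := by
  classical
  induction s using Finset.induction_on with
  | empty => simp [rnorm_one]
  | insert i s hi ih =>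
    rw [Finset.prod_insert hi, Finset.prod_insert hi]
    exact (rnorm_mul_le _ _ _).trans (by gcongr)

theorem summable_iff_rnorm {r : ℝ≥0} {φ : MvPowerSeries (Fin n) ℂ} :
    (Summable fun m : Fin n →₀ ℕ => ‖coeff m φ‖ * (r : ℝ) ^ m.degree) ↔
      rnorm (fun _ => r) φ ≠ ⊤ := by
  have h : rnorm (fun _ => r) φ =
      ∑' m : Fin n →₀ ℕ, ((‖coeff m φ‖₊ * r ^ m.degree : ℝ≥0) : ℝ≥0∞) := by
    rw [rnorm]
    congr 1
    ext m
    rw [rmon_const, ENNReal.coe_mul, ENNReal.coe_pow]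
    rfl
  rw [h, ENNReal.tsum_coe_ne_top_iff_summable, ← NNReal.summable_coe]
  simp

theorem exists_pos_le (ρ : Fin n → ℝ≥0) (hρ : ∀ i, 0 < ρ i) : ∃ r > 0, ∀ i, r ≤ ρ i := by
  have h : ∀ᶠ r in nhdsWithin (0 : ℝ≥0) (Set.Ioi 0), ∀ i, r ≤ ρ i :=
    Filter.eventually_all.mpr fun i =>
      Filter.Eventually.filter_mono nhdsWithin_le_nhds (Iic_mem_nhds (hρ i))
  obtain ⟨r, h1, h2⟩ := (h.and self_mem_nhdsWithin).exists
  exact ⟨r, h2, h1⟩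

theorem isConvergent_of_rnorm {ρ : Fin n → ℝ≥0} (hρ : ∀ i, 0 < ρ i) {φ : MvPowerSeries (Fin n) ℂ}
    (h : rnorm ρ φ ≠ ⊤) : IsConvergent φ := by
  obtain ⟨r, hr, hle⟩ := exists_pos_le ρ hρ
  exact ⟨r, hr, summable_iff_rnorm.mpr (ne_top_of_le_ne_top h (rnorm_mono hle φ))⟩

theorem IsConvergent.exists_rnorm {φ : MvPowerSeries (Fin n) ℂ} (h : IsConvergent φ) :
    ∃ r : ℝ≥0, 0 < r ∧ rnorm (fun _ => r) φ ≠ ⊤ := by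
  obtain ⟨r, hr, hs⟩ := h
  exact ⟨⟨r, hr.le⟩, hr, summable_iff_rnorm.mp hs⟩

/-- A convergent series without constant term is small on small polydiscs. -/
theorem IsConvergent.eventually_rnorm_le {φ : MvPowerSeries (Fin n) ℂ} (h : IsConvergent φ)
    (h0 : constantCoeff φ = 0) {σ : ℝ≥0} (hσ : 0 < σ) :
    ∀ᶠ r in nhdsWithin (0 : ℝ≥0) (Set.Ioi 0), rnorm (fun _ => r) φ ≤ σ := by
  obtain ⟨r, hr, hs⟩ := h.exists_rnorm
  have key : ∀ t : ℝ≥0, t ≤ 1 → rnorm (fun _ => t * r) φ ≤ t * rnorm (fun _ => r) φ := by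
    intro t ht
    rw [rnorm, rnorm, ← ENNReal.tsum_mul_left]
    refine ENNReal.tsum_le_tsum fun m => ?_
    by_cases hm : m = 0
    · subst hm
      rw [coeff_zero_eq_constantCoeff_apply, h0]; simp
    · rw [rmon_const, rmon_const, ENNReal.coe_mul, mul_pow]
      have : (t : ℝ≥0∞) ^ m.degree ≤ t := by
        apply pow_le_of_le_one (by positivity) (by exact_mod_cast ht)
        simpa [Finsupp.degree_eq_zero_iff] using hm
      calc ‖coeff m φ‖ₑ * ((t : ℝ≥0∞) ^ m.degree * r ^ m.degree)
          ≤ ‖coeff m φ‖ₑ * (t * r ^ m.degree) := by gcongr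
        _ = _ := by ring
  lift rnorm (fun _ => r) φ to ℝ≥0 using hs with M hM
  obtain ⟨t, ht0, ht1, ht2⟩ : ∃ t : ℝ≥0, 0 < t ∧ t ≤ 1 ∧ t * M ≤ σ := by
    refine ⟨min 1 (σ / (M + 1)), lt_min one_pos (by positivity), min_le_left _ _, ?_⟩
    calc min 1 (σ / (M + 1)) * M ≤ σ / (M + 1) * (M + 1) := by
          gcongr
          · exact min_le_right _ _
          · exact le_self_add
      _ = σ := div_mul_cancel₀ _ (by positivity)
  have hmem : Set.Iic (t * r) ∈ nhdsWithin (0 : ℝ≥0) (Set.Ioi 0) :=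
    nhdsWithin_le_nhds (Iic_mem_nhds (by positivity))
  filter_upwards [hmem] with s hs'
  calc rnorm (fun _ => s) φ ≤ rnorm (fun _ => t * r) φ := rnorm_mono (fun _ => hs') φ
    _ ≤ t * M := key t ht1
    _ ≤ σ := by exact_mod_cast ht2

/-- Substitution of series of norm at most `σ_i` does not increase the norm. -/
theorem rnorm_subst_le {k : ℕ} {y : Fin n → MvPowerSeries (Fin k) ℂ} (hy : HasSubst y)
    (ρ : Fin k → ℝ≥0) (σ : Fin n → ℝ≥0) (h : ∀ i, rnorm ρ (y i) ≤ σ i)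
    (s : MvPowerSeries (Fin n) ℂ) : rnorm ρ (subst y s) ≤ rnorm σ s := by
  calc rnorm ρ (subst y s)
      ≤ ∑' m, ∑' d, ‖coeff d s‖ₑ * (‖coeff m (d.prod fun i e => y i ^ e)‖ₑ * rmon ρ m) := by
        refine ENNReal.tsum_le_tsum fun m => ?_
        have hfin := coeff_subst_finite hy s m
        rw [coeff_subst hy, finsum_eq_sum _ hfin]
        calc _ ≤ (∑ d ∈ hfin.toFinset,
              ‖coeff d s • coeff m (d.prod fun i e => y i ^ e)‖ₑ) * rmon ρ m := by
              gcongr; exact enorm_sum_le _ _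
          _ = ∑ d ∈ hfin.toFinset,
              ‖coeff d s‖ₑ * (‖coeff m (d.prod fun i e => y i ^ e)‖ₑ * rmon ρ m) := by
              rw [Finset.sum_mul]
              refine Finset.sum_congr rfl fun d _ => ?_
              rw [enorm_smul, mul_assoc]
          _ ≤ _ := ENNReal.sum_le_tsum _
    _ = ∑' d, ‖coeff d s‖ₑ * rnorm ρ (d.prod fun i e => y i ^ e) := by
        rw [ENNReal.tsum_comm]
        congr 1
        ext d
        rw [ENNReal.tsum_mul_left, rnorm]
    _ ≤ rnorm σ s := by
        refine ENNReal.tsum_le_tsum fun d => ?_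
        gcongr
        rw [Finsupp.prod_fintype _ _ (by simp)]
        refine (rnorm_prod_le _ _ _).trans (Finset.prod_le_prod' fun i _ => ?_)
        exact (rnorm_pow_le _ _ _).trans (by gcongr; exact h i)

/-- Substitution of convergent series without constant term into a convergent series. -/
def substHom {k : ℕ} (y : Fin n → O k) (hy : ∀ i, evalZero k (y i) = 0) : O n →ₐ[ℂ] O k :=
  have hs : HasSubst fun i => (y i).1 := hasSubst_of_constantCoeff_zero hy
  ((substAlgHom hs).comp (convergentSeries n).val).codRestrict (convergentSeries k) fun φ => by
    obtain ⟨σ, hσ, hφ⟩ := φ.2.exists_rnorm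
    have h1 := Filter.eventually_all.mpr fun i => (y i).2.eventually_rnorm_le (hy i) hσ
    obtain ⟨r, h2, h3⟩ := (h1.and self_mem_nhdsWithin).exists
    refine isConvergent_of_rnorm (ρ := fun _ => r) (fun _ => h3) ?_
    change rnorm _ (substAlgHom hs φ.1) ≠ ⊤
    rw [substAlgHom_apply]
    exact ne_top_of_le_ne_top hφ (rnorm_subst_le hs _ _ h2 _)

theorem substHom_coord {k : ℕ} (y : Fin n → O k) (hy : ∀ i, evalZero k (y i) = 0) (i : Fin n) :
    substHom y hy (coord i) = y i :=
  Subtype.ext (substAlgHom_X (hasSubst_of_constantCoeff_zero hy) i)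

/-- The geometric series. -/
def geometric : MvPowerSeries (Fin 1) ℂ := fun _ => 1

theorem coeff_geometric (m : Fin 1 →₀ ℕ) : coeff m geometric = 1 := rfl

theorem isConvergent_geometric : IsConvergent geometric := by
  refine ⟨1 / 2, by norm_num, ?_⟩
  have h := summable_geometric_of_lt_one (r := (1 / 2 : ℝ)) (by norm_num) (by norm_num)
  have h2 : Function.Injective fun m : Fin 1 →₀ ℕ => m.degree := fun a b hab => by
    refine Finsupp.ext fun i => ?_
    fin_cases i
    simpa [Finsupp.degree_eq_sum] using hab
  refine (h.comp_injective h2).congr fun m => ?_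
  simp [coeff_geometric]

theorem isUnit_one_sub_coord : IsUnit (1 - coord 0 : O 1) := by
  refine IsUnit.of_mul_eq_one ⟨_, isConvergent_geometric⟩ (Subtype.ext ?_)
  classical
  change (1 - X 0) * geometric = 1
  ext m
  rw [sub_mul, one_mul, map_sub, X_def, coeff_monomial_mul, coeff_one, coeff_geometric,
    coeff_geometric, one_mul]
  by_cases hm : m = 0
  · subst hm
    rw [if_pos rfl, if_neg, sub_zero]
    intro h; simpa using h 0
  · rw [if_neg hm, if_pos, sub_self]
    rw [Finsupp.single_le_iff, Nat.one_le_iff_ne_zero]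
    intro h
    exact hm (Finsupp.ext fun i => by fin_cases i; simpa using h)

/-- A germ that does not vanish at the origin is invertible: substitute into the geometric
series. -/
theorem isUnit_iff_evalZero_ne_zero {φ : O n} : IsUnit φ ↔ evalZero n φ ≠ 0 := by
  refine ⟨fun h => (h.map (evalZero n)).ne_zero, fun h => ?_⟩
  set c := evalZero n φ
  have h1 : evalZero n (1 - c⁻¹ • φ) = 0 := by
    rw [map_sub, map_one, map_smul, smul_eq_mul, inv_mul_cancel₀ h, sub_self]
  have h2 := isUnit_one_sub_coord.map (substHom (fun _ : Fin 1 => 1 - c⁻¹ • φ) fun _ => h1)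
  rw [map_sub, map_one, substHom_coord, sub_sub_cancel] at h2
  have h3 : φ = algebraMap ℂ (O n) c * (c⁻¹ • φ) := by
    rw [← Algebra.smul_def, smul_smul, mul_inv_cancel₀ h, one_smul]
  rw [h3]
  exact ((IsUnit.mk0 c h).map (algebraMap ℂ (O n))).mul h2

instance : IsLocalRing (O n) :=
  IsLocalRing.of_nonunits_add fun a b ha hb => by
    simp only [mem_nonunits_iff, isUnit_iff_evalZero_ne_zero, not_not] at *
    rw [map_add, ha, hb, add_zero]

theorem mem_maximalIdeal_iff_evalZero {φ : O n} : φ ∈ maximalIdeal (O n) ↔ evalZero n φ = 0 := by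
  rw [mem_maximalIdeal, mem_nonunits_iff, isUnit_iff_evalZero_ne_zero, not_not]

theorem maximalIdeal_eq_span_coord : maximalIdeal (O n) = Ideal.span (Set.range coord) := by
  apply le_antisymm
  · intro φ hφ
    obtain ⟨t, ht⟩ := exists_eq_add_sum_coord φ
    rw [mem_maximalIdeal_iff_evalZero.mp hφ, map_zero, zero_add] at ht
    rw [ht]
    exact sum_mem fun i _ => Ideal.mul_mem_right _ _ (Ideal.subset_span ⟨i, rfl⟩)
  · rw [Ideal.span_le]
    rintro _ ⟨i, rfl⟩
    exact mem_maximalIdeal_iff_evalZero.mpr (evalZero_coord i)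

end Convergent

/-! ### Weighted homogeneous germs -/

section Weights
open MvPowerSeries
open scoped NNReal ENNReal
variable {n : ℕ} (w : Fin n → ℕ)

/-- The operator on power series that multiplies every monomial of weight `j` by `c j`. -/
def wmul (c : ℤ → ℂ) : MvPowerSeries (Fin n) ℂ →ₗ[ℂ] MvPowerSeries (Fin n) ℂ where
  toFun φ := fun m => c (Finsupp.weight w m) * coeff m φ
  map_add' φ ψ := by
    ext m
    exact mul_add _ _ _
  map_smul' a φ := by
    ext m
    change c _ * (a * coeff m φ) = a * (c _ * coeff m φ)
    ring

theorem coeff_wmul (c : ℤ → ℂ) (φ : MvPowerSeries (Fin n) ℂ) (m : Fin n →₀ ℕ) :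
    coeff m (wmul w c φ) = c (Finsupp.weight w m) * coeff m φ := rfl

/-- All monomials of `φ` have weight `d`. -/
def IsWHom (d : ℤ) (φ : MvPowerSeries (Fin n) ℂ) : Prop :=
  ∀ m, coeff m φ ≠ 0 → (Finsupp.weight w m : ℤ) = d

variable {w}

theorem IsWHom.wmul_mul {d : ℤ} {f : MvPowerSeries (Fin n) ℂ} (hf : IsWHom w d f) (c : ℤ → ℂ)
    (φ : MvPowerSeries (Fin n) ℂ) : wmul w c (f * φ) = f * wmul w (fun j => c (d + j)) φ := by
  classical
  ext m
  rw [coeff_wmul, coeff_mul, coeff_mul, Finset.mul_sum]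
  refine Finset.sum_congr rfl fun p hp => ?_
  rw [coeff_wmul]
  by_cases h : coeff p.1 f = 0
  · rw [h]; ring
  · rw [← hf _ h, ← Finset.HasAntidiagonal.mem_antidiagonal.mp hp, map_add]
    push_cast
    ring

theorem IsWHom.mul {d e : ℤ} {f g : MvPowerSeries (Fin n) ℂ} (hf : IsWHom w d f)
    (hg : IsWHom w e g) : IsWHom w (d + e) (f * g) := by
  classical
  intro m hm
  rw [coeff_mul] at hm
  obtain ⟨p, hp, hne⟩ := Finset.exists_ne_zero_of_sum_ne_zero hm
  rw [← hf _ (left_ne_zero_of_mul hne), ← hg _ (right_ne_zero_of_mul hne),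
    ← Finset.HasAntidiagonal.mem_antidiagonal.mp hp, map_add]
  push_cast
  rfl

theorem IsWHom.wmul {d : ℤ} {f : MvPowerSeries (Fin n) ℂ} (hf : IsWHom w d f) (c : ℤ → ℂ) :
    wmul w c f = c d • f := by
  ext m
  rw [coeff_wmul, coeff_smul]
  by_cases h : coeff m f = 0
  · rw [h, mul_zero, mul_zero]
  · rw [hf _ h]

theorem IsWHom.pderiv {d : ℤ} {f : MvPowerSeries (Fin n) ℂ} (hf : IsWHom w d f) (i : Fin n) :
    IsWHom w (d - w i) (MvPowerSeries.pderiv ℂ i f) := by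
  intro m hm
  rw [coeff_pderiv] at hm
  have := hf _ (left_ne_zero_of_mul hm)
  rw [map_add, Finsupp.weight_single] at this
  push_cast at this
  simp only [smul_eq_mul, one_mul] at this
  linarith

/-- The indicator function of a set of weights. -/
def wInd (P : Set ℤ) : ℤ → ℂ := P.indicator 1

theorem norm_wInd_le (P : Set ℤ) (j : ℤ) : ‖wInd P j‖ ≤ 1 := by
  classical
  rw [wInd, Set.indicator_apply]
  split_ifs <;> simp

variable (w) in
/-- The operator `wmul` for bounded multipliers, on germs. -/
def wmulO (c : ℤ → ℂ) (hc : ∀ j, ‖c j‖ ≤ 1) : O n →ₗ[ℂ] O n where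
  toFun φ := ⟨wmul w c φ.1, φ.2.of_norm_coeff_le 1 0 fun m => by
    rw [coeff_wmul, norm_mul, add_zero, one_mul]
    gcongr
    exact (hc _).trans (one_le_pow₀ (by norm_num))⟩
  map_add' φ ψ := Subtype.ext (map_add (wmul w c) φ.1 ψ.1)
  map_smul' a φ := Subtype.ext (map_smul (wmul w c) a φ.1)

theorem coe_wmulO (c : ℤ → ℂ) (hc : ∀ j, ‖c j‖ ≤ 1) (φ : O n) :
    (wmulO w c hc φ : MvPowerSeries (Fin n) ℂ) = wmul w c φ.1 := rfl

variable (w) in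
/-- The part of a germ consisting of the monomials with weight in `P`. -/
def wpart (P : Set ℤ) : O n →ₗ[ℂ] O n := wmulO w (wInd P) (norm_wInd_le P)

variable (w) in
/-- The space of weighted homogeneous germs of weight `d`. -/
def wHom (d : ℤ) : Submodule ℂ (O n) where
  carrier := {φ | IsWHom w d φ.1}
  add_mem' {φ ψ} hφ hψ m hm := by
    by_cases h : coeff m φ.1 = 0
    · refine hψ m fun h' => hm ?_
      rw [Subalgebra.coe_add, map_add, h, h', add_zero]
    · exact hφ m h
  zero_mem' m hm := absurd rfl hm
  smul_mem' c φ hφ m hm := by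
    refine hφ m fun h => hm ?_
    rw [Subalgebra.coe_smul, coeff_smul, h, mul_zero]

theorem coeff_wpart (P : Set ℤ) (φ : O n) (m : Fin n →₀ ℕ) [Decidable ((Finsupp.weight w m : ℤ) ∈ P)] :
    coeff m (wpart w P φ).1 = if (Finsupp.weight w m : ℤ) ∈ P then coeff m φ.1 else 0 := by
  rw [wpart, coe_wmulO, coeff_wmul, wInd, Set.indicator_apply]
  split_ifs <;> simp

theorem wpart_mem_wHom (d : ℤ) (φ : O n) : wpart w {d} φ ∈ wHom w d := by
  classical
  intro m hm
  rw [coeff_wpart] at hm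
  by_contra h
  exact hm (if_neg h)

theorem wpart_of_mem {d : ℤ} {φ : O n} (h : φ ∈ wHom w d) (P : Set ℤ) [Decidable (d ∈ P)] :
    wpart w P φ = if d ∈ P then φ else 0 := by
  apply Subtype.ext
  rw [wpart, coe_wmulO, IsWHom.wmul h, wInd, Set.indicator_apply]
  split_ifs
  · exact one_smul _ _
  · exact zero_smul _ _

theorem wpart_singleton_of_mem {d : ℤ} {φ : O n} (h : φ ∈ wHom w d) : wpart w {d} φ = φ := by
  classical
  rw [wpart_of_mem h, if_pos (Set.mem_singleton d)]

theorem mul_mem_wHom {d e : ℤ} {f g : O n} (hf : f ∈ wHom w d) (hg : g ∈ wHom w e) :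
    f * g ∈ wHom w (d + e) := IsWHom.mul hf hg

theorem pd_mem_wHom {d : ℤ} {f : O n} (hf : f ∈ wHom w d) (i : Fin n) :
    pd i f ∈ wHom w (d - w i) := IsWHom.pderiv hf i

theorem wmulO_mul {d : ℤ} {f : O n} (hf : f ∈ wHom w d) (c : ℤ → ℂ) (hc : ∀ j, ‖c j‖ ≤ 1) (φ : O n) :
    wmulO w c hc (f * φ) = f * wmulO w (fun j => c (d + j)) (fun _ => hc _) φ :=
  Subtype.ext (IsWHom.wmul_mul hf c φ.1)

theorem wpart_mul {d : ℤ} {f : O n} (hf : f ∈ wHom w d) (P : Set ℤ) (φ : O n) :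
    wpart w P (f * φ) = f * wpart w {j | d + j ∈ P} φ := by
  rw [wpart, wmulO_mul hf]
  rfl

theorem wpart_mul_singleton {d e : ℤ} {f : O n} (hf : f ∈ wHom w d) (φ : O n) :
    wpart w {d + e} (f * φ) = f * wpart w {e} φ := by
  rw [wpart_mul hf]
  congr 2
  congr 1
  ext j
  simp

variable (w) in
/-- The Euler vector field `∑ w_i x_i ∂/∂x_i`. -/
def euler : Derivation ℂ (O n) (O n) := ∑ i, (w i : ℂ) • (coord i • pd i)

theorem coe_euler (φ : O n) : (euler w φ : MvPowerSeries (Fin n) ℂ) = wmul w (fun j => (j : ℂ)) φ.1 := by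
  classical
  ext m
  have h1 : (euler w φ : MvPowerSeries (Fin n) ℂ) =
      ∑ i, (w i : ℂ) • (X i * MvPowerSeries.pderiv ℂ i φ.1) := by
    rw [euler, der_sum_apply, AddSubmonoidClass.coe_finsetSum]
    rfl
  have h2 : ∀ i, coeff m (X i * MvPowerSeries.pderiv ℂ i φ.1) = (m i : ℂ) * coeff m φ.1 := by
    intro i
    rw [X_def, coeff_monomial_mul, one_mul]
    split_ifs with h
    · have h' := (Finsupp.single_le_iff).mp h
      rw [coeff_pderiv, tsub_add_cancel_of_le h, Finsupp.tsub_apply,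
        Finsupp.single_eq_same, Nat.cast_sub h']
      push_cast; ring
    · rw [Finsupp.single_le_iff] at h
      rw [show m i = 0 by omega]; simp
  rw [h1, map_sum, coeff_wmul]
  simp only [coeff_smul, h2]
  rw [Finsupp.weight_apply, Finsupp.sum_fintype _ _ (by simp)]
  push_cast
  rw [Finset.sum_mul]
  refine Finset.sum_congr rfl fun i _ => ?_
  rw [smul_eq_mul, Nat.cast_mul]
  ring

theorem euler_of_mem {d : ℤ} {φ : O n} (h : φ ∈ wHom w d) : euler w φ = (d : ℂ) • φ := by
  apply Subtype.ext
  rw [coe_euler, IsWHom.wmul h]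
  rfl

theorem euler_coord (i : Fin n) : euler w (coord i) = (w i : ℂ) • coord i := by
  rw [euler, der_sum_apply]
  simp [pd_coord]

/-- If `(χ - d) h` lies in an ideal generated by homogeneous elements, then so does `h` up to its
component of weight `d`: divide coefficientwise by the eigenvalues of `χ - d`. -/
theorem sub_wpart_mem_of_euler_mem {ι : Type*} [Fintype ι] {d : ℤ} {h : O n} (e : ι → ℤ)
    (g : ι → O n) (hg : ∀ i, g i ∈ wHom w (e i)) (a : ι → O n)
    (H : euler w h - (d : ℂ) • h = ∑ i, g i * a i) :
    ∃ b : ι → O n, h - wpart w {d} h = ∑ i, g i * b i := by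
  classical
  have hc : ∀ j : ℤ, ‖(((j - d : ℤ) : ℂ))⁻¹‖ ≤ 1 := fun j => by
    by_cases hj : j - d = 0
    · rw [hj]; simp
    · rw [norm_inv]
      apply inv_le_one_of_one_le₀
      rw [Complex.norm_intCast]
      exact_mod_cast Int.one_le_abs hj
  have h1 : wmulO w _ hc (euler w h - (d : ℂ) • h) = h - wpart w {d} h := by
    apply Subtype.ext
    ext m
    rw [coe_wmulO, coeff_wmul, Subalgebra.coe_sub, Subalgebra.coe_sub, map_sub, map_sub,
      Subalgebra.coe_smul, coeff_smul, coeff_wpart, coe_euler, coeff_wmul]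
    simp only [Set.mem_singleton_iff]
    split_ifs with hm
    · rw [hm]; simp
    · rw [← sub_mul, ← mul_assoc, ← Int.cast_sub, inv_mul_cancel₀, one_mul, sub_zero]
      exact_mod_cast sub_ne_zero.mpr hm
  refine ⟨fun i => wmulO w _ (fun j => hc (e i + j)) (a i), ?_⟩
  rw [← h1, H, map_sum]
  exact Finset.sum_congr rfl fun i _ => wmulO_mul (hg i) _ hc _

variable (w) in
/-- The ideal of germs all of whose monomials have weight at least `E`. -/
def wFilt (E : ℕ) : Ideal (O n) where
  carrier := {φ | ∀ m, Finsupp.weight w m < E → coeff m φ.1 = 0}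
  add_mem' {φ ψ} hφ hψ m hm := by
    rw [Subalgebra.coe_add, map_add, hφ m hm, hψ m hm, add_zero]
  zero_mem' _ _ := rfl
  smul_mem' c φ hφ m hm := by
    classical
    rw [smul_eq_mul, Subalgebra.coe_mul, coeff_mul]
    refine Finset.sum_eq_zero fun p hp => ?_
    rw [hφ p.2, mul_zero]
    refine lt_of_le_of_lt ?_ hm
    rw [← Finset.HasAntidiagonal.mem_antidiagonal.mp hp, map_add]
    exact Nat.le_add_left _ _

theorem mem_wFilt {E : ℕ} {φ : O n} :
    φ ∈ wFilt w E ↔ ∀ m, Finsupp.weight w m < E → coeff m φ.1 = 0 := Iff.rfl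

theorem mul_mem_wFilt {a b : ℕ} {φ ψ : O n} (hφ : φ ∈ wFilt w a) (hψ : ψ ∈ wFilt w b) :
    φ * ψ ∈ wFilt w (a + b) := by
  classical
  intro m hm
  rw [Subalgebra.coe_mul, coeff_mul]
  refine Finset.sum_eq_zero fun p hp => ?_
  rw [← Finset.HasAntidiagonal.mem_antidiagonal.mp hp, map_add] at hm
  rcases Nat.lt_or_ge (Finsupp.weight w p.1) a with h | h
  · rw [hφ _ h, zero_mul]
  · rw [hψ _ (by omega), mul_zero]

theorem weight_eq_zero_iff (hw : ∀ i, 0 < w i) (m : Fin n →₀ ℕ) :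
    Finsupp.weight w m = 0 ↔ m = 0 := by
  refine ⟨fun h0 => ?_, fun h => by rw [h, map_zero]⟩
  by_contra h
  obtain ⟨i, hi⟩ := Finsupp.ne_iff.mp h
  have h1 := Finsupp.le_weight w (hw i).ne' m
  rw [Finsupp.zero_apply] at hi
  omega

theorem maximalIdeal_pow_le_wFilt (hw : ∀ i, 0 < w i) (k : ℕ) :
    maximalIdeal (O n) ^ k ≤ wFilt w k := by
  induction k with
  | zero => intro φ _ m hm; exact absurd hm (Nat.not_lt_zero _)
  | succ k ih =>
    rw [pow_succ, Ideal.mul_le]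
    intro φ hφ ψ hψ
    refine mul_mem_wFilt (ih hφ) ?_
    intro m hm
    rw [(weight_eq_zero_iff hw m).mp (by omega)]
    exact mem_maximalIdeal_iff_evalZero.mp hψ

theorem finite_weight_eq (hw : ∀ i, 0 < w i) (d : ℤ) :
    {m : Fin n →₀ ℕ | (Finsupp.weight w m : ℤ) = d}.Finite := by
  refine (Finsupp.finite_of_degree_le (σ := Fin n) d.toNat).subset fun m hm => ?_
  have h2 : m.degree ≤ Finsupp.weight w m := by
    rw [Finsupp.degree_eq_sum, Finsupp.weight_apply, Finsupp.sum_fintype _ _ (by simp)]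
    refine Finset.sum_le_sum fun i _ => ?_
    rw [smul_eq_mul]
    exact Nat.le_mul_of_pos_right _ (hw i)
  simp only [Set.mem_ofPred_eq] at hm ⊢
  omega

theorem finite_wHom (hw : ∀ i, 0 < w i) (d : ℤ) : Module.Finite ℂ (wHom w d) := by
  have := (finite_weight_eq hw d).to_subtype
  let L : wHom w d →ₗ[ℂ] ({m : Fin n →₀ ℕ | (Finsupp.weight w m : ℤ) = d} → ℂ) :=
    { toFun := fun φ m => coeff m.1 φ.1.1
      map_add' := fun φ ψ => by ext m; exact map_add (coeff m.1) φ.1.1 ψ.1.1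
      map_smul' := fun a φ => rfl }
  refine Module.Finite.of_injective L fun φ ψ h => Subtype.ext (Subtype.ext ?_)
  ext m
  by_cases hm : (Finsupp.weight w m : ℤ) = d
  · exact congrFun h ⟨m, hm⟩
  · rw [show coeff m φ.1.1 = 0 by by_contra h'; exact hm (φ.2 m h'),
      show coeff m ψ.1.1 = 0 by by_contra h'; exact hm (ψ.2 m h')]

/-! ### Division by a weighted homogeneous germ -/

theorem le_rnorm_monomial_mul (ρ : Fin n → ℝ≥0) (a : Fin n →₀ ℕ) (c : ℂ)
    (h : MvPowerSeries (Fin n) ℂ) : ‖c‖ₑ * rmon ρ a * rnorm ρ h ≤ rnorm ρ (monomial a c * h) := by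
  rw [rnorm, ← ENNReal.tsum_mul_left]
  refine le_trans (ENNReal.tsum_le_tsum fun m => ?_)
    (ENNReal.tsum_comp_le_tsum_of_injective (add_right_injective a)
      fun m => ‖coeff m (monomial a c * h)‖ₑ * rmon ρ m)
  rw [coeff_add_monomial_mul, rmon_add, enorm_mul]
  exact le_of_eq (by ring)

/-- Finitely many monomials are told apart by one system of positive weights: take the powers of a
large integer. -/
theorem exists_weight_injOn (s : Finset (Fin n →₀ ℕ)) :
    ∃ v : Fin n → ℕ, (∀ i, 0 < v i) ∧ Set.InjOn (fun m : Fin n →₀ ℕ => Finsupp.weight v m) s := by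
  classical
  let q (a b : Fin n →₀ ℕ) : Polynomial ℤ :=
    ∑ i : Fin n, Polynomial.monomial (i : ℕ) ((a i : ℤ) - b i)
  have hq : ∀ a b, a ≠ b → q a b ≠ 0 := by
    intro a b hab h
    obtain ⟨i, hi⟩ := Finsupp.ne_iff.mp hab
    have := congrArg (fun p => Polynomial.coeff p (i : ℕ)) h
    simp only [q, Polynomial.finsetSum_coeff, Polynomial.coeff_monomial, Polynomial.coeff_zero,
      Fin.val_inj] at this
    rw [Finset.sum_ite_eq' Finset.univ i, if_pos (Finset.mem_univ _)] at this
    omega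
  have hev : ∀ᶠ M : ℕ in Filter.atTop, ∀ a ∈ s, ∀ b ∈ s, a ≠ b → (q a b).eval (M : ℤ) ≠ 0 := by
    rw [Filter.eventually_all_finset]
    intro a _
    rw [Filter.eventually_all_finset]
    intro b _
    by_cases hab : a = b
    · exact Filter.Eventually.of_forall fun _ h => absurd hab h
    · have hfin : {M : ℕ | (q a b).eval (M : ℤ) = 0}.Finite := by
        have := Polynomial.finite_setOfPred_isRoot (hq a b hab)
        exact this.preimage Nat.cast_injective.injOn
      have := hfin.compl_mem_cofinite
      rw [Nat.cofinite_eq_atTop] at this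
      filter_upwards [this] with M hM _ using hM
  obtain ⟨M, hM, hM1⟩ := (hev.and (Filter.eventually_ge_atTop 1)).exists
  refine ⟨fun i => M ^ (i : ℕ), fun i => by positivity, fun a ha b hb hab => ?_⟩
  by_contra hne
  apply hM a ha b hb hne
  simp only [Finsupp.weight_apply] at hab
  rw [Finsupp.sum_fintype _ _ (by simp), Finsupp.sum_fintype _ _ (by simp)] at hab
  simp only [q, Polynomial.eval_finsetSum, Polynomial.eval_monomial, sub_mul,
    Finset.sum_sub_distrib]
  rw [sub_eq_zero]
  simp only [smul_eq_mul] at hab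
  exact_mod_cast hab

/-- On suitable small polydiscs one monomial of a non-zero polynomial `f` dominates the others.
Hence the norm of a multiple `f * h` controls the norm of `h`. -/
theorem exists_rnorm_le_mul {f : MvPowerSeries (Fin n) ℂ} (hf : f ≠ 0)
    (hfin : {m | coeff m f ≠ 0}.Finite) {r : ℝ≥0} (hr : 0 < r) :
    ∃ ρ : Fin n → ℝ≥0, (∀ i, 0 < ρ i) ∧ (∀ i, ρ i ≤ r) ∧ ∃ K : ℝ≥0∞, K ≠ ⊤ ∧
      ∀ h : MvPowerSeries (Fin n) ℂ, rnorm ρ h ≠ ⊤ → rnorm ρ h ≤ K * rnorm ρ (f * h) := by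
  classical
  set s := hfin.toFinset with hs
  have hmem : ∀ m, m ∈ s ↔ coeff m f ≠ 0 := fun m => by rw [hs, Set.Finite.mem_toFinset]; rfl
  obtain ⟨v, hv, hinj⟩ := exists_weight_injOn s
  have hne : s.Nonempty := by
    obtain ⟨m, hm⟩ := (ne_zero_iff_exists_coeff_ne_zero f).mp hf
    exact ⟨m, (hmem m).mpr hm⟩
  obtain ⟨a, ha, hmin⟩ := s.exists_min_image (fun m => Finsupp.weight v m) hne
  set d := Finsupp.weight v a
  set c := coeff a f
  have hc : c ≠ 0 := (hmem a).mp ha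
  have hc' : 0 < ‖c‖₊ := by simpa using hc
  set T := ∑ m ∈ s, ‖coeff m f‖₊
  -- the radii are powers of one small number `t`
  obtain ⟨t, ht0, ht1, htr, htT⟩ : ∃ t : ℝ≥0, 0 < t ∧ t ≤ 1 ∧ t ≤ r ∧ t * T ≤ ‖c‖₊ / 2 := by
    refine ⟨min (min 1 r) (‖c‖₊ / 2 / (T + 1)), by positivity, ?_, ?_, ?_⟩
    · exact (min_le_left _ _).trans (min_le_left _ _)
    · exact (min_le_left _ _).trans (min_le_right _ _)
    · calc _ ≤ ‖c‖₊ / 2 / (T + 1) * (T + 1) := by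
            gcongr
            · exact min_le_right _ _
            · exact le_self_add
        _ = _ := div_mul_cancel₀ _ (by positivity)
  set ρ : Fin n → ℝ≥0 := fun i => t ^ v i
  have hρ0 : ∀ i, 0 < ρ i := fun i => by positivity
  have hmon : ∀ m, rmon ρ m = (t : ℝ≥0∞) ^ (Finsupp.weight v m) := by
    intro m
    rw [rmon, Finsupp.weight_apply, Finsupp.sum_fintype _ _ (by simp), ← Finset.prod_pow_eq_pow_sum]
    refine Finset.prod_congr rfl fun i _ => ?_
    rw [smul_eq_mul, mul_comm, pow_mul, ENNReal.coe_pow]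
  set g := monomial a c - f
  have hg : rnorm ρ g ≤ ‖c‖ₑ / 2 * t ^ d := by
    have hgm : ∀ m, coeff m g = if m = a then 0 else - coeff m f := by
      intro m
      rw [map_sub, coeff_monomial]
      split_ifs with h
      · rw [h, sub_self]
      · rw [zero_sub]
    have h1 : rnorm ρ g = ∑ m ∈ s, ‖coeff m g‖ₑ * rmon ρ m := by
      rw [rnorm, tsum_eq_sum]
      intro m hm
      rw [hgm]
      split_ifs
      · simp
      · rw [(not_iff_comm.mp (hmem m).symm).mp hm]; simp
    rw [h1]
    calc ∑ m ∈ s, ‖coeff m g‖ₑ * rmon ρ m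
        ≤ ∑ m ∈ s, ‖coeff m f‖ₑ * (t : ℝ≥0∞) ^ (d + 1) := by
          refine Finset.sum_le_sum fun m hm => ?_
          rw [hgm]
          split_ifs with h
          · simp
          · rw [enorm_neg, hmon]
            refine mul_le_mul_right ?_ _
            apply pow_le_pow_of_le_one (by positivity) (by exact_mod_cast ht1)
            refine Nat.succ_le_of_lt (lt_of_le_of_ne (hmin m hm) fun he => h ?_)
            exact hinj hm ha he.symm
      _ = ((t * T : ℝ≥0) : ℝ≥0∞) * t ^ d := by
          rw [← Finset.sum_mul, ENNReal.coe_mul, ENNReal.ofNNReal_finsetSum, pow_succ]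
          simp only [enorm_eq_nnnorm]
          ring
      _ ≤ ((‖c‖₊ / 2 : ℝ≥0) : ℝ≥0∞) * t ^ d := by gcongr
      _ = _ := by rw [ENNReal.coe_div (by norm_num)]; rfl
  set q : ℝ≥0∞ := ‖c‖ₑ / 2 * t ^ d with hqdef
  have hq0 : q ≠ 0 := by
    apply mul_ne_zero
    · exact ENNReal.div_ne_zero.mpr ⟨by simpa using hc, by norm_num⟩
    · apply pow_ne_zero; simpa using ht0.ne'
  have hqt : q ≠ ⊤ := ENNReal.mul_ne_top (ENNReal.div_ne_top enorm_ne_top (by norm_num))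
    (ENNReal.pow_ne_top ENNReal.coe_ne_top)
  have h2q : ‖c‖ₑ * rmon ρ a = q + q := by
    rw [hmon, hqdef, ← add_mul, ENNReal.add_halves]
  refine ⟨ρ, hρ0, fun i => ?_, q⁻¹, ENNReal.inv_ne_top.mpr hq0, fun h hh => ?_⟩
  · exact (pow_le_of_le_one (by positivity) ht1 (hv i).ne').trans htr
  have h3 : q * rnorm ρ h + q * rnorm ρ h ≤ rnorm ρ (f * h) + q * rnorm ρ h := by
    calc q * rnorm ρ h + q * rnorm ρ h = ‖c‖ₑ * rmon ρ a * rnorm ρ h := by rw [h2q, add_mul]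
      _ ≤ rnorm ρ (monomial a c * h) := le_rnorm_monomial_mul _ _ _ _
      _ = rnorm ρ (f * h + g * h) := by rw [← add_mul, add_sub_cancel]
      _ ≤ rnorm ρ (f * h) + rnorm ρ (g * h) := rnorm_add_le _ _ _
      _ ≤ _ := by gcongr; exact (rnorm_mul_le _ _ _).trans (by gcongr)
  have h4 := (ENNReal.add_le_add_iff_right (ENNReal.mul_ne_top hqt hh)).mp h3
  calc rnorm ρ h = q⁻¹ * (q * rnorm ρ h) := by
        rw [← mul_assoc, ENNReal.inv_mul_cancel hq0 hqt, one_mul]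
    _ ≤ _ := by gcongr

theorem rnorm_wmul_wInd_le (ρ : Fin n → ℝ≥0) (P : Set ℤ) (φ : MvPowerSeries (Fin n) ℂ) :
    rnorm ρ (wmul w (wInd P) φ) ≤ rnorm ρ φ := by
  refine ENNReal.tsum_le_tsum fun m => ?_
  gcongr
  rw [coeff_wmul, enorm_mul]
  refine mul_le_of_le_one_left (by positivity) ?_
  have := norm_wInd_le P (Finsupp.weight w m)
  rw [enorm_eq_nnnorm]
  exact_mod_cast this

/-- A formal power series is convergent as soon as its product with a non-zero weighted homogeneous
polynomial is. -/
theorem isConvergent_of_mul (hw : ∀ i, 0 < w i) {d : ℤ} {f : MvPowerSeries (Fin n) ℂ}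
    (hf : IsWHom w d f) (hf0 : f ≠ 0) {h : MvPowerSeries (Fin n) ℂ} (H : IsConvergent (f * h)) :
    IsConvergent h := by
  classical
  obtain ⟨r, hr, hfin⟩ := H.exists_rnorm
  obtain ⟨ρ, hρ0, hρr, K, hK, hle⟩ := exists_rnorm_le_mul hf0
    ((finite_weight_eq hw d).subset fun m hm => hf m hm) hr
  refine isConvergent_of_rnorm hρ0 (ne_top_of_le_ne_top
    (ENNReal.mul_ne_top hK (ne_top_of_le_ne_top hfin (rnorm_mono hρr _))) ?_)
  rw [rnorm]
  rw [ENNReal.tsum_eq_iSup_sum]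
  refine iSup_le fun s => ?_
  obtain ⟨L, hL⟩ : ∃ L : ℕ, ∀ m ∈ s, Finsupp.weight w m ≤ L :=
    ⟨s.sup fun m => Finsupp.weight w m, fun m hm => Finset.le_sup (f := fun m => Finsupp.weight w m) hm⟩
  set hL' := wmul w (wInd {j | j ≤ (L : ℤ)}) h with hdef
  have hco : ∀ m, coeff m hL' = if Finsupp.weight w m ≤ L then coeff m h else 0 := by
    intro m
    rw [hdef, coeff_wmul, wInd, Set.indicator_apply]
    simp only [Set.mem_ofPred_eq, Nat.cast_le, Pi.one_apply]
    split_ifs <;> simp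
  have hfinL : {m : Fin n →₀ ℕ | Finsupp.weight w m ≤ L}.Finite := by
    refine ((Set.finite_Iic L).biUnion fun j _ => finite_weight_eq hw (j : ℤ)).subset ?_
    intro m hm
    exact Set.mem_biUnion hm rfl
  have hnt : rnorm ρ hL' ≠ ⊤ := by
    rw [rnorm, tsum_eq_sum (s := hfinL.toFinset)]
    · exact ENNReal.sum_ne_top.mpr fun m _ => ENNReal.mul_ne_top enorm_ne_top (rmon_ne_top _ _)
    · intro m hm
      rw [hco, if_neg (by simpa using hm)]
      simp
  have hmul : f * hL' = wmul w (wInd {j | j ≤ d + L}) (f * h) := by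
    have : (fun j => wInd {j | j ≤ d + L} (d + j)) = wInd {j | j ≤ (L : ℤ)} := by
      ext j
      simp [wInd, Set.indicator_apply]
    rw [hf.wmul_mul, this]
  calc ∑ m ∈ s, ‖coeff m h‖ₑ * rmon ρ m
      = ∑ m ∈ s, ‖coeff m hL'‖ₑ * rmon ρ m :=
        Finset.sum_congr rfl fun m hm => by rw [hco, if_pos (hL m hm)]
    _ ≤ rnorm ρ hL' := ENNReal.sum_le_tsum _
    _ ≤ K * rnorm ρ (f * hL') := hle _ hnt
    _ ≤ K * rnorm ρ (f * h) := by
      rw [hmul]; gcongr; exact rnorm_wmul_wInd_le _ _ _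

/-- The principal ideal generated by a non-zero weighted homogeneous germ is closed in the adic
topology. -/
theorem mem_span_of_forall_mem_sup (hw : ∀ i, 0 < w i) {d : ℤ} {f : O n} (hf : f ∈ wHom w d)
    (hf0 : f ≠ 0) {g : O n} (h : ∀ k, g ∈ Ideal.span {f} ⊔ maximalIdeal (O n) ^ k) :
    g ∈ Ideal.span {f} := by
  classical
  have key : ∀ l : ℤ, ∃ u : O n, wpart w {d + l} g = f * u ∧ u ∈ wHom w l := by
    intro l
    obtain ⟨a, ha, b, hb, hab⟩ := Submodule.mem_sup.mp (h ((d + l).toNat + 1))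
    obtain ⟨u, rfl⟩ := Ideal.mem_span_singleton.mp ha
    refine ⟨wpart w {l} u, ?_, wpart_mem_wHom _ _⟩
    have hb0 : wpart w {d + l} b = 0 := by
      apply Subtype.ext
      ext m
      rw [coeff_wpart]
      split_ifs with hm
      · rw [Set.mem_singleton_iff] at hm
        exact maximalIdeal_pow_le_wFilt hw _ hb m (by omega)
      · rfl
    rw [← hab, map_add, hb0, add_zero, wpart_mul_singleton hf]
  choose u hu hu' using key
  let φ : MvPowerSeries (Fin n) ℂ := fun m => coeff m (u (Finsupp.weight w m)).1
  have hφ : ∀ m, coeff m φ = coeff m (u (Finsupp.weight w m)).1 := fun _ => rfl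
  have hmul : f.1 * φ = g.1 := by
    ext m
    have h1 := congrArg (fun z : O n => coeff m z.1) (hu ((Finsupp.weight w m : ℤ) - d))
    simp only [coeff_wpart, add_sub_cancel, Set.mem_singleton_iff, if_true] at h1
    rw [h1, Subalgebra.coe_mul, coeff_mul, coeff_mul]
    refine Finset.sum_congr rfl fun p hp => ?_
    by_cases hp0 : coeff p.1 f.1 = 0
    · rw [hp0, zero_mul, zero_mul]
    · rw [hφ, ← Finset.HasAntidiagonal.mem_antidiagonal.mp hp, map_add, ← hf _ hp0]
      congr 4
      push_cast
      ring
  refine Ideal.mem_span_singleton.mpr ⟨⟨φ, isConvergent_of_mul hw hf ?_ ?_⟩, Subtype.ext hmul.symm⟩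
  · intro h; exact hf0 (Subtype.ext h)
  · rw [hmul]; exact g.2

theorem coe_germ (p : MvPolynomial (Fin n) ℂ) :
    (germ p : MvPowerSeries (Fin n) ℂ) = (p : MvPowerSeries (Fin n) ℂ) := by
  have h : ((convergentSeries n).val.comp germ : MvPolynomial (Fin n) ℂ →ₐ[ℂ] _) =
      MvPolynomial.coeToMvPowerSeries.algHom ℂ := by
    apply MvPolynomial.algHom_ext
    intro i
    simp [germ, coord]
  have := DFunLike.congr_fun h p
  simpa using this

theorem germ_mem_wHom {p : MvPolynomial (Fin n) ℂ} {k : ℕ}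
    (hp : MvPolynomial.IsWeightedHomogeneous w p k) : germ p ∈ wHom w k := by
  intro m hm
  rw [coe_germ, MvPolynomial.coeff_coe] at hm
  exact_mod_cast hp hm

end Weights

/-! ### Modules over local Artin algebras -/

section Artin
variable {A : Type} [CommRing A]

/-- A linear map to a flat module that is injective modulo a nilpotent maximal ideal is
injective. -/
theorem injective_of_injective_mod [IsLocalRing A] (hm : IsNilpotent (maximalIdeal A))
    {M P : Type} [AddCommGroup M] [Module A M] [AddCommGroup P] [Module A P] [Module.Flat A P]
    (φ : M →ₗ[A] P) (h : ∀ μ, φ μ ∈ maximalIdeal A • (⊤ : Submodule A P) →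
      μ ∈ maximalIdeal A • (⊤ : Submodule A M)) : Function.Injective φ := by
  rw [← LinearMap.ker_eq_bot]
  have h1 : LinearMap.ker φ ≤ maximalIdeal A • LinearMap.ker φ := fun κ hκ =>
    mem_smul_ker hm φ (fun μ hμ => ⟨0, map_zero _, by simpa using h μ hμ⟩) hκ
      (h κ (by rw [LinearMap.mem_ker.mp hκ]; exact zero_mem _))
  have h2 : ∀ k : ℕ, LinearMap.ker φ ≤ maximalIdeal A ^ k • LinearMap.ker φ := fun k => by
    induction k with
    | zero => simp
    | succ k ih =>
      calc LinearMap.ker φ ≤ maximalIdeal A • LinearMap.ker φ := h1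
        _ ≤ maximalIdeal A • (maximalIdeal A ^ k • LinearMap.ker φ) := Submodule.smul_mono le_rfl ih
        _ = _ := by rw [← Submodule.smul_assoc, smul_eq_mul, pow_succ']
  obtain ⟨k, hk⟩ := hm
  have := h2 k
  rw [hk] at this
  simpa using this

/-- If `Q` is flat and `κ q ∈ 𝔠 Q` with `κ ∉ 𝔠`, then `q ∈ 𝔪 Q`. -/
theorem mem_map_maximalIdeal_of_smul_mem [IsLocalRing A] {Q : Type} [CommRing Q] [Algebra A Q]
    [Module.Flat A Q] {𝔠 : Ideal A} {κ : A} (hκ : κ ∉ 𝔠) {q : Q}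
    (h : κ • q ∈ 𝔠.map (algebraMap A Q)) : q ∈ (maximalIdeal A).map (algebraMap A Q) := by
  have hker : ∀ (I : Ideal A) (q : Q),
      (1 : A ⧸ I) ⊗ₜ[A] q = 0 ↔ q ∈ I.map (algebraMap A Q) := by
    intro I q
    have h1 := LinearMap.ker_tensorProductMk (R := A) (Q := Q) (I := I)
    have h2 : q ∈ LinearMap.ker ((TensorProduct.mk A (A ⧸ I) Q) 1) ↔ q ∈ I • (⊤ : Submodule A Q) := by
      rw [← h1]
    rw [LinearMap.mem_ker, Ideal.smul_top_eq_map] at h2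
    exact h2
  -- the annihilator of `κ` modulo `𝔠`
  let g₀ : A →ₗ[A] A ⧸ 𝔠 := (LinearMap.toSpanSingleton A (A ⧸ 𝔠) (Ideal.Quotient.mk 𝔠 κ))
  let 𝔞 : Ideal A := LinearMap.ker g₀
  let g : (A ⧸ 𝔞) →ₗ[A] A ⧸ 𝔠 := Submodule.liftQ 𝔞 g₀ le_rfl
  have hg : Function.Injective g := by
    rw [← LinearMap.ker_eq_bot]
    exact Submodule.ker_liftQ_eq_bot _ _ _ le_rfl
  have h𝔞 : 𝔞 ≤ maximalIdeal A := by
    intro a ha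
    rw [mem_maximalIdeal, mem_nonunits_iff]
    intro hu
    apply hκ
    have h1 : a • Ideal.Quotient.mk 𝔠 κ = 0 := ha
    have h2 : a * κ ∈ 𝔠 := by
      rw [← Ideal.Quotient.eq_zero_iff_mem, map_mul]
      exact h1
    exact (Ideal.unit_mul_mem_iff_mem 𝔠 hu).mp h2
  have h1 : (g.rTensor Q) ((1 : A ⧸ 𝔞) ⊗ₜ[A] q) = 0 := by
    have h2 : g (1 : A ⧸ 𝔞) = κ • (1 : A ⧸ 𝔠) := by
      change g₀ 1 = _
      simp only [g₀, LinearMap.toSpanSingleton_apply, one_smul]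
      rw [Algebra.smul_def, mul_one]
      rfl
    rw [LinearMap.rTensor_tmul, h2, TensorProduct.smul_tmul]
    exact (hker 𝔠 _).mpr h
  have h3 := Module.Flat.rTensor_preserves_injective_linearMap (M := Q) g hg
  have h4 := (hker 𝔞 q).mp (h3 (h1.trans (map_zero _).symm))
  exact Ideal.map_mono h𝔞 h4

variable [Algebra ℂ A] [IsLocalRing A] [Module.Finite ℂ A]

/-- A non-zero ideal of a local Artin algebra contains a subideal of colength one. -/
theorem exists_ideal_step {𝔟 : Ideal A} (h : 𝔟 ≠ ⊥) :
    ∃ 𝔠 < 𝔟, ∃ κ ∈ 𝔟, κ ∉ 𝔠 ∧ (∀ a ∈ maximalIdeal A, ∀ b ∈ 𝔟, a * b ∈ 𝔠) ∧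
      ∀ b ∈ 𝔟, ∃ c : ℂ, b - c • κ ∈ 𝔠 := by
  have : IsArtinianRing A := IsArtinianRing.of_finite ℂ A
  have hwf : WellFounded (fun I J : Ideal A => J < I) := wellFounded_gt
  obtain ⟨𝔠, (hlt : 𝔠 < 𝔟), hmax⟩ := hwf.has_min {𝔠 | 𝔠 < 𝔟} ⟨⊥, bot_lt_iff_ne_bot.mpr h⟩
  obtain ⟨κ, hκ, hκ'⟩ := Set.exists_of_ssubset (show (𝔠 : Set A) ⊂ 𝔟 from hlt)
  have hsup : ∀ 𝔡 ≤ 𝔟, ¬ 𝔡 ≤ 𝔠 → 𝔟 = 𝔠 ⊔ 𝔡 := by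
    intro 𝔡 h1 h2
    by_contra h3
    have h4 : 𝔠 ⊔ 𝔡 < 𝔟 := lt_of_le_of_ne (sup_le (le_of_lt hlt) h1) (Ne.symm h3)
    have h5 : 𝔠 < 𝔠 ⊔ 𝔡 := left_lt_sup.mpr h2
    exact hmax (𝔠 ⊔ 𝔡) h4 h5
  have hm : maximalIdeal A * 𝔟 ≤ 𝔠 := by
    by_contra hcon
    have h1 : 𝔟 = 𝔠 ⊔ maximalIdeal A * 𝔟 := hsup (maximalIdeal A * 𝔟) Ideal.mul_le_right hcon
    have h2 : ∀ k : ℕ, 𝔟 ≤ 𝔠 ⊔ maximalIdeal A ^ k * 𝔟 := fun k => by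
      induction k with
      | zero => simp
      | succ k ih =>
        calc 𝔟 = 𝔠 ⊔ maximalIdeal A * 𝔟 := h1
          _ ≤ 𝔠 ⊔ maximalIdeal A * (𝔠 ⊔ maximalIdeal A ^ k * 𝔟) := by gcongr
          _ = 𝔠 ⊔ (maximalIdeal A * 𝔠 ⊔ maximalIdeal A ^ (k + 1) * 𝔟) := by
            rw [Ideal.mul_sup, pow_succ', mul_assoc]
          _ ≤ _ := sup_le le_sup_left (sup_le_sup_right Ideal.mul_le_right _)
    obtain ⟨k, hk⟩ := isNilpotent_maximalIdeal (A := A)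
    have := h2 k
    rw [hk] at this
    exact absurd (by simpa using this) (not_le_of_gt hlt)
  refine ⟨𝔠, hlt, κ, hκ, hκ', fun a ha b hb => hm (Ideal.mul_mem_mul ha hb), fun b hb => ?_⟩
  have h1 := hsup (Ideal.span {κ}) ((Ideal.span_singleton_le_iff_mem _).mpr hκ)
    fun h => hκ' (h (Ideal.mem_span_singleton_self κ))
  rw [h1] at hb
  obtain ⟨c, hc, d, hd, rfl⟩ := Submodule.mem_sup.mp hb
  obtain ⟨a, rfl⟩ := Ideal.mem_span_singleton'.mp hd
  refine ⟨residueHom A a, ?_⟩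
  have h2 : c + a * κ - residueHom A a • κ = c + (a - algebraMap ℂ A (residueHom A a)) * κ := by
    rw [Algebra.smul_def]; ring
  rw [h2]
  exact add_mem hc (hm (Ideal.mul_mem_mul (residueHom_eq_zero.mp (by simp)) hκ))

/-- Descending induction along ideals. -/
theorem ideal_devissage {P : Ideal A → Prop} {𝔟₀ : Ideal A} (h₀ : P 𝔟₀)
    (h : ∀ 𝔟 ≤ 𝔟₀, P 𝔟 → ∀ 𝔠 < 𝔟, ∀ κ ∈ 𝔟, κ ∉ 𝔠 → (∀ a ∈ maximalIdeal A, ∀ b ∈ 𝔟, a * b ∈ 𝔠) →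
      (∀ b ∈ 𝔟, ∃ c : ℂ, b - c • κ ∈ 𝔠) → P 𝔠) : P ⊥ := by
  have : IsArtinianRing A := IsArtinianRing.of_finite ℂ A
  obtain ⟨𝔟, ⟨hle, hP⟩, hmin⟩ := (wellFounded_lt (α := Ideal A)).has_min
    {𝔟 | 𝔟 ≤ 𝔟₀ ∧ P 𝔟} ⟨𝔟₀, le_rfl, h₀⟩
  by_cases hb : 𝔟 = ⊥
  · exact hb ▸ hP
  · obtain ⟨𝔠, hlt, κ, h1, h2, h3, h4⟩ := exists_ideal_step hb
    exact absurd hlt (hmin 𝔠 ⟨hlt.le.trans hle, h 𝔟 hle hP 𝔠 hlt κ h1 h2 h3 h4⟩)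

/-- Modulo `𝔠 Q`, every element of `𝔟 Q` is a multiple of `κ` when `𝔟 = 𝔠 + ℂ κ`. -/
theorem exists_sub_smul_mem {A : Type} [CommRing A] [Algebra ℂ A] {Q : Type} [CommRing Q] [Algebra A Q] {𝔟 𝔠 : Ideal A} {κ : A}
    (h : ∀ b ∈ 𝔟, ∃ c : ℂ, b - c • κ ∈ 𝔠) {z : Q} (hz : z ∈ 𝔟.map (algebraMap A Q)) :
    ∃ q : Q, z - κ • q ∈ 𝔠.map (algebraMap A Q) := by
  induction hz using Submodule.span_induction with
  | mem x hx =>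
    obtain ⟨b, hb, rfl⟩ := hx
    obtain ⟨c, hc⟩ := h b hb
    refine ⟨algebraMap A Q (algebraMap ℂ A c), ?_⟩
    have := Ideal.mem_map_of_mem (algebraMap A Q) hc
    rwa [map_sub, Algebra.smul_def, mul_comm, map_mul, ← Algebra.smul_def] at this
  | zero => exact ⟨0, by simp⟩
  | add x y _ _ hx hy =>
    obtain ⟨q, hq⟩ := hx
    obtain ⟨r, hr⟩ := hy
    refine ⟨q + r, ?_⟩
    rw [smul_add, add_sub_add_comm]
    exact add_mem hq hr
  | smul a x _ hx =>
    obtain ⟨q, hq⟩ := hx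
    refine ⟨a * q, ?_⟩
    rw [smul_eq_mul, ← mul_smul_comm, ← mul_sub]
    exact Ideal.mul_mem_left _ _ hq

theorem smul_mem_map_of_mem {A : Type} [CommRing A] {Q : Type} [CommRing Q] [Algebra A Q]
    {𝔪 𝔠 : Ideal A} {κ : A} (h : ∀ a ∈ 𝔪, a * κ ∈ 𝔠) {z : Q} (hz : z ∈ 𝔪.map (algebraMap A Q)) :
    κ • z ∈ 𝔠.map (algebraMap A Q) := by
  induction hz using Submodule.span_induction with
  | mem z hz =>
    obtain ⟨a, ha, rfl⟩ := hz
    rw [Algebra.smul_def, ← map_mul, mul_comm]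
    exact Ideal.mem_map_of_mem _ (h a ha)
  | zero => simp
  | add x y _ _ hx hy => rw [smul_add]; exact add_mem hx hy
  | smul a x _ hx => rw [smul_eq_mul, ← mul_smul_comm]; exact Ideal.mul_mem_left _ _ hx

end Artin

/-! ### Coordinates and uniqueness of maps out of a ring of germs -/

/-- Hadamard's lemma holds in `S` with respect to the family `x`. -/
def IsHadamard {S ι : Type} [CommRing S] [Algebra ℂ S] [Fintype ι] (x : ι → S) : Prop :=
  ∀ s, ∃ (c : ℂ) (t : ι → S), s = algebraMap ℂ S c + ∑ i, x i * t i

/-- A map that is additive and `x_i`-linear modulo an ideal `N`, and vanishes on constants modulo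
`N`, vanishes modulo `N` when `N` is closed in the `x`-adic topology. -/
theorem IsHadamard.mem_of_mul {S Q ι : Type} [CommRing S] [Algebra ℂ S] [CommRing Q] [Fintype ι]
    {x : ι → S} (hx : IsHadamard x) {y : ι → Q} {N : Ideal Q} (q : S → Q)
    (hadd : ∀ s t, q (s + t) - (q s + q t) ∈ N) (hc : ∀ c, q (algebraMap ℂ S c) ∈ N)
    (hmul : ∀ i t, q (x i * t) - y i * q t ∈ N)
    (hsep : ∀ z, (∀ k, z ∈ N ⊔ Ideal.span (Set.range y) ^ k) → z ∈ N) (s : S) : q s ∈ N := by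
  let D : S →+ Q ⧸ N := AddMonoidHom.mk' (fun s => Ideal.Quotient.mk N (q s)) fun s t => by
    rw [← map_add, Ideal.Quotient.eq]; exact hadd s t
  have hD : ∀ s, D s = Ideal.Quotient.mk N (q s) := fun _ => rfl
  apply hsep
  intro k
  induction k generalizing s with
  | zero => simp
  | succ k ih =>
    obtain ⟨c, t, hs⟩ := hx s
    have h1 : Ideal.Quotient.mk N (q s) = Ideal.Quotient.mk N (∑ i, y i * q (t i)) := by
      rw [← hD, hs, map_add, map_sum, hD, Ideal.Quotient.eq_zero_iff_mem.mpr (hc c), zero_add,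
        map_sum]
      refine Finset.sum_congr rfl fun i _ => ?_
      rw [hD, Ideal.Quotient.eq]
      exact hmul i _
    have h2 : q s = (q s - ∑ i, y i * q (t i)) + ∑ i, y i * q (t i) := by ring
    rw [h2]
    refine add_mem (Submodule.mem_sup_left (Ideal.Quotient.eq.mp h1)) (sum_mem fun i _ => ?_)
    obtain ⟨a, ha, b, hb, hab⟩ := Submodule.mem_sup.mp (ih (t i))
    rw [← hab, mul_add]
    refine add_mem (Submodule.mem_sup_left (N.mul_mem_left _ ha)) (Submodule.mem_sup_right ?_)
    rw [pow_succ']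
    exact Ideal.mul_mem_mul (Ideal.subset_span ⟨i, rfl⟩) hb

/-- A version of the previous lemma for values in a flat family over a local Artin algebra, where
separatedness is only required for the special fibre. -/
theorem IsHadamard.eq_zero_of_mul {A S Q ι : Type} [CommRing A] [Algebra ℂ A] [IsLocalRing A]
    [Module.Finite ℂ A] [CommRing S] [Algebra ℂ S] [CommRing Q] [Algebra A Q] [Module.Flat A Q]
    [Fintype ι] {x : ι → S} (hx : IsHadamard x) {y : ι → Q} (D : S →+ Q)
    (hc : ∀ c, D (algebraMap ℂ S c) = 0) (hmul : ∀ i t, D (x i * t) = y i * D t)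
    (hsep : ∀ z, (∀ k, z ∈ (maximalIdeal A).map (algebraMap A Q) ⊔ Ideal.span (Set.range y) ^ k) →
      z ∈ (maximalIdeal A).map (algebraMap A Q)) : D = 0 := by
  have key : ∀ s, D s ∈ (⊥ : Ideal A).map (algebraMap A Q) := by
    refine ideal_devissage (P := fun 𝔟 => ∀ s, D s ∈ 𝔟.map (algebraMap A Q)) (𝔟₀ := ⊤)
      (fun s => by rw [Ideal.map_top]; trivial) ?_
    intro 𝔟 _ hP 𝔠 _ κ hκ hκ' hm hone s
    choose q hq using fun s => exists_sub_smul_mem hone (hP s)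
    have hmem : ∀ z, κ • z ∈ 𝔠.map (algebraMap A Q) → z ∈ (maximalIdeal A).map (algebraMap A Q) :=
      fun z hz => mem_map_maximalIdeal_of_smul_mem hκ' hz
    have hqs : q s ∈ (maximalIdeal A).map (algebraMap A Q) := by
      refine hx.mem_of_mul q (fun s t => hmem _ ?_) (fun c => hmem _ ?_) (fun i t => hmem _ ?_) hsep s
      · have h1 := sub_mem (add_mem (hq s) (hq t)) (hq (s + t))
        rw [map_add] at h1
        convert h1 using 1
        rw [smul_sub, smul_add]; ring
      · have h1 := neg_mem (hq (algebraMap ℂ S c))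
        rwa [hc, zero_sub, neg_neg] at h1
      · have h1 := sub_mem (Ideal.mul_mem_left _ (y i) (hq t)) (hq (x i * t))
        rw [hmul] at h1
        convert h1 using 1
        rw [smul_sub, mul_sub, mul_smul_comm]; ring
    have h2 : κ • q s ∈ 𝔠.map (algebraMap A Q) := by
      exact smul_mem_map_of_mem (fun a ha => hm a ha κ hκ) hqs
    have := add_mem (hq s) h2
    rwa [sub_add_cancel] at this
  ext s
  have := key s
  rwa [Ideal.map_bot, Ideal.mem_bot] at this

/-! ### Hypersurfaces over a local Artin algebra -/

section Hypersurface
variable {A S : Type} [CommRing A] [Algebra ℂ A] [IsLocalRing A] [Module.Finite ℂ A]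
  [CommRing S] [Algebra ℂ S]

theorem fibreMap_eq_zero_iff {z : A ⊗[ℂ] S} :
    fibreMap A S z = 0 ↔ z ∈ maximalIdeal A • (⊤ : Submodule A (A ⊗[ℂ] S)) := by
  refine ⟨fun h => ?_, fibreMap_eq_zero⟩
  have := sub_fibreMap_mem z
  rwa [h, TensorProduct.tmul_zero, sub_zero] at this

theorem fibreMap_eq_zero_iff' {z : A ⊗[ℂ] S} :
    fibreMap A S z = 0 ↔ z ∈ (maximalIdeal A).map (algebraMap A (A ⊗[ℂ] S)) := by
  rw [fibreMap_eq_zero_iff, Ideal.smul_top_eq_map]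
  rfl

theorem isNilpotent_of_fibreMap_eq_zero {z : A ⊗[ℂ] S} (h : fibreMap A S z = 0) :
    IsNilpotent z := by
  obtain ⟨k, hk⟩ := isNilpotent_maximalIdeal (A := A)
  refine ⟨k, ?_⟩
  have := Ideal.pow_mem_pow (fibreMap_eq_zero_iff'.mp h) k
  rw [← Ideal.map_pow, hk] at this
  simpa using this

theorem isUnit_of_fibreMap {z : A ⊗[ℂ] S} (h : IsUnit (fibreMap A S z)) : IsUnit z := by
  obtain ⟨v, hv⟩ := h.exists_right_inv
  have h1 : IsNilpotent (z * 1 ⊗ₜ v - 1) := isNilpotent_of_fibreMap_eq_zero (by simp [hv])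
  have h2 : IsUnit (z * 1 ⊗ₜ v) := by
    have := h1.isUnit_add_one
    rwa [sub_add_cancel] at this
  exact isUnit_of_mul_isUnit_left h2

variable [IsDomain S] {f : S} {F : A ⊗[ℂ] S}

theorem eq_zero_of_mul_eq_zero_of_fibreMap (hf : f ≠ 0) (hF : fibreMap A S F = f) {z : A ⊗[ℂ] S}
    (h : F * z = 0) : z = 0 := by
  have := injective_of_injective_mod isNilpotent_maximalIdeal (LinearMap.mulLeft A F) fun μ hμ => by
    rw [← fibreMap_eq_zero_iff] at hμ ⊢
    rw [LinearMap.mulLeft_apply, map_mul, hF] at hμ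
    exact (mul_eq_zero.mp hμ).resolve_left hf
  exact this (by simpa using h)

/-- The quotient by a lift of a non-zero germ is flat over the base, because it is a direct summand
of the ambient ring. -/
theorem flat_quotient_span (hf : f ≠ 0) (hF : fibreMap A S F = f) :
    Module.Flat A ((A ⊗[ℂ] S) ⧸ Ideal.span {F}) := by
  -- `q` is a linear left inverse of multiplication by `f`
  obtain ⟨q, hq⟩ := LinearMap.exists_leftInverse_of_injective (LinearMap.mulLeft ℂ f)
    (LinearMap.ker_eq_bot.mpr (mul_right_injective₀ hf))
  have hq : ∀ s, q (f * s) = s := fun s => DFunLike.congr_fun hq s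
  let qA : A ⊗[ℂ] S →ₗ[A] A ⊗[ℂ] S := q.baseChange A
  have hqA : ∀ z, qA ((1 ⊗ₜ f) * z) = z := fun z => by
    induction z using TensorProduct.induction_on with
    | zero => simp
    | add x y hx hy => rw [mul_add, map_add, hx, hy]
    | tmul a s => simp [qA, hq]
  let ψ : A ⊗[ℂ] S →ₗ[A] A ⊗[ℂ] S := LinearMap.id + LinearMap.mulLeft A (F - 1 ⊗ₜ f) ∘ₗ qA
  have hψ : ∀ z, ψ z = z + (F - 1 ⊗ₜ f) * qA z := fun _ => rfl
  have hψ0 : ∀ z, fibreMap A S (ψ z) = fibreMap A S z := fun z => by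
    rw [hψ, map_add, map_mul, map_sub, hF]; simp
  have hinj : Function.Injective ψ := injective_of_injective_mod isNilpotent_maximalIdeal ψ
    fun μ hμ => by rwa [← fibreMap_eq_zero_iff, hψ0, fibreMap_eq_zero_iff] at hμ
  have hsurj : Function.Surjective ψ := by
    rw [← LinearMap.range_eq_top]
    refine nilpotent_nakayama isNilpotent_maximalIdeal fun z _ => ?_
    have h1 : z - ψ z ∈ maximalIdeal A • (⊤ : Submodule A (A ⊗[ℂ] S)) := by
      rw [← fibreMap_eq_zero_iff, map_sub, hψ0, sub_self]
    have := add_mem (Submodule.mem_sup_left (LinearMap.mem_range_self ψ z))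
      (Submodule.mem_sup_right h1)
    rwa [add_sub_cancel] at this
  let e := LinearEquiv.ofBijective ψ ⟨hinj, hsurj⟩
  let p : A ⊗[ℂ] S →ₗ[A] A ⊗[ℂ] S :=
    (LinearMap.id - LinearMap.mulLeft A (1 ⊗ₜ f) ∘ₗ qA) ∘ₗ e.symm.toLinearMap
  have hpψ : ∀ z, p (ψ z) = z - (1 ⊗ₜ f) * qA z := fun z => by
    have : e.symm (ψ z) = z := e.symm_apply_apply z
    simp [p, this]
  have hpF : ∀ z ∈ (Ideal.span {F}).restrictScalars A, p z = 0 := fun z hz => by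
    obtain ⟨y, rfl⟩ := Ideal.mem_span_singleton.mp hz
    have : F * y = ψ ((1 ⊗ₜ f) * y) := by rw [hψ, hqA]; ring
    rw [this, hpψ, hqA, sub_self]
  let s : ((A ⊗[ℂ] S) ⧸ Ideal.span {F}) →ₗ[A] A ⊗[ℂ] S :=
    Submodule.liftQ ((Ideal.span {F}).restrictScalars A) p hpF
  refine Module.Flat.of_retract s (Ideal.Quotient.mkₐ A (Ideal.span {F})).toLinearMap ?_
  apply LinearMap.ext
  intro z
  obtain ⟨z, rfl⟩ := Ideal.Quotient.mk_surjective z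
  obtain ⟨y, rfl⟩ := hsurj z
  change Ideal.Quotient.mk _ (p (ψ y)) = Ideal.Quotient.mk _ (ψ y)
  rw [Ideal.Quotient.eq, Ideal.mem_span_singleton]
  refine ⟨- qA y, ?_⟩
  rw [hpψ, hψ]; ring

end Hypersurface

/-! ### Exponentials of nilpotent derivations -/

section Exp
variable {A T : Type} [CommRing A] [CommRing T] [Algebra A T] [Algebra ℂ T]

/-- The `ℚ`-vector space underlying a `ℂ`-algebra. -/
abbrev ratModule (T : Type) [CommRing T] [Algebra ℂ T] : Module ℚ T :=
  Module.compHom T (algebraMap ℚ ℂ)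

/-- The exponential of a nilpotent derivation, as an automorphism of algebras. -/
def expAut (θ : Derivation A T T) (h : IsNilpotent (θ : Module.End A T)) : T ≃ₐ[A] T :=
  letI := ratModule T
  have hmul : ∀ x y, (θ : Module.End A T) (x * y) = x * θ y + θ x * y := fun x y => by
    change θ (x * y) = _
    rw [Derivation.leibniz, smul_eq_mul, smul_eq_mul, mul_comm y]
  have hone : IsNilpotent.exp (θ : Module.End A T) 1 = 1 := by
    obtain ⟨k, hk⟩ := h
    rw [IsNilpotent.exp_eq_sum (k := k + 1) (by rw [pow_succ, hk, zero_mul]),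
      Finset.sum_range_succ', LinearMap.add_apply, LinearMap.sum_apply, Finset.sum_eq_zero]
    · simp
    · intro i _
      rw [LinearMap.smul_apply, pow_succ]
      change _ • ((θ : Module.End A T) ^ i) (θ 1) = 0
      rw [Derivation.map_one_eq_zero, map_zero, smul_zero]
  AlgEquiv.ofLinearEquiv
    { toLinearMap := IsNilpotent.exp (θ : Module.End A T)
      invFun := ⇑(IsNilpotent.exp (-(θ : Module.End A T)))
      left_inv := fun x => by
        change (IsNilpotent.exp (-(θ : Module.End A T)) * IsNilpotent.exp (θ : Module.End A T)) x = x
        rw [IsNilpotent.exp_neg_mul_exp_self h]; rfl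
      right_inv := fun x => by
        change (IsNilpotent.exp (θ : Module.End A T) * IsNilpotent.exp (-(θ : Module.End A T))) x = x
        rw [IsNilpotent.exp_mul_exp_neg_self h]; rfl }
    hone fun x y => Module.End.exp_mul_of_derivation A T θ hmul h x y

theorem expAut_apply (θ : Derivation A T T) (h : IsNilpotent (θ : Module.End A T)) {k : ℕ}
    (hk : (θ : Module.End A T) ^ k = 0) (z : T) :
    expAut θ h z = ∑ i ∈ Finset.range k, ((i.factorial : ℂ)⁻¹) • ((θ : Module.End A T) ^ i) z := by
  let := ratModule T
  change IsNilpotent.exp (θ : Module.End A T) z = _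
  rw [IsNilpotent.exp_eq_sum hk, LinearMap.sum_apply]
  refine Finset.sum_congr rfl fun i _ => ?_
  rw [LinearMap.smul_apply]
  change (algebraMap ℚ ℂ ((i.factorial : ℚ)⁻¹)) • (((θ : Module.End A T) ^ i) z) = _
  simp

end Exp

section ExpFibre
variable {A B S : Type} [CommRing A] [Algebra ℂ A] [IsLocalRing A] [Module.Finite ℂ A]
  [CommRing B] [Algebra ℂ B] [IsLocalRing B] [Module.Finite ℂ B] [CommRing S] [Algebra ℂ S]

theorem isNilpotent_of_restrictDer_eq_zero {θ : Derivation A (A ⊗[ℂ] S) (A ⊗[ℂ] S)}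
    (h : ∀ z, fibreMap A S (θ z) = 0) : IsNilpotent (θ : Module.End A (A ⊗[ℂ] S)) := by
  have key : ∀ (k : ℕ) z, ((θ : Module.End A (A ⊗[ℂ] S)) ^ k) z ∈
      maximalIdeal A ^ k • (⊤ : Submodule A (A ⊗[ℂ] S)) := by
    intro k
    induction k with
    | zero =>
      intro z
      rw [pow_zero, pow_zero, Ideal.one_eq_top, Submodule.top_smul]
      trivial
    | succ k ih =>
      intro z
      rw [pow_succ' (θ : Module.End A (A ⊗[ℂ] S)) k]
      have h1 := Submodule.mem_map_of_mem (f := (θ : Module.End A (A ⊗[ℂ] S))) (ih z)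
      rw [Submodule.map_smul''] at h1
      have h2 : (⊤ : Submodule A (A ⊗[ℂ] S)).map (θ : Module.End A (A ⊗[ℂ] S)) ≤
          maximalIdeal A • ⊤ := by
        rintro _ ⟨y, _, rfl⟩
        exact fibreMap_eq_zero_iff.mp (h y)
      have h3 := Submodule.smul_mono (le_refl (maximalIdeal A ^ k)) h2 h1
      rwa [← Submodule.smul_assoc, smul_eq_mul, ← pow_succ] at h3
  obtain ⟨k, hk⟩ := isNilpotent_maximalIdeal (A := A)
  refine ⟨k, LinearMap.ext fun z => ?_⟩
  have := key k z
  rw [hk] at this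
  simpa using this

/-- Automorphisms of `ℂⁿ × Spec A` over `Spec A` obtained by composing exponentials of vector
fields that vanish on the central fibre. -/
def gaugeGroup (A S : Type) [CommRing A] [Algebra ℂ A] [IsLocalRing A] [Module.Finite ℂ A]
    [CommRing S] [Algebra ℂ S] : Subgroup ((A ⊗[ℂ] S) ≃ₐ[A] (A ⊗[ℂ] S)) :=
  Subgroup.closure {φ | ∃ (θ : Derivation A (A ⊗[ℂ] S) (A ⊗[ℂ] S))
    (h : ∀ z, fibreMap A S (θ z) = 0), φ = expAut θ (isNilpotent_of_restrictDer_eq_zero h)}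

theorem expAut_mem_gaugeGroup {θ : Derivation A (A ⊗[ℂ] S) (A ⊗[ℂ] S)}
    (h : ∀ z, fibreMap A S (θ z) = 0) :
    expAut θ (isNilpotent_of_restrictDer_eq_zero h) ∈ gaugeGroup A S :=
  Subgroup.subset_closure ⟨θ, h, rfl⟩

theorem fibreMap_expAut {θ : Derivation A (A ⊗[ℂ] S) (A ⊗[ℂ] S)}
    (h : ∀ z, fibreMap A S (θ z) = 0) (hn : IsNilpotent (θ : Module.End A (A ⊗[ℂ] S)))
    (z : A ⊗[ℂ] S) : fibreMap A S (expAut θ hn z) = fibreMap A S z := by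
  obtain ⟨k, hk⟩ := id hn
  have hk' : (θ : Module.End A (A ⊗[ℂ] S)) ^ (k + 1) = 0 := by rw [pow_succ, hk, zero_mul]
  rw [expAut_apply θ hn hk', Finset.sum_range_succ', map_add, map_sum, Finset.sum_eq_zero]
  · simp
  · intro i _
    rw [map_smul, pow_succ']
    change _ • fibreMap A S (θ _) = 0
    rw [h, smul_zero]

theorem fibreMap_gauge {φ : (A ⊗[ℂ] S) ≃ₐ[A] (A ⊗[ℂ] S)} (hφ : φ ∈ gaugeGroup A S)
    (z : A ⊗[ℂ] S) : fibreMap A S (φ z) = fibreMap A S z := by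
  induction hφ using Subgroup.closure_induction generalizing z with
  | mem φ hφ =>
    obtain ⟨θ, h, rfl⟩ := hφ
    exact fibreMap_expAut h _ z
  | one => rfl
  | mul φ ψ _ _ h1 h2 => rw [AlgEquiv.mul_apply, h1, h2]
  | inv φ _ h1 =>
    rw [← h1]
    congr 1
    exact φ.apply_symm_apply z

/-- The exponential agrees with its first order approximation modulo the second order terms. -/
theorem expAut_sub_mem {θ : Derivation A (A ⊗[ℂ] S) (A ⊗[ℂ] S)}
    (hn : IsNilpotent (θ : Module.End A (A ⊗[ℂ] S))) {𝔠 : Ideal A}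
    (h : ∀ z, θ (θ z) ∈ 𝔠 • (⊤ : Submodule A (A ⊗[ℂ] S))) (z : A ⊗[ℂ] S) :
    expAut θ hn z - (z + θ z) ∈ 𝔠 • (⊤ : Submodule A (A ⊗[ℂ] S)) := by
  obtain ⟨k, hk⟩ := id hn
  have hk' : (θ : Module.End A (A ⊗[ℂ] S)) ^ (k + 2) = 0 := by rw [pow_add, hk, zero_mul]
  rw [expAut_apply θ hn hk', Finset.sum_range_succ', Finset.sum_range_succ']
  have h1 : ∀ z : A ⊗[ℂ] S, ∀ c : ℂ, z ∈ 𝔠 • (⊤ : Submodule A (A ⊗[ℂ] S)) →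
      c • z ∈ 𝔠 • (⊤ : Submodule A (A ⊗[ℂ] S)) := fun z c hz => by
    rw [← algebraMap_smul A c z]
    exact Submodule.smul_mem _ _ hz
  have h2 : ∀ i z, ((θ : Module.End A (A ⊗[ℂ] S)) ^ (i + 1 + 1)) z ∈
      𝔠 • (⊤ : Submodule A (A ⊗[ℂ] S)) := by
    intro i z
    rw [add_assoc, pow_add, Module.End.mul_apply]
    have h3 : ((θ : Module.End A (A ⊗[ℂ] S)) ^ (1 + 1)) z = θ (θ z) := by
      rw [pow_succ, pow_one]; rfl
    rw [h3]
    have := Submodule.mem_map_of_mem (f := (θ : Module.End A (A ⊗[ℂ] S)) ^ i) (h z)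
    rw [Submodule.map_smul''] at this
    exact Submodule.smul_mono le_rfl le_top this
  have h3 : ∑ i ∈ Finset.range k, (((i + 1 + 1).factorial : ℂ)⁻¹) •
      ((θ : Module.End A (A ⊗[ℂ] S)) ^ (i + 1 + 1)) z ∈ 𝔠 • (⊤ : Submodule A (A ⊗[ℂ] S)) :=
    Submodule.sum_mem _ fun i _ => h1 _ _ (h2 i z)
  convert h3 using 1
  simp
  abel

/-! ### Lifting along a change of base -/

theorem surjective_changeMap {g : B →ₐ[ℂ] A} (hg : Function.Surjective g) :
    Function.Surjective (changeMap S g) := by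
  intro z
  induction z using TensorProduct.induction_on with
  | zero => exact ⟨0, map_zero _⟩
  | add x y hx hy =>
    obtain ⟨x, rfl⟩ := hx
    obtain ⟨y, rfl⟩ := hy
    exact ⟨x + y, map_add _ _ _⟩
  | tmul a s =>
    obtain ⟨b, rfl⟩ := hg a
    exact ⟨b ⊗ₜ s, by simp [changeMap]⟩

theorem changeMap_tmul (g : B →ₐ[ℂ] A) (b : B) (s : S) :
    changeMap S g (b ⊗ₜ s) = g b ⊗ₜ s := by simp [changeMap]

theorem changeMap_smul (g : B →ₐ[ℂ] A) (b : B) (z : B ⊗[ℂ] S) :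
    changeMap S g (b • z) = g b • changeMap S g z := by
  induction z using TensorProduct.induction_on with
  | zero => simp
  | add x y hx hy => rw [smul_add, map_add, hx, hy, map_add, smul_add]
  | tmul c s => simp [TensorProduct.smul_tmul', changeMap_tmul]

theorem residueHom_comp (g : B →ₐ[ℂ] A) (b : B) : residueHom A (g b) = residueHom B b :=
  DFunLike.congr_fun (residueHom_unique ((residueHom A).comp g)) b

/-- Relative vector fields lift along a surjective change of base. -/
theorem exists_der_lift {g : B →ₐ[ℂ] A} (hg : Function.Surjective g)
    (δ : Derivation A (A ⊗[ℂ] S) (A ⊗[ℂ] S)) :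
    ∃ δ' : Derivation B (B ⊗[ℂ] S) (B ⊗[ℂ] S), ∀ z, changeMap S g (δ' z) = δ (changeMap S g z) := by
  obtain ⟨d, hd⟩ := exists_der_decomp (Module.finBasis ℂ A) δ
  choose b hb using fun i => hg (Module.finBasis ℂ A i)
  refine ⟨∑ i, b i • extendDer B (d i), fun z => ?_⟩
  rw [hd, der_sum_apply, der_sum_apply, map_sum]
  refine Finset.sum_congr rfl fun i _ => ?_
  rw [Derivation.smul_apply, Derivation.smul_apply, changeMap_smul, hb]
  congr 1
  induction z using TensorProduct.induction_on with
  | zero => simp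
  | add x y hx hy => simp only [map_add, hx, hy]
  | tmul b s => rw [changeMap_tmul, extendDer_tmul, extendDer_tmul, changeMap_tmul]

theorem exists_der_lift_fibre {g : B →ₐ[ℂ] A} (hg : Function.Surjective g)
    (θ : Derivation A (A ⊗[ℂ] S) (A ⊗[ℂ] S)) (h : ∀ z, fibreMap A S (θ z) = 0) :
    ∃ θ' : Derivation B (B ⊗[ℂ] S) (B ⊗[ℂ] S), (∀ z, fibreMap B S (θ' z) = 0) ∧
      ∀ z, changeMap S g (θ' z) = θ (changeMap S g z) := by
  obtain ⟨θ', hθ'⟩ := exists_der_lift hg θ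
  refine ⟨θ', fun z => ?_, hθ'⟩
  rw [← fibreMap_changeMap g, hθ', h]

theorem changeMap_expAut {g : B →ₐ[ℂ] A} {θ : Derivation A (A ⊗[ℂ] S) (A ⊗[ℂ] S)}
    {θ' : Derivation B (B ⊗[ℂ] S) (B ⊗[ℂ] S)} (h : IsNilpotent (θ : Module.End A (A ⊗[ℂ] S)))
    (h' : IsNilpotent (θ' : Module.End B (B ⊗[ℂ] S)))
    (H : ∀ z, changeMap S g (θ' z) = θ (changeMap S g z)) (z : B ⊗[ℂ] S) :
    changeMap S g (expAut θ' h' z) = expAut θ h (changeMap S g z) := by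
  obtain ⟨k, hk⟩ := id h
  obtain ⟨l, hl⟩ := id h'
  rw [expAut_apply θ h (k := l + k) (by rw [pow_add, hk, mul_zero]),
    expAut_apply θ' h' (k := l + k) (by rw [pow_add, hl, zero_mul]), map_sum]
  refine Finset.sum_congr rfl fun i hi => ?_
  rw [map_smul]
  congr 1
  clear hk hl hi
  induction i generalizing z with
  | zero => rfl
  | succ i ih =>
    rw [pow_succ, pow_succ, Module.End.mul_apply, Module.End.mul_apply, ih]
    congr 1
    exact H z

/-- Gauge transformations lift along a surjective change of base. -/
theorem exists_gauge_lift {g : B →ₐ[ℂ] A} (hg : Function.Surjective g)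
    {φ : (A ⊗[ℂ] S) ≃ₐ[A] (A ⊗[ℂ] S)} (hφ : φ ∈ gaugeGroup A S) :
    ∃ φ' ∈ gaugeGroup B S, ∀ z, changeMap S g (φ' z) = φ (changeMap S g z) := by
  induction hφ using Subgroup.closure_induction with
  | mem φ hφ =>
    obtain ⟨θ, h, rfl⟩ := hφ
    obtain ⟨θ', h1, h2⟩ := exists_der_lift_fibre hg θ h
    exact ⟨_, expAut_mem_gaugeGroup h1, changeMap_expAut _ _ h2⟩
  | one => exact ⟨1, one_mem _, fun z => rfl⟩
  | mul φ ψ _ _ h1 h2 =>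
    obtain ⟨φ', h1, h1'⟩ := h1
    obtain ⟨ψ', h2, h2'⟩ := h2
    exact ⟨φ' * ψ', mul_mem h1 h2, fun z => by
      rw [AlgEquiv.mul_apply, AlgEquiv.mul_apply, h1', h2']⟩
  | inv φ _ h1 =>
    obtain ⟨φ', h1, h1'⟩ := h1
    refine ⟨φ'⁻¹, inv_mem h1, fun z => ?_⟩
    apply φ.injective
    rw [← h1']
    change changeMap S g (φ' (φ'.symm z)) = φ (φ.symm _)
    rw [φ'.apply_symm_apply, φ.apply_symm_apply]

/-! ### Small extensions -/

/-- A surjection `B → A` of local Artin algebras whose kernel is the line spanned by a socle element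
`κ`. -/
structure IsSmallExt (g : B →ₐ[ℂ] A) (κ : B) : Prop where
  surjective : Function.Surjective g
  ne_zero : κ ≠ 0
  map_eq_zero : g κ = 0
  ker : ∀ b, g b = 0 → ∃ c : ℂ, b = c • κ
  socle : ∀ b ∈ maximalIdeal B, b * κ = 0

namespace IsSmallExt
variable {g : B →ₐ[ℂ] A} {κ : B}

theorem mul_eq (h : IsSmallExt g κ) (b : B) : b * κ = residueHom B b • κ := by
  have := h.socle (b - algebraMap ℂ B (residueHom B b)) (residueHom_eq_zero.mp (by simp))
  rwa [sub_mul, sub_eq_zero, ← Algebra.smul_def] at this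

theorem mem_maximalIdeal (h : IsSmallExt g κ) : κ ∈ maximalIdeal B := by
  rw [← residueHom_eq_zero, ← residueHom_comp g, h.map_eq_zero, map_zero]

theorem smul_tmul_eq (h : IsSmallExt g κ) (z : B ⊗[ℂ] S) : κ • z = κ ⊗ₜ fibreMap B S z := by
  induction z using TensorProduct.induction_on with
  | zero => simp
  | add x y hx hy => rw [smul_add, hx, hy, map_add, TensorProduct.tmul_add]
  | tmul b s =>
    rw [TensorProduct.smul_tmul', smul_eq_mul, mul_comm, h.mul_eq, fibreMap_tmul,
      TensorProduct.tmul_smul, TensorProduct.smul_tmul']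

theorem mul_tmul (h : IsSmallExt g κ) (z : B ⊗[ℂ] S) (s : S) : z * (κ ⊗ₜ s) = κ ⊗ₜ (fibreMap B S z * s) := by
  have h1 : (κ ⊗ₜ s : B ⊗[ℂ] S) = κ • (1 ⊗ₜ s) := by simp [TensorProduct.smul_tmul']
  rw [h1, mul_smul_comm, h.smul_tmul_eq]
  simp

theorem exists_eq_tmul (h : IsSmallExt g κ) {z : B ⊗[ℂ] S} (hz : changeMap S g z = 0) : ∃ s : S, z = κ ⊗ₜ s := by
  have h1 : Function.Exact (LinearMap.ker g.toLinearMap).subtype g.toLinearMap :=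
    LinearMap.exact_subtype_ker_map _
  have h2 := rTensor_exact S h1 h.surjective
  have h3 : (g.toLinearMap.rTensor S) z = 0 := by
    rw [← hz]
    rfl
  obtain ⟨y, rfl⟩ := (h2 z).mp h3
  clear hz h3
  induction y using TensorProduct.induction_on with
  | zero => exact ⟨0, by simp⟩
  | add x y hx hy =>
    obtain ⟨s, hs⟩ := hx
    obtain ⟨t, ht⟩ := hy
    exact ⟨s + t, by rw [map_add, hs, ht, TensorProduct.tmul_add]⟩
  | tmul b s =>
    obtain ⟨c, hc⟩ := h.ker b.1 b.2
    refine ⟨c • s, ?_⟩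
    rw [LinearMap.rTensor_tmul, Submodule.subtype_apply, hc, TensorProduct.tmul_smul,
      TensorProduct.smul_tmul']

theorem tmul_injective (h : IsSmallExt g κ) {s t : S} (hst : (κ ⊗ₜ s : B ⊗[ℂ] S) = κ ⊗ₜ t) : s = t := by
  obtain ⟨l, hl⟩ := Module.Projective.exists_dual_eq_one ℂ h.ne_zero
  have := congrArg (fun z => TensorProduct.lid ℂ S (l.rTensor S z)) hst
  simpa [hl] using this

theorem changeMap_tmul_eq_zero (h : IsSmallExt g κ) (s : S) : changeMap S g (κ ⊗ₜ s) = 0 := by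
  rw [changeMap_tmul, h.map_eq_zero, TensorProduct.zero_tmul]

/-- Vector fields with the same restriction to `Spec A` differ by `κ` times a vector field on the
central fibre. -/
theorem exists_der_eq (h : IsSmallExt g κ) {δ δ' : Derivation B (B ⊗[ℂ] S) (B ⊗[ℂ] S)}
    (H : ∀ z, changeMap S g (δ z) = changeMap S g (δ' z)) :
    ∃ d : Derivation ℂ S S, ∀ z, δ z = δ' z + κ ⊗ₜ d (fibreMap B S z) := by
  have h1 : ∀ s : S, ∃ t, δ (1 ⊗ₜ s) - δ' (1 ⊗ₜ s) = κ ⊗ₜ t := fun s =>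
    h.exists_eq_tmul (by rw [map_sub, H, sub_self])
  choose d hd using h1
  let D : Derivation ℂ S S := Derivation.mk'
    { toFun := d
      map_add' := fun s t => h.tmul_injective (by
        rw [TensorProduct.tmul_add, ← hd, ← hd, ← hd, TensorProduct.tmul_add, map_add, map_add]; abel)
      map_smul' := fun c s => h.tmul_injective (by
        rw [RingHom.id_apply, TensorProduct.tmul_smul, ← hd, ← hd, TensorProduct.tmul_smul,
          smul_sub, ← algebraMap_smul B c, Derivation.map_smul, Derivation.map_smul,
          algebraMap_smul, algebraMap_smul]) }
    fun s t => h.tmul_injective (by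
      change κ ⊗ₜ[ℂ] d (s * t) = κ ⊗ₜ (s * d t + t * d s)
      have h2 : (1 : B) ⊗ₜ[ℂ] (s * t) = (1 ⊗ₜ s) * (1 ⊗ₜ t) := by simp
      have h3 : ∀ s t : S, (κ ⊗ₜ (s * t) : B ⊗[ℂ] S) = (1 ⊗ₜ s) * (κ ⊗ₜ t) := by simp
      rw [← hd, h2, Derivation.leibniz, Derivation.leibniz, TensorProduct.tmul_add, h3, h3, ← hd,
        ← hd]
      simp only [smul_eq_mul]
      ring)
  refine ⟨D, fun z => ?_⟩
  induction z using TensorProduct.induction_on with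
  | zero => simp
  | add x y hx hy => simp only [map_add, hx, hy, TensorProduct.tmul_add]; abel
  | tmul b s =>
    have h2 : b ⊗ₜ[ℂ] s = b • ((1 : B) ⊗ₜ[ℂ] s) := by simp [TensorProduct.smul_tmul']
    have h3 : δ (1 ⊗ₜ s) = δ' (1 ⊗ₜ s) + κ ⊗ₜ d s := by rw [← hd]; abel
    rw [h2, Derivation.map_smul, Derivation.map_smul, h3, smul_add, fibreMap_smul,
      TensorProduct.smul_tmul', smul_eq_mul, h.mul_eq, D.map_smul, TensorProduct.tmul_smul,
      TensorProduct.smul_tmul', fibreMap_tmul, map_one, one_smul]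
    rfl

/-- Infinitesimal gauge transformations: `exp (κ d) = 1 + κ d`. -/
theorem exists_gauge_der (h : IsSmallExt g κ) (d : Derivation ℂ S S) :
    ∃ φ ∈ gaugeGroup B S, (∀ z, φ z = z + κ ⊗ₜ d (fibreMap B S z)) ∧
      ∀ z, changeMap S g (φ z) = changeMap S g z := by
  have h1 : ∀ z, (κ • extendDer B d) z = κ ⊗ₜ d (fibreMap B S z) := fun z => by
    induction z using TensorProduct.induction_on with
    | zero => simp
    | add x y hx hy => rw [map_add, hx, hy, map_add, map_add, TensorProduct.tmul_add]
    | tmul b s =>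
      rw [Derivation.smul_apply, extendDer_tmul, h.smul_tmul_eq, fibreMap_tmul, fibreMap_tmul,
        d.map_smul]
  have h2 : ∀ z, fibreMap B S ((κ • extendDer B d) z) = 0 := fun z => by
    rw [h1, fibreMap_tmul, residueHom_eq_zero.mpr h.mem_maximalIdeal, zero_smul]
  have h4 : ∀ z, expAut _ (isNilpotent_of_restrictDer_eq_zero h2) z =
      z + κ ⊗ₜ d (fibreMap B S z) := fun z => by
    have h3 := expAut_sub_mem (isNilpotent_of_restrictDer_eq_zero h2) (𝔠 := ⊥) (fun z => by
      rw [h1, h2, map_zero, TensorProduct.tmul_zero]; exact zero_mem _) z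
    rw [Submodule.bot_smul, Submodule.mem_bot, sub_eq_zero] at h3
    rw [h3, h1]
  refine ⟨_, expAut_mem_gaugeGroup h2, h4, fun z => ?_⟩
  rw [h4, map_add, h.changeMap_tmul_eq_zero, add_zero]

end IsSmallExt
end ExpFibre

/-! ### Coordinates adapted to a hypersurface germ -/

/-- The properties of the ring of germs of holomorphic functions used for the deformation theory of
the hypersurface `f = 0`: `x` are coordinates generating the maximal ideal, `∂` the dual vector
fields, germs may be substituted for the coordinates, and `S` and `S / (f)` are separated in the
adic topology. -/
structure IsGermFrame {S ι : Type} [CommRing S] [Algebra ℂ S] [IsLocalRing S] [Fintype ι]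
    [DecidableEq ι] (x : ι → S) (pd : ι → Derivation ℂ S S) (f : S) : Prop where
  hadamard : IsHadamard x
  der : ∀ i j, pd i (x j) = if i = j then 1 else 0
  subst : ∀ y : ι → S, (∀ i, y i ∈ maximalIdeal S) → ∃ Φ : S →ₐ[ℂ] S, ∀ i, Φ (x i) = y i
  span : maximalIdeal S = Ideal.span (Set.range x)
  ne_zero : f ≠ 0
  mem : f ∈ maximalIdeal S
  separated : ∀ z, (∀ k, z ∈ maximalIdeal S ^ k) → z = 0
  separated_quotient : ∀ z, (∀ k, z ∈ Ideal.span {f} ⊔ maximalIdeal S ^ k) → z ∈ Ideal.span {f}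

namespace IsGermFrame
variable {S ι : Type} [CommRing S] [Algebra ℂ S] [IsLocalRing S] [Fintype ι]
    [DecidableEq ι] {x : ι → S} {pd : ι → Derivation ℂ S S} {f : S}

theorem eq_zero_of_mem_pow (h : IsGermFrame x pd f) {z : S ⧸ Ideal.span {f}}
    (hz : ∀ k, z ∈ ((maximalIdeal S).map (Ideal.Quotient.mk (Ideal.span {f}))) ^ k) : z = 0 := by
  obtain ⟨t, rfl⟩ := Ideal.Quotient.mk_surjective z
  rw [Ideal.Quotient.eq_zero_iff_mem]
  refine h.separated_quotient t fun k => ?_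
  have := hz k
  rw [← Ideal.map_pow, Ideal.mem_map_iff_of_surjective _ Ideal.Quotient.mk_surjective] at this
  obtain ⟨t', h1, h2⟩ := this
  have h3 : t - t' ∈ Ideal.span {f} := Ideal.Quotient.eq.mp h2.symm
  rw [← sub_add_cancel t t']
  exact add_mem (Submodule.mem_sup_left h3) (Submodule.mem_sup_right h1)

/-- Uniqueness of twisted derivations with values in the ring of a hypersurface germ. -/
theorem eq_zero_of_mul_quotient (h : IsGermFrame x pd f) {y : ι → S ⧸ Ideal.span {f}}
    (hy : ∀ i, y i ∈ (maximalIdeal S).map (Ideal.Quotient.mk (Ideal.span {f})))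
    (D : S →+ S ⧸ Ideal.span {f}) (hc : ∀ c, D (algebraMap ℂ S c) = 0)
    (hmul : ∀ i t, D (x i * t) = y i * D t) : D = 0 := by
  ext s
  refine (Ideal.mem_bot).mp (h.hadamard.mem_of_mul (N := ⊥) (y := y) D (fun s t => ?_) (fun c => ?_)
    (fun i t => ?_) (fun z hz => ?_) s)
  · rw [map_add, sub_self]; exact zero_mem _
  · rw [hc]; exact zero_mem _
  · rw [hmul, sub_self]; exact zero_mem _
  · rw [Ideal.mem_bot]
    refine h.eq_zero_of_mem_pow fun k => ?_
    have h1 := hz k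
    rw [bot_sup_eq] at h1
    refine Ideal.pow_right_mono (Ideal.span_le.mpr ?_) k h1
    rintro _ ⟨i, rfl⟩
    exact hy i

/-- Uniqueness of twisted derivations with values in a flat family with special fibre a hypersurface
germ. -/
theorem eq_zero_of_mul_flat (h : IsGermFrame x pd f) {A Q : Type} [CommRing A] [Algebra ℂ A]
    [IsLocalRing A] [Module.Finite ℂ A] [CommRing Q] [Algebra A Q] [Module.Flat A Q]
    (e : Q →+* S ⧸ Ideal.span {f})
    (he : ∀ q, e q = 0 ↔ q ∈ (maximalIdeal A).map (algebraMap A Q)) {y : ι → Q}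
    (hy : ∀ i, e (y i) ∈ (maximalIdeal S).map (Ideal.Quotient.mk (Ideal.span {f})))
    (D : S →+ Q) (hc : ∀ c, D (algebraMap ℂ S c) = 0)
    (hmul : ∀ i t, D (x i * t) = y i * D t) : D = 0 := by
  refine h.hadamard.eq_zero_of_mul (A := A) (y := y) D hc hmul fun z hz => ?_
  rw [← he]
  refine h.eq_zero_of_mem_pow fun k => ?_
  obtain ⟨a, ha, b, hb, rfl⟩ := Submodule.mem_sup.mp (hz k)
  rw [map_add, (he a).mpr ha, zero_add]
  have h1 := Ideal.mem_map_of_mem e hb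
  rw [Ideal.map_pow] at h1
  refine Ideal.pow_right_mono ?_ k h1
  rw [Ideal.map_span, Ideal.span_le]
  rintro _ ⟨_, ⟨i, rfl⟩, rfl⟩
  exact hy i

theorem sum_pd_apply (h : IsGermFrame x pd f) (c : ι → S) (j : ι) :
    (∑ i, c i • pd i) (x j) = c j := by
  rw [der_sum_apply, Finset.sum_eq_single j]
  · rw [Derivation.smul_apply, h.der, if_pos rfl, smul_eq_mul, mul_one]
  · intro i _ hi
    rw [Derivation.smul_apply, h.der, if_neg hi, smul_zero]
  · simp

theorem der_eq_sum (h : IsGermFrame x pd f) (d : Derivation ℂ S S) : d = ∑ i, d (x i) • pd i := by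
  ext s
  rw [← sub_eq_zero]
  refine (Ideal.mem_bot).mp (h.hadamard.mem_of_mul (N := ⊥) (y := x)
    (fun s => d s - (∑ i, d (x i) • pd i) s) (fun s t => ?_) (fun c => ?_)
    (fun i t => ?_) (fun z hz => ?_) s)
  · simp only [map_add]
    rw [Ideal.mem_bot]; ring
  · simp
  · simp only [Derivation.leibniz, h.sum_pd_apply, smul_eq_mul]
    rw [Ideal.mem_bot]; ring
  · rw [Ideal.mem_bot]
    refine h.separated z fun k => ?_
    have h1 := hz k
    rwa [bot_sup_eq, ← h.span] at h1

end IsGermFrame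

/-! ### Deformations given by one equation -/

section MkDef
variable {S : Type} [CommRing S] [Algebra ℂ S] {f : S} {A : Art}

theorem map_fibreMap_span {F : A ⊗[ℂ] S} (hF : fibreMap A S F = f) :
    (Ideal.span {F}).map (fibreMap A S) = Ideal.span {f} := by
  rw [Ideal.map_span, Set.image_singleton, hF]

/-- The embedded deformation `F = 0` of the hypersurface `f = 0`, where `F` restricts to `f`. -/
def mkDef [IsDomain S] (hf : f ≠ 0) (F : A ⊗[ℂ] S) (hF : fibreMap A S F = f)
    (hadm : IsAdmissible (Ideal.span {F})) : Deformation (Ideal.span {f}) A where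
  ideal := Ideal.span {F}
  fg := ⟨{F}, by simp⟩
  flat := flat_quotient_span hf hF
  special := Ideal.quotientEquivAlgOfEq ℂ (map_fibreMap_span hF).symm
  admissible := hadm

theorem mkDef_embedding [IsDomain S] (hf : f ≠ 0) (F : A ⊗[ℂ] S) (hF : fibreMap A S F = f)
    (hadm : IsAdmissible (Ideal.span {F})) (z : A ⊗[ℂ] S) :
    (mkDef hf F hF hadm).embedding (Ideal.Quotient.mk _ z) = Ideal.Quotient.mk _ (fibreMap A S z) :=
  rfl

theorem Deformation.embedding_eq_zero_iff {D : Ideal S} (X : Deformation D A)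
    (q : (A ⊗[ℂ] S) ⧸ X.ideal) :
    X.embedding q = 0 ↔ q ∈ (maximalIdeal A).map (algebraMap A ((A ⊗[ℂ] S) ⧸ X.ideal)) := by
  obtain ⟨z, rfl⟩ := Ideal.Quotient.mk_surjective q
  have h0 : (maximalIdeal A).map (algebraMap A ((A ⊗[ℂ] S) ⧸ X.ideal)) =
      ((maximalIdeal A).map (algebraMap A (A ⊗[ℂ] S))).map (Ideal.Quotient.mk X.ideal) := by
    rw [Ideal.map_map]; rfl
  rw [h0, X.embedding_mk, EmbeddingLike.map_eq_zero_iff, Ideal.Quotient.eq_zero_iff_mem,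
    Ideal.mem_map_iff_of_surjective _ Ideal.Quotient.mk_surjective]
  constructor
  · intro hz
    obtain ⟨z', h1, h2⟩ := exists_of_mem_map hz
    refine ⟨z - z', fibreMap_eq_zero_iff'.mp (by rw [map_sub, h2, sub_self]), ?_⟩
    rw [map_sub, Ideal.Quotient.eq_zero_iff_mem.mpr h1, sub_zero]
  · rintro ⟨z', h1, h2⟩
    have h3 : z - z' ∈ X.ideal := Ideal.Quotient.eq.mp h2.symm
    have := Ideal.mem_map_of_mem (fibreMap A S) h3
    rwa [map_sub, fibreMap_eq_zero_iff'.mpr h1, sub_zero] at this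

end MkDef

section NormalForm
variable {S ι : Type} [CommRing S] [Algebra ℂ S] [IsLocalRing S] [IsDomain S] [Fintype ι]
  [DecidableEq ι] {x : ι → S} {pd : ι → Derivation ℂ S S} {f : S} {A B : Art}

theorem IsGermFrame.mem_maximalIdeal_of_special (h : IsGermFrame x pd f) {I : Ideal S}
    (e : (S ⧸ Ideal.span {f}) ≃ₐ[ℂ] S ⧸ I) {s t : S}
    (hst : e (Ideal.Quotient.mk _ s) = Ideal.Quotient.mk _ t) (hs : s ∈ maximalIdeal S) :
    t ∈ maximalIdeal S := by
  rw [mem_maximalIdeal, mem_nonunits_iff]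
  intro hu
  have h1 := (hu.map (Ideal.Quotient.mk I))
  rw [← hst] at h1
  have h2 : IsUnit (Ideal.Quotient.mk (Ideal.span {f}) s) := by
    have := h1.map e.symm
    rwa [AlgEquiv.symm_apply_apply] at this
  obtain ⟨v, hv⟩ := h2.exists_right_inv
  obtain ⟨v, rfl⟩ := Ideal.Quotient.mk_surjective v
  rw [← map_mul, ← map_one (Ideal.Quotient.mk _), Ideal.Quotient.eq] at hv
  have h3 : s * v - 1 ∈ maximalIdeal S :=
    (Ideal.span_singleton_le_iff_mem _).mpr h.mem hv
  have h4 := sub_mem (Ideal.mul_mem_right v _ hs) h3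
  rw [sub_sub_cancel] at h4
  exact (Ideal.ne_top_iff_one _).mp (Ideal.IsPrime.ne_top inferInstance) h4

theorem IsGermFrame.mem_maximalIdeal_of_special_symm (h : IsGermFrame x pd f) {I : Ideal S}
    (e : (S ⧸ Ideal.span {f}) ≃ₐ[ℂ] S ⧸ I) {s t : S}
    (hst : e (Ideal.Quotient.mk _ s) = Ideal.Quotient.mk _ t) (ht : t ∈ maximalIdeal S) :
    s ∈ maximalIdeal S := by
  rw [mem_maximalIdeal, mem_nonunits_iff]
  intro hu
  have h1 := (hu.map (Ideal.Quotient.mk (Ideal.span {f}))).map e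
  rw [hst] at h1
  have hI : I ≤ maximalIdeal S := by
    refine le_maximalIdeal fun hI => ?_
    have h2 : e 1 = e 0 := by
      rw [map_one, map_zero, ← map_one (Ideal.Quotient.mk I), Ideal.Quotient.eq_zero_iff_mem, hI]
      trivial
    have h3 := e.injective h2
    rw [← map_one (Ideal.Quotient.mk _), Ideal.Quotient.eq_zero_iff_mem] at h3
    exact (Ideal.ne_top_iff_one _).mp (Ideal.IsPrime.ne_top inferInstance)
      ((Ideal.span_singleton_le_iff_mem _).mpr h.mem h3)
  obtain ⟨v, hv⟩ := h1.exists_right_inv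
  obtain ⟨v, rfl⟩ := Ideal.Quotient.mk_surjective v
  rw [← map_mul, ← map_one (Ideal.Quotient.mk _), Ideal.Quotient.eq] at hv
  have h4 := sub_mem (Ideal.mul_mem_right v _ ht) (hI hv)
  rw [sub_sub_cancel] at h4
  exact (Ideal.ne_top_iff_one _).mp (Ideal.IsPrime.ne_top inferInstance) h4

/-- A coordinate change of the ambient space inducing a given isomorphism with the special fibre. -/
theorem IsGermFrame.exists_lift_special (h : IsGermFrame x pd f) {I : Ideal S}
    (e : (S ⧸ Ideal.span {f}) ≃ₐ[ℂ] S ⧸ I) :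
    ∃ Φ : S →ₐ[ℂ] S, ∀ s, e (Ideal.Quotient.mk _ s) = Ideal.Quotient.mk _ (Φ s) := by
  choose y hy using fun i => Ideal.Quotient.mk_surjective (e (Ideal.Quotient.mk _ (x i)))
  have hxm : ∀ i, x i ∈ maximalIdeal S := fun i => by
    rw [h.span]; exact Ideal.subset_span ⟨i, rfl⟩
  obtain ⟨Φ, hΦ⟩ := h.subst y fun i => h.mem_maximalIdeal_of_special e (hy i).symm (hxm i)
  refine ⟨Φ, fun s => ?_⟩
  let D : S →+ S ⧸ Ideal.span {f} := AddMonoidHom.mk' (fun s => e.symm (Ideal.Quotient.mk _ (Φ s)) -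
    Ideal.Quotient.mk _ s) fun s t => by simp only [map_add]; ring
  have hD : ∀ s, D s = e.symm (Ideal.Quotient.mk _ (Φ s)) - Ideal.Quotient.mk _ s := fun _ => rfl
  have hx : ∀ i, e.symm (Ideal.Quotient.mk _ (Φ (x i))) = Ideal.Quotient.mk _ (x i) := fun i => by
    rw [hΦ, hy, AlgEquiv.symm_apply_apply]
  have h0 : D = 0 := h.eq_zero_of_mul_quotient (y := fun i => Ideal.Quotient.mk _ (x i))
    (fun i => Ideal.mem_map_of_mem _ (hxm i)) D
    (fun c => by
      rw [hD, AlgHom.commutes]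
      exact sub_eq_zero.mpr (e.symm.commutes c))
    (fun i t => by simp only [hD, map_mul, hx]; ring)
  have h1 := DFunLike.congr_fun h0 s
  rw [hD, AddMonoidHom.zero_apply, sub_eq_zero] at h1
  rw [← h1, AlgEquiv.apply_symm_apply]

/-- A logarithmic vector field of the hypersurface germ extends to any deformation, in terms of a
coordinate change `Φ` lifting the identification of the special fibre. -/
theorem IsGermFrame.exists_logDer_lift (h : IsGermFrame x pd f)
    (X : Deformation (Ideal.span {f}) A) {Φ : S →ₐ[ℂ] S}
    (hΦ : ∀ s, X.special (Ideal.Quotient.mk _ s) = Ideal.Quotient.mk _ (Φ s))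
    {d : Derivation ℂ S S} (hd : d ∈ logDer ℂ S (Ideal.span {f})) :
    ∃ δ ∈ logDer A (A ⊗[ℂ] S) X.ideal, ∀ s,
      X.embedding (Ideal.Quotient.mk _ (δ (1 ⊗ₜ Φ s))) = Ideal.Quotient.mk _ (d s) := by
  have hxm : ∀ i, x i ∈ maximalIdeal S := fun i => by
    rw [h.span]; exact Ideal.subset_span ⟨i, rfl⟩
  have hcongr : ∀ {a b : S}, Ideal.Quotient.mk (Ideal.span {f}) a = Ideal.Quotient.mk _ b →
      Ideal.Quotient.mk (Ideal.span {f}) (d a) = Ideal.Quotient.mk _ (d b) := fun hab => by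
    rw [Ideal.Quotient.eq] at hab ⊢
    rw [← map_sub]
    exact hd _ hab
  set e := X.special with he
  choose Γ hΓ using fun s => Ideal.Quotient.mk_surjective (e.symm (Ideal.Quotient.mk _ s))
  choose c hc using fun i => Ideal.Quotient.mk_surjective (e (Ideal.Quotient.mk _ (d (Γ (x i)))))
  -- the transport of `d` to the special fibre of `X`
  let d₁ : Derivation ℂ S S := ∑ i, c i • pd i
  let D : S →+ S ⧸ Ideal.span {f} := AddMonoidHom.mk'
    (fun s => e.symm (Ideal.Quotient.mk _ (d₁ s)) - Ideal.Quotient.mk _ (d (Γ s))) fun s t => by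
      have h1 := hcongr (a := Γ (s + t)) (b := Γ s + Γ t) (by simp only [map_add, hΓ])
      rw [h1]
      simp only [map_add]; ring
  have hD : ∀ s, D s = e.symm (Ideal.Quotient.mk _ (d₁ s)) - Ideal.Quotient.mk _ (d (Γ s)) :=
    fun _ => rfl
  have hDx : ∀ i, D (x i) = 0 := fun i => by
    rw [hD, h.sum_pd_apply, hc, AlgEquiv.symm_apply_apply, sub_self]
  have h0 : D = 0 := by
    refine h.eq_zero_of_mul_quotient (y := fun i => e.symm (Ideal.Quotient.mk _ (x i)))
      (fun i => ?_) D (fun c => ?_) (fun i t => ?_)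
    · rw [← hΓ]
      refine Ideal.mem_map_of_mem _ (h.mem_maximalIdeal_of_special_symm e ?_ (hxm i))
      rw [hΓ, AlgEquiv.apply_symm_apply]
    · have h1 := hcongr (a := Γ (algebraMap ℂ S c)) (b := algebraMap ℂ S c)
        (by rw [hΓ]; exact e.symm.commutes c)
      rw [hD, h1]
      simp
    · have h1 := hcongr (a := Γ (x i * t)) (b := Γ (x i) * Γ t) (by simp only [map_mul, hΓ])
      have h2 := hDx i
      rw [hD, sub_eq_zero] at h2
      rw [hD, hD, h1]
      simp only [Derivation.leibniz, smul_eq_mul, map_add, map_mul, hΓ, h2]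
      ring
  have hd₁ : ∀ s, e.symm (Ideal.Quotient.mk _ (d₁ s)) = Ideal.Quotient.mk _ (d (Γ s)) := fun s => by
    rw [← sub_eq_zero, ← hD, h0]; rfl
  obtain ⟨δ, hδ, hδ'⟩ := X.admissible.1 d₁ fun g hg => by
    rw [← Ideal.Quotient.eq_zero_iff_mem] at hg ⊢
    have h1 := hcongr (a := Γ g) (b := 0) (by rw [hΓ, hg]; simp)
    rw [← EmbeddingLike.map_eq_zero_iff (f := e.symm), hd₁, h1]
    simp
  refine ⟨δ, hδ, fun s => ?_⟩
  rw [X.embedding_mk, ← restrictDer_apply, hδ', ← he, hd₁]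
  exact hcongr (by rw [hΓ, ← hΦ, AlgEquiv.symm_apply_apply])

/-- Every deformation of a hypersurface germ is isomorphic to one given by a lift of its equation. -/
theorem IsGermFrame.exists_iso_mkDef (h : IsGermFrame x pd f)
    (X : Deformation (Ideal.span {f}) A) :
    ∃ F hF hadm, X.Iso (mkDef h.ne_zero F hF hadm) := by
  have hxm : ∀ i, x i ∈ maximalIdeal S := fun i => by
    rw [h.span]; exact Ideal.subset_span ⟨i, rfl⟩
  obtain ⟨Φ, hΦ⟩ := h.exists_lift_special X.special
  have := X.flat
  let ΦA : A ⊗[ℂ] S →ₐ[A] A ⊗[ℂ] S := Algebra.TensorProduct.map (AlgHom.id A A) Φ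
  have hΦA : ∀ s, ΦA (1 ⊗ₜ s) = 1 ⊗ₜ Φ s := fun s => by simp [ΦA]
  let Ψ : A ⊗[ℂ] S →ₐ[A] (A ⊗[ℂ] S) ⧸ X.ideal := (Ideal.Quotient.mkₐ A X.ideal).comp ΦA
  have hΨ : ∀ z, Ψ z = Ideal.Quotient.mk X.ideal (ΦA z) := fun _ => rfl
  have hemb : ∀ z, X.embedding (Ψ z) = Ideal.Quotient.mk _ (fibreMap A S z) := fun z => by
    induction z using TensorProduct.induction_on with
    | zero => simp
    | add x y hx hy => simp only [map_add, hx, hy]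
    | tmul a s =>
      rw [hΨ, X.embedding_mk, AlgEquiv.symm_apply_eq]
      have h1 : fibreMap A S (ΦA (a ⊗ₜ s)) = Φ (fibreMap A S (a ⊗ₜ s)) := by
        simp [ΦA]
      rw [h1, hΦ]
  have hsurj : Function.Surjective Ψ := by
    have h1 : LinearMap.range Ψ.toLinearMap = ⊤ := by
      refine nilpotent_nakayama isNilpotent_maximalIdeal fun q _ => ?_
      obtain ⟨s, hs⟩ := Ideal.Quotient.mk_surjective (X.embedding q)
      have h2 : q - Ψ (1 ⊗ₜ s) ∈ maximalIdeal A • (⊤ : Submodule A ((A ⊗[ℂ] S) ⧸ X.ideal)) := by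
        rw [Ideal.smul_top_eq_map]
        exact (X.embedding_eq_zero_iff _).mp (by rw [map_sub, hemb]; simp [hs])
      have := add_mem (Submodule.mem_sup_left (LinearMap.mem_range_self Ψ.toLinearMap (1 ⊗ₜ s)))
        (Submodule.mem_sup_right h2)
      rwa [AlgHom.toLinearMap_apply, add_sub_cancel] at this
    exact LinearMap.range_eq_top.mp h1
  -- the equation
  obtain ⟨F, hF, hΨF⟩ : ∃ F, fibreMap A S F = f ∧ Ψ F = 0 := by
    have h1 : Ψ (1 ⊗ₜ f) ∈ maximalIdeal A • (⊤ : Submodule A ((A ⊗[ℂ] S) ⧸ X.ideal)) := by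
      rw [Ideal.smul_top_eq_map]
      refine (X.embedding_eq_zero_iff _).mp ?_
      rw [hemb, Ideal.Quotient.eq_zero_iff_mem]
      simp
    rw [← LinearMap.range_eq_top.mpr (show Function.Surjective Ψ.toLinearMap from hsurj),
      ← Submodule.map_top, ← Submodule.map_smul''] at h1
    obtain ⟨m, hm, hm'⟩ := h1
    refine ⟨1 ⊗ₜ f - m, ?_, ?_⟩
    · rw [map_sub, fibreMap_eq_zero hm]; simp
    · rw [map_sub, sub_eq_zero]; exact hm'.symm
  have hmod : ∀ z, X.embedding (Ψ z) = 0 → ∃ c, fibreMap A S (z - F * c) = 0 := fun z hz => by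
    rw [hemb, Ideal.Quotient.eq_zero_iff_mem, Ideal.mem_span_singleton] at hz
    obtain ⟨c, hc⟩ := hz
    exact ⟨1 ⊗ₜ c, by simp [hc, hF]⟩
  have hker : ∀ z ∈ Ideal.span {F}, Ψ z = 0 := fun z hz => by
    obtain ⟨c, rfl⟩ := Ideal.mem_span_singleton.mp hz
    rw [map_mul, hΨF, zero_mul]
  let Ψ' : ((A ⊗[ℂ] S) ⧸ Ideal.span {F}) →ₐ[A] (A ⊗[ℂ] S) ⧸ X.ideal :=
    Ideal.Quotient.liftₐ (Ideal.span {F}) Ψ hker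
  have hΨ' : ∀ z, Ψ' (Ideal.Quotient.mk _ z) = Ψ z := fun _ => rfl
  have hbij : Function.Bijective Ψ' := by
    refine ⟨?_, fun q => ?_⟩
    · refine injective_of_injective_mod isNilpotent_maximalIdeal Ψ'.toLinearMap fun μ hμ => ?_
      obtain ⟨z, rfl⟩ := Ideal.Quotient.mk_surjective μ
      rw [Ideal.smul_top_eq_map] at hμ
      obtain ⟨c, hc⟩ := hmod z ((X.embedding_eq_zero_iff _).mpr hμ)
      have h1 : Ideal.Quotient.mk (Ideal.span {F}) z = Ideal.Quotient.mk _ (z - F * c) := by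
        rw [Ideal.Quotient.eq, sub_sub_cancel, Ideal.mem_span_singleton]
        exact ⟨c, rfl⟩
      rw [h1, Ideal.smul_top_eq_map]
      have h2 := Ideal.mem_map_of_mem (Ideal.Quotient.mk (Ideal.span {F}))
        (fibreMap_eq_zero_iff'.mp hc)
      rw [Ideal.map_map] at h2
      exact h2
    · obtain ⟨z, rfl⟩ := hsurj q
      exact ⟨Ideal.Quotient.mk _ z, rfl⟩
  have hker' : ∀ z, Ψ z = 0 → z ∈ Ideal.span {F} := fun z hz => by
    rw [← Ideal.Quotient.eq_zero_iff_mem]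
    exact hbij.1 (by rw [hΨ', hz, map_zero])
  have hadm : IsAdmissible (Ideal.span {F}) := by
    have := flat_quotient_span h.ne_zero hF
    refine isAdmissible_of_surjective ⟨{F}, by simp⟩ fun d hd => ?_
    rw [map_fibreMap_span hF] at hd
    obtain ⟨δ, hδ, hδd⟩ := h.exists_logDer_lift X hΦ hd
    -- the components of the lift of `d`, with prescribed restriction to the central fibre
    have hc : ∀ i, ∃ c, Ψ c = Ideal.Quotient.mk _ (δ (1 ⊗ₜ Φ (x i))) ∧ fibreMap A S c = d (x i) := by
      intro i
      obtain ⟨c, hc⟩ := hsurj (Ideal.Quotient.mk _ (δ (1 ⊗ₜ Φ (x i))))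
      have h1 := hemb c
      rw [hc, hδd, eq_comm, Ideal.Quotient.eq, Ideal.mem_span_singleton] at h1
      obtain ⟨r, hr⟩ := h1
      refine ⟨c - F * 1 ⊗ₜ r, by rw [map_sub, map_mul, hΨF, zero_mul, sub_zero, hc], ?_⟩
      rw [map_sub, map_mul, hF, sub_eq_iff_eq_add, ← sub_eq_iff_eq_add', hr]
      simp
    choose c hc hcd using hc
    let δ' : Derivation A (A ⊗[ℂ] S) (A ⊗[ℂ] S) := ∑ i, c i • extendDer A (pd i)
    have hδ' : ∀ s, δ' (1 ⊗ₜ s) = ∑ i, c i * 1 ⊗ₜ pd i s := fun s => by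
      simp only [δ', der_sum_apply, Derivation.smul_apply, extendDer_tmul, smul_eq_mul]
    have hδx : ∀ i, δ' (1 ⊗ₜ x i) = c i := fun j => by
      rw [hδ', Finset.sum_eq_single j]
      · rw [h.der, if_pos rfl, ← Algebra.TensorProduct.one_def, mul_one]
      · intro i _ hi
        rw [h.der, if_neg hi, TensorProduct.tmul_zero, mul_zero]
      · simp
    have hmul1 : ∀ s t : S, (1 : A) ⊗ₜ[ℂ] (s * t) = (1 ⊗ₜ s) * (1 ⊗ₜ t) := by simp
    let E : S →+ (A ⊗[ℂ] S) ⧸ X.ideal := AddMonoidHom.mk'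
      (fun s => Ψ (δ' (1 ⊗ₜ s)) - Ideal.Quotient.mk _ (δ (1 ⊗ₜ Φ s))) fun s t => by
        simp only [map_add, TensorProduct.tmul_add]; ring
    have hE : ∀ s, E s = Ψ (δ' (1 ⊗ₜ s)) - Ideal.Quotient.mk _ (δ (1 ⊗ₜ Φ s)) := fun _ => rfl
    have hconst : ∀ (r : ℂ) (η : Derivation A (A ⊗[ℂ] S) (A ⊗[ℂ] S)),
        η (1 ⊗ₜ algebraMap ℂ S r) = 0 := fun r η => by
      rw [Algebra.algebraMap_eq_smul_one, TensorProduct.tmul_smul, ← algebraMap_smul A r,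
        Derivation.map_smul, ← Algebra.TensorProduct.one_def, Derivation.map_one_eq_zero, smul_zero]
    have hE0 : E = 0 := by
      refine h.eq_zero_of_mul_flat (A := A) (X.embedding : _ →+* _) X.embedding_eq_zero_iff
        (y := fun i => Ψ (1 ⊗ₜ x i)) (fun i => ?_) E (fun r => ?_) (fun i t => ?_)
      · change X.embedding (Ψ _) ∈ _
        rw [hemb]
        refine Ideal.mem_map_of_mem _ ?_
        simpa using hxm i
      · rw [hE, hconst, AlgHom.commutes, hconst, map_zero, map_zero, sub_zero]
      · rw [hE, hE, hmul1, map_mul Φ, hmul1, Derivation.leibniz, Derivation.leibniz, hδx]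
        simp only [smul_eq_mul, map_add, map_mul, hc]
        rw [hΨ (1 ⊗ₜ x i), hΨ (1 ⊗ₜ t), hΦA, hΦA]
        ring
    have hδΨ : ∀ z, Ψ (δ' z) = Ideal.Quotient.mk _ (δ (ΦA z)) := fun z => by
      induction z using TensorProduct.induction_on with
      | zero => simp
      | add x y hx hy => simp only [map_add, hx, hy]
      | tmul a s =>
        have h2 : a ⊗ₜ[ℂ] s = a • ((1 : A) ⊗ₜ[ℂ] s) := by simp [TensorProduct.smul_tmul']
        have h3 := DFunLike.congr_fun hE0 s
        rw [hE, AddMonoidHom.zero_apply, sub_eq_zero] at h3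
        rw [h2, Derivation.map_smul, map_smul, map_smul, Derivation.map_smul, h3, hΦA]
        rfl
    refine ⟨δ', fun z hz => hker' _ ?_, ?_⟩
    · rw [hδΨ, Ideal.Quotient.eq_zero_iff_mem]
      exact hδ _ (Ideal.Quotient.eq_zero_iff_mem.mp (hker z hz))
    · rw [h.der_eq_sum (restrictDer δ'), h.der_eq_sum d]
      refine Finset.sum_congr rfl fun i _ => ?_
      rw [restrictDer_apply, hδx, hcd]
  refine ⟨F, hF, hadm, AlgEquiv.ofBijective Ψ' hbij, fun z => ?_⟩
  obtain ⟨z, rfl⟩ := Ideal.Quotient.mk_surjective z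
  exact hemb z

end NormalForm

/-! ### Isomorphisms of deformations and gauge transformations -/

section Gauge
variable {S ι : Type} [CommRing S] [Algebra ℂ S] [IsDomain S] [Fintype ι]
  [DecidableEq ι] {x : ι → S} {pd : ι → Derivation ℂ S S} {f : S} {A B : Art}

/-- Conjugation of a derivation by an automorphism. -/
def conjDer {R T : Type} [CommRing R] [CommRing T] [Algebra R T] (φ : T ≃ₐ[R] T)
    (δ : Derivation R T T) : Derivation R T T :=
  Derivation.mk' (φ.symm.toLinearMap ∘ₗ (δ : T →ₗ[R] T) ∘ₗ φ.toLinearMap) fun a b => by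
    change φ.symm (δ (φ (a * b))) = a * φ.symm (δ (φ b)) + b * φ.symm (δ (φ a))
    rw [map_mul, Derivation.leibniz, map_add, smul_eq_mul, smul_eq_mul, map_mul, map_mul,
      φ.symm_apply_apply, φ.symm_apply_apply]

theorem conjDer_apply {R T : Type} [CommRing R] [CommRing T] [Algebra R T] (φ : T ≃ₐ[R] T)
    (δ : Derivation R T T) (z : T) : conjDer φ δ z = φ.symm (δ (φ z)) := rfl

variable {F G u : A ⊗[ℂ] S} {φ : (A ⊗[ℂ] S) ≃ₐ[A] (A ⊗[ℂ] S)}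

theorem span_eq_map_of_gauge (hu : IsUnit u) (huF : φ G = u * F) :
    Ideal.span {F} = (Ideal.span {G}).map (φ : (A ⊗[ℂ] S) →+* (A ⊗[ℂ] S)) := by
  rw [Ideal.map_span, Set.image_singleton]
  change _ = Ideal.span {φ G}
  rw [huF, mul_comm, Ideal.span_singleton_mul_right_unit hu]

theorem fibreMap_gauge_symm (hφ : φ ∈ gaugeGroup A S) (z : A ⊗[ℂ] S) :
    fibreMap A S (φ.symm z) = fibreMap A S z := by
  rw [← fibreMap_gauge hφ, φ.apply_symm_apply]

/-- Admissibility is preserved under units and gauge transformations: the automorphism conjugates the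
logarithmic vector fields into each other and acts trivially on the central fibre. -/
theorem isAdmissible_of_gauge (hf : f ≠ 0) (hG : fibreMap A S G = f) (hF : fibreMap A S F = f)
    (hφ : φ ∈ gaugeGroup A S) (hu : IsUnit u) (huF : φ G = u * F)
    (hadm : IsAdmissible (Ideal.span {F})) : IsAdmissible (Ideal.span {G}) := by
  have := flat_quotient_span hf hG
  have hmem : ∀ z, z ∈ Ideal.span {G} ↔ φ z ∈ Ideal.span {F} := fun z => by
    rw [span_eq_map_of_gauge hu huF, Ideal.mem_map_iff_of_surjective (φ : (A ⊗[ℂ] S) →+* (A ⊗[ℂ] S))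
      φ.surjective]
    exact ⟨fun h => ⟨z, h, rfl⟩, fun ⟨y, h, hy⟩ => φ.injective hy ▸ h⟩
  refine isAdmissible_of_surjective ⟨{G}, by simp⟩ fun d hd => ?_
  rw [map_fibreMap_span hG, ← map_fibreMap_span hF] at hd
  obtain ⟨δ, hδ, rfl⟩ := hadm.1 d hd
  refine ⟨conjDer φ δ, fun z hz => ?_, ?_⟩
  · rw [hmem, conjDer_apply, φ.apply_symm_apply]
    exact hδ _ ((hmem z).mp hz)
  · ext s
    rw [restrictDer_apply, conjDer_apply, fibreMap_gauge_symm hφ, ← restrictDer_fibreMap,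
      fibreMap_gauge hφ, restrictDer_fibreMap, restrictDer_apply]

theorem mkDef_iso_of_gauge (hf : f ≠ 0) (hG : fibreMap A S G = f) (hF : fibreMap A S F = f)
    (hφ : φ ∈ gaugeGroup A S) (hu : IsUnit u) (huF : φ G = u * F)
    (hadm : IsAdmissible (Ideal.span {F})) (hadm' : IsAdmissible (Ideal.span {G})) :
    (mkDef hf F hF hadm).Iso (mkDef hf G hG hadm') := by
  refine ⟨Ideal.quotientEquivAlg (Ideal.span {G}) (Ideal.span {F}) φ
    (span_eq_map_of_gauge hu huF), fun z => ?_⟩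
  obtain ⟨z, rfl⟩ := Ideal.Quotient.mk_surjective z
  change (mkDef hf F hF hadm).embedding (Ideal.Quotient.mk _ (φ z)) = _
  rw [mkDef_embedding, mkDef_embedding, fibreMap_gauge hφ]

/-- An isomorphism of deformations over `Spec A` is induced by a gauge transformation. -/
theorem IsGermFrame.exists_gauge_of_iso [IsLocalRing S] (h : IsGermFrame x pd f)
    (hF : fibreMap A S F = f) (hG : fibreMap A S G = f)
    (hadm : IsAdmissible (Ideal.span {F})) (hadm' : IsAdmissible (Ideal.span {G}))
    (hiso : (mkDef h.ne_zero F hF hadm).Iso (mkDef h.ne_zero G hG hadm')) :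
    ∃ φ ∈ gaugeGroup A S, ∃ u, IsUnit u ∧ φ G = u * F := by
  obtain ⟨τ, hτ⟩ := hiso
  let X := mkDef h.ne_zero F hF hadm
  let Q := (A ⊗[ℂ] S) ⧸ Ideal.span {F}
  have : Module.Flat A Q := flat_quotient_span h.ne_zero hF
  let σ : A ⊗[ℂ] S →ₐ[A] Q := AlgHom.comp τ.toAlgHom
    (Ideal.Quotient.mkₐ A (Ideal.span {G}))
  let π : A ⊗[ℂ] S →ₐ[A] Q := Ideal.Quotient.mkₐ A (Ideal.span {F})
  let e : Q →ₐ[ℂ] S ⧸ Ideal.span {f} := X.embedding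
  have he : ∀ q, e q = 0 ↔ q ∈ (maximalIdeal A).map (algebraMap A Q) := X.embedding_eq_zero_iff
  have heσ : ∀ z, e (σ z) = Ideal.Quotient.mk _ (fibreMap A S z) := fun z => hτ _
  have heπ : ∀ z, e (π z) = Ideal.Quotient.mk _ (fibreMap A S z) := fun z => rfl
  have hmk : ∀ 𝔠 : Ideal A, ∀ z ∈ 𝔠 • (⊤ : Submodule A (A ⊗[ℂ] S)),
      π z ∈ 𝔠.map (algebraMap A Q) := fun 𝔠 z hz => by
    have h1 := Submodule.mem_map_of_mem (f := π.toLinearMap) hz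
    rw [Submodule.map_smul''] at h1
    have h2 := Submodule.smul_mono (le_refl 𝔠) (le_top) h1
    rwa [Ideal.smul_top_eq_map] at h2
  have key : ∃ φ ∈ gaugeGroup A S, ∀ s : S,
      σ (1 ⊗ₜ s) - π (φ (1 ⊗ₜ s)) ∈ (⊥ : Ideal A).map (algebraMap A Q) := by
    refine ideal_devissage (P := fun 𝔟 : Ideal A => ∃ φ ∈ gaugeGroup A S, ∀ s : S,
      σ (1 ⊗ₜ s) - π (φ (1 ⊗ₜ s)) ∈ 𝔟.map (algebraMap A Q)) (𝔟₀ := maximalIdeal A)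
      ⟨1, one_mem _, fun s => ?_⟩ ?_
    · rw [← he, map_sub, heσ, heπ, AlgEquiv.one_apply, sub_self]
    intro 𝔟 hb ⟨φ, hφ, hs⟩ 𝔠 _ κ hκ hκ' hm hone
    choose q hq using fun s => exists_sub_smul_mem hone (hs s)
    have hmem : ∀ z, κ • z ∈ 𝔠.map (algebraMap A Q) → e z = 0 :=
      fun z hz => (he z).mpr (mem_map_maximalIdeal_of_smul_mem hκ' hz)
    have hmem' : ∀ z, e z = 0 → κ • z ∈ 𝔠.map (algebraMap A Q) := fun z hz =>
      smul_mem_map_of_mem (fun a ha => hm a ha κ hκ) ((he z).mp hz)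
    -- the discrepancy `q` induces a derivation from germs to germs on the hypersurface
    have hadd : ∀ s t, e (q (s + t)) = e (q s) + e (q t) := fun s t => by
      rw [← sub_eq_zero, ← map_add, ← map_sub]
      apply hmem
      have h1 := sub_mem (add_mem (hq s) (hq t)) (hq (s + t))
      rw [TensorProduct.tmul_add, map_add, map_add, map_add] at h1
      convert h1 using 1
      rw [smul_sub, smul_add]; ring
    have hmul : ∀ s t, e (q (s * t)) = Ideal.Quotient.mk _ s * e (q t) +
        Ideal.Quotient.mk _ t * e (q s) := fun s t => by
      have h0 : e (q (s * t) - (σ (1 ⊗ₜ s) * q t + π (φ (1 ⊗ₜ t)) * q s)) = 0 := by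
        apply hmem
        have h1 := sub_mem (add_mem (Ideal.mul_mem_left _ (σ (1 ⊗ₜ s)) (hq t))
          (Ideal.mul_mem_left _ (π (φ (1 ⊗ₜ t))) (hq s))) (hq (s * t))
        have h2 : (1 : A) ⊗ₜ[ℂ] (s * t) = (1 ⊗ₜ s) * (1 ⊗ₜ t) := by simp
        rw [h2, map_mul σ, map_mul φ, map_mul π] at h1
        convert h1 using 1
        simp only [smul_sub, smul_add, mul_sub, mul_smul_comm]; ring
      rw [map_sub, sub_eq_zero, map_add, map_mul, map_mul, heσ, heπ, fibreMap_gauge hφ] at h0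
      simpa using h0
    have hconst : ∀ c : ℂ, e (q (algebraMap ℂ S c)) = 0 := fun c => by
      apply hmem
      have h1 : (1 : A) ⊗ₜ[ℂ] algebraMap ℂ S c = algebraMap A _ (algebraMap ℂ A c) := by
        rw [Algebra.algebraMap_eq_smul_one (A := S), TensorProduct.tmul_smul,
          ← algebraMap_smul A c, Algebra.algebraMap_eq_smul_one (R := A),
          Algebra.TensorProduct.one_def]
      have h2 := hq (algebraMap ℂ S c)
      rw [h1, AlgHom.commutes, AlgEquiv.commutes, AlgHom.commutes, sub_self, zero_sub] at h2
      exact neg_mem_iff.mp h2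
    choose a ha using fun i => Ideal.Quotient.mk_surjective (e (q (x i)))
    let d : Derivation ℂ S S := ∑ i, a i • pd i
    have hd : ∀ s, e (q s) = Ideal.Quotient.mk _ (d s) := fun s => by
      let D : S →+ S ⧸ Ideal.span {f} := AddMonoidHom.mk'
        (fun s => e (q s) - Ideal.Quotient.mk _ (d s)) fun s t => by
          rw [hadd, map_add, map_add]; ring
      have hD : ∀ s, D s = e (q s) - Ideal.Quotient.mk _ (d s) := fun _ => rfl
      have h0 : D = 0 := by
        refine h.eq_zero_of_mul_quotient (y := fun i => Ideal.Quotient.mk _ (x i)) (fun i => ?_) D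
          (fun c => ?_) (fun i t => ?_)
        · refine Ideal.mem_map_of_mem _ ?_
          rw [h.span]; exact Ideal.subset_span ⟨i, rfl⟩
        · rw [hD, hconst]; simp
        · rw [hD, hD, hmul, Derivation.leibniz, h.sum_pd_apply, ← ha]
          simp only [smul_eq_mul, map_add, map_mul]; ring
      have h1 := DFunLike.congr_fun h0 s
      rwa [hD, AddMonoidHom.zero_apply, sub_eq_zero] at h1
    let θ : Derivation A (A ⊗[ℂ] S) (A ⊗[ℂ] S) := κ • extendDer A d
    have hθ : ∀ z, θ z = κ • extendDer A d z := fun _ => rfl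
    have hκm : κ ∈ maximalIdeal A := hb hκ
    have hθ0 : ∀ z, fibreMap A S (θ z) = 0 := fun z => by
      rw [hθ, fibreMap_smul, residueHom_eq_zero.mpr hκm, zero_smul]
    refine ⟨expAut θ (isNilpotent_of_restrictDer_eq_zero hθ0) * φ,
      mul_mem (expAut_mem_gaugeGroup hθ0) hφ, fun s => ?_⟩
    rw [AlgEquiv.mul_apply]
    have h1 := hmk 𝔠 _ (expAut_sub_mem (isNilpotent_of_restrictDer_eq_zero hθ0) (𝔠 := 𝔠)
      (fun z => by
        rw [hθ, hθ, Derivation.map_smul, smul_smul]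
        exact Submodule.smul_mem_smul (hm κ hκm κ hκ) trivial) (φ (1 ⊗ₜ s)))
    rw [map_sub, map_add, hθ, map_smul] at h1
    have h2 : κ • (q s - π (extendDer A d (φ (1 ⊗ₜ s)))) ∈ 𝔠.map (algebraMap A Q) := by
      apply hmem'
      have h3 : restrictDer (extendDer A d) = d := by
        ext s; rw [restrictDer_apply, extendDer_tmul]; simp
      rw [map_sub, heπ, ← restrictDer_fibreMap, fibreMap_gauge hφ, hd, h3]
      simp
    have h4 := add_mem (sub_mem (hq s) h1) h2
    convert h4 using 1
    rw [smul_sub]; ring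
  obtain ⟨φ, hφ, hs⟩ := key
  have hall : ∀ z, σ z = π (φ z) := fun z => by
    induction z using TensorProduct.induction_on with
    | zero => simp
    | add x y hx hy => simp only [map_add, hx, hy]
    | tmul a s =>
      have h2 : a ⊗ₜ[ℂ] s = a • ((1 : A) ⊗ₜ[ℂ] s) := by simp [TensorProduct.smul_tmul']
      have h3 := hs s
      rw [Ideal.map_bot, Ideal.mem_bot, sub_eq_zero] at h3
      rw [h2, map_smul, map_smul, map_smul, h3]
  have hGF : φ G ∈ Ideal.span {F} := by
    rw [← Ideal.Quotient.eq_zero_iff_mem]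
    change π (φ G) = 0
    rw [← hall]
    exact (congrArg τ (Ideal.Quotient.eq_zero_iff_mem.mpr
      (Ideal.mem_span_singleton_self G))).trans (map_zero τ)
  obtain ⟨u, hu⟩ := Ideal.mem_span_singleton'.mp hGF
  refine ⟨φ, hφ, u, isUnit_of_fibreMap ?_, hu.symm⟩
  have h1 := congrArg (fibreMap A S) hu
  rw [map_mul, hF, fibreMap_gauge hφ, hG] at h1
  rw [mul_right_cancel₀ h.ne_zero (h1.trans (one_mul f).symm)]
  exact isUnit_one

end Gauge

/-! ### Change of base and lifting of admissible deformations -/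

/-- Nakayama's lemma for a nilpotent ideal, without finiteness assumptions. -/
theorem le_of_le_sup_nilpotent_smul {A M : Type} [CommRing A] [AddCommGroup M] [Module A M]
    {m : Ideal A} (hm : IsNilpotent m) {L N : Submodule A M} (h : L ≤ N ⊔ m • L) : L ≤ N := by
  have key : ∀ k : ℕ, L ≤ N ⊔ m ^ k • L := by
    intro k
    induction k with
    | zero => simp
    | succ k ih =>
      calc L ≤ N ⊔ m • L := h
        _ ≤ N ⊔ m • (N ⊔ m ^ k • L) := sup_le_sup_left (Submodule.smul_mono le_rfl ih) _
        _ ≤ N ⊔ m ^ (k + 1) • L := by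
          rw [Submodule.smul_sup, pow_succ', ← smul_eq_mul, Submodule.smul_assoc]
          exact sup_le le_sup_left (sup_le_sup_right Submodule.smul_le_right _)
  obtain ⟨k, hk⟩ := hm
  have := key k
  rw [hk] at this
  simpa using this

theorem mem_logDer_span {R T : Type} [CommRing R] [CommRing T] [Algebra R T] {F : T}
    {δ : Derivation R T T} : δ ∈ logDer R T (Ideal.span {F}) ↔ δ F ∈ Ideal.span {F} := by
  refine ⟨fun h => h F (Ideal.mem_span_singleton_self F), fun h g hg => ?_⟩
  obtain ⟨c, rfl⟩ := Ideal.mem_span_singleton'.mp hg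
  rw [Derivation.leibniz]
  exact add_mem (Ideal.mul_mem_left _ _ h) (Ideal.mul_mem_right _ _
    (Ideal.mem_span_singleton_self F))

section Change
variable {S : Type} [CommRing S] [Algebra ℂ S] [IsDomain S] {f : S} {A B : Art}

theorem isAdmissible_changeMap (hf : f ≠ 0) {F : B ⊗[ℂ] S} (hF : fibreMap B S F = f)
    (hadm : IsAdmissible (Ideal.span {F})) (g : B →ₐ[ℂ] A) :
    IsAdmissible (Ideal.span {changeMap S g F}) := by
  have h1 : (Ideal.span {F}).map (changeMap S g) = Ideal.span {changeMap S g F} := by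
    rw [Ideal.map_span, Set.image_singleton]
  have := flat_quotient_span (A := A) hf (F := changeMap S g F) (by rw [fibreMap_changeMap, hF])
  rw [← h1] at this ⊢
  exact hadm.change g ⟨{F}, by simp⟩

theorem baseChange_mkDef (hf : f ≠ 0) {F : B ⊗[ℂ] S} (hF : fibreMap B S F = f)
    (hadm : IsAdmissible (Ideal.span {F})) (g : B →ₐ[ℂ] A) :
    ((mkDef hf F hF hadm).baseChange g).Iso (mkDef hf (changeMap S g F)
      (by rw [fibreMap_changeMap, hF]) (isAdmissible_changeMap hf hF hadm g)) := by
  refine Deformation.iso_of_eq ?_ fun z => ?_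
  · change (Ideal.span {F}).map (changeMap S g) = Ideal.span {changeMap S g F}
    rw [Ideal.map_span, Set.image_singleton]
  · rw [mkDef_embedding, Deformation.embedding_baseChange]
    rfl

/-- Logarithmic vector fields of an admissible deformation extend along surjective changes of
base. -/
theorem exists_logDer_lift_change {g : B →ₐ[ℂ] A} (hg : Function.Surjective g) {F : B ⊗[ℂ] S}
    (hF : fibreMap B S F = f) (hadm : IsAdmissible (Ideal.span {F}))
    (hadm' : IsAdmissible (Ideal.span {changeMap S g F}))
    {δ : Derivation A (A ⊗[ℂ] S) (A ⊗[ℂ] S)}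
    (hδ : δ ∈ logDer A (A ⊗[ℂ] S) (Ideal.span {changeMap S g F})) :
    ∃ δ' ∈ logDer B (B ⊗[ℂ] S) (Ideal.span {F}), ∀ z, changeMap S g (δ' z) = δ (changeMap S g z) := by
  let N : Submodule A (Derivation A (A ⊗[ℂ] S) (A ⊗[ℂ] S)) :=
    { carrier := {δ | ∃ δ' ∈ logDer B (B ⊗[ℂ] S) (Ideal.span {F}),
        ∀ z, changeMap S g (δ' z) = δ (changeMap S g z)}
      add_mem' := by
        rintro δ η ⟨δ', h1, h2⟩ ⟨η', h3, h4⟩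
        exact ⟨δ' + η', add_mem h1 h3, fun z => by
          rw [Derivation.add_apply, map_add, h2, h4, Derivation.add_apply]⟩
      zero_mem' := ⟨0, zero_mem _, fun z => by simp⟩
      smul_mem' := by
        rintro a δ ⟨δ', h1, h2⟩
        obtain ⟨b, rfl⟩ := hg a
        refine ⟨b • δ', ?_, fun z => ?_⟩
        · rw [← algebraMap_smul (B ⊗[ℂ] S) b δ']
          exact Submodule.smul_mem _ _ h1
        · rw [Derivation.smul_apply, changeMap_smul, h2, Derivation.smul_apply] }
  have hle : (logDer A (A ⊗[ℂ] S) (Ideal.span {changeMap S g F})).restrictScalars A ≤ N := by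
    refine le_of_le_sup_nilpotent_smul isNilpotent_maximalIdeal fun η hη => ?_
    have h1 := restrictDer_mem (I := Ideal.span {changeMap S g F}) hη
    rw [map_fibreMap_span (A := A) (f := f) (by rw [fibreMap_changeMap, hF]),
      ← map_fibreMap_span hF] at h1
    obtain ⟨δ', h2, h3⟩ := hadm.1 _ h1
    obtain ⟨δ₁, h4⟩ := restrictDer_change g δ'
    have h5 : δ₁ ∈ logDer A (A ⊗[ℂ] S) (Ideal.span {changeMap S g F}) := by
      rw [mem_logDer_span, h4]
      obtain ⟨c, hc⟩ := Ideal.mem_span_singleton'.mp (mem_logDer_span.mp h2)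
      rw [← hc, map_mul]
      exact Ideal.mul_mem_left _ _ (Ideal.mem_span_singleton_self _)
    have h6 : restrictDer (η - δ₁) = 0 := by
      ext s
      have h7 := DFunLike.congr_fun h3 s
      rw [restrictDer_apply, restrictDer_apply] at h7
      have h8 := h4 (1 ⊗ₜ s)
      rw [changeMap_tmul, map_one] at h8
      rw [restrictDer_apply, Derivation.sub_apply, map_sub, h8, fibreMap_changeMap, h7, sub_self]
      rfl
    have h9 := hadm'.2 (η - δ₁) (sub_mem hη h5) h6
    rw [← add_sub_cancel δ₁ η]
    exact add_mem (Submodule.mem_sup_left ⟨δ', h2, fun z => (h4 z).symm⟩)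
      (Submodule.mem_sup_right h9)
  exact hle hδ

end Change

section FDMk
variable {S : Type} [CommRing S] [Algebra ℂ S] [IsDomain S] {f : S} {A B : Art}

/-- The class of the deformation `F = 0`. -/
def fdMk (hf : f ≠ 0) (F : A ⊗[ℂ] S) (hF : fibreMap A S F = f)
    (hadm : IsAdmissible (Ideal.span {F})) : (FD (Ideal.span {f})).obj A :=
  Quotient.mk (Deformation.setoid _ A) (mkDef hf F hF hadm)

theorem fdMk_congr (hf : f ≠ 0) {F G : A ⊗[ℂ] S} (hF : fibreMap A S F = f)
    (hadm : IsAdmissible (Ideal.span {F})) (hG : fibreMap A S G = f)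
    (hadm' : IsAdmissible (Ideal.span {G})) (h : F = G) :
    fdMk hf F hF hadm = fdMk hf G hG hadm' := by
  subst h
  rfl

theorem map_fdMk (hf : f ≠ 0) {F : B ⊗[ℂ] S} (hF : fibreMap B S F = f)
    (hadm : IsAdmissible (Ideal.span {F})) (g : B ⟶ A) :
    (FD (Ideal.span {f})).map g (fdMk hf F hF hadm) =
      fdMk hf (changeMap S (show B →ₐ[ℂ] A from g) F) (by rw [fibreMap_changeMap, hF])
        (isAdmissible_changeMap hf hF hadm _) :=
  Quotient.sound (baseChange_mkDef hf hF hadm _)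

theorem fdMk_eq_of_gauge (hf : f ≠ 0) {F G u : A ⊗[ℂ] S} (hF : fibreMap A S F = f)
    (hadm : IsAdmissible (Ideal.span {F})) (hG : fibreMap A S G = f)
    (hadm' : IsAdmissible (Ideal.span {G})) {φ : (A ⊗[ℂ] S) ≃ₐ[A] (A ⊗[ℂ] S)}
    (hφ : φ ∈ gaugeGroup A S) (hu : IsUnit u) (huF : φ G = u * F) :
    fdMk hf F hF hadm = fdMk hf G hG hadm' :=
  Quotient.sound (mkDef_iso_of_gauge hf hG hF hφ hu huF hadm hadm')

end FDMk

namespace IsGermFrame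
variable {S ι : Type} [CommRing S] [Algebra ℂ S] [IsLocalRing S] [IsDomain S] [Fintype ι]
  [DecidableEq ι] {x : ι → S} {pd : ι → Derivation ℂ S S} {f : S} {A B : Art}

/-- Every admissible deformation is given by one equation. -/
theorem exists_eq_fdMk (h : IsGermFrame x pd f) (y : (FD (Ideal.span {f})).obj A) :
    ∃ F hF hadm, y = fdMk h.ne_zero F hF hadm := by
  obtain ⟨X, rfl⟩ := Quotient.exists_rep y
  obtain ⟨F, hF, hadm, hiso⟩ := h.exists_iso_mkDef X
  exact ⟨F, hF, hadm, Quotient.sound hiso⟩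

/-- Equations of isomorphic deformations differ by a unit and a gauge transformation. -/
theorem exists_gauge_of_fdMk_eq (h : IsGermFrame x pd f) {F G : A ⊗[ℂ] S}
    (hF : fibreMap A S F = f) (hadm : IsAdmissible (Ideal.span {F})) (hG : fibreMap A S G = f)
    (hadm' : IsAdmissible (Ideal.span {G}))
    (heq : fdMk h.ne_zero F hF hadm = fdMk h.ne_zero G hG hadm') :
    ∃ φ ∈ gaugeGroup A S, ∃ u, IsUnit u ∧ φ G = u * F :=
  h.exists_gauge_of_iso hF hG hadm hadm' (Quotient.exact heq)

/-- A class over `B` that restricts to the class of `F = 0` over a quotient of `B` is given by an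
equation that restricts to `F`. -/
theorem exists_fdMk_of_map_eq (h : IsGermFrame x pd f) (g : B ⟶ A)
    (hg : Function.Surjective (show B →ₐ[ℂ] A from g)) {F : A ⊗[ℂ] S}
    (hF : fibreMap A S F = f) (hadm : IsAdmissible (Ideal.span {F}))
    (y : (FD (Ideal.span {f})).obj B)
    (hy : (FD (Ideal.span {f})).map g y = fdMk h.ne_zero F hF hadm) :
    ∃ G hG hadm', y = fdMk h.ne_zero G hG hadm' ∧ changeMap S (show B →ₐ[ℂ] A from g) G = F := by
  let g' : B →ₐ[ℂ] A := g
  obtain ⟨G, hG, hadm', rfl⟩ := h.exists_eq_fdMk y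
  rw [map_fdMk, eq_comm] at hy
  obtain ⟨φ, hφ, u, hu, huF⟩ := h.exists_gauge_of_fdMk_eq _ _ _ _ hy
  obtain ⟨φ', hφ', hφφ⟩ := exists_gauge_lift (g := g') hg hφ
  obtain ⟨u', rfl⟩ := surjective_changeMap (S := S) (g := g') hg u
  have hfu : fibreMap B S u' = 1 := by
    have h1 := congrArg (fibreMap A S) huF
    rw [map_mul, hF, fibreMap_gauge hφ, fibreMap_changeMap, hG, fibreMap_changeMap] at h1
    exact (mul_right_cancel₀ h.ne_zero ((one_mul f).trans h1)).symm
  have hu' : IsUnit u' := isUnit_of_fibreMap (by rw [hfu]; exact isUnit_one)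
  obtain ⟨v, hv⟩ := hu'.exists_left_inv
  have hfv : fibreMap B S v = 1 := by
    have h1 := congrArg (fibreMap B S) hv
    rwa [map_mul, hfu, mul_one, map_one] at h1
  have hG' : fibreMap B S (v * φ' G) = f := by rw [map_mul, hfv, one_mul, fibreMap_gauge hφ', hG]
  have h1 : φ' G = u' * (v * φ' G) := by rw [← mul_assoc, mul_comm u' v, hv, one_mul]
  have h2 : φ'⁻¹ (v * φ' G) = φ'⁻¹ v * G := by
    rw [map_mul]; congr 1; exact φ'.symm_apply_apply G
  have hv' : IsUnit (φ'⁻¹ v) := (IsUnit.of_mul_eq_one u' hv).map _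
  have hadm'' := isAdmissible_of_gauge h.ne_zero hG' hG (inv_mem hφ') hv' h2 hadm'
  refine ⟨v * φ' G, hG', hadm'', ?_, ?_⟩
  · exact fdMk_eq_of_gauge _ _ _ _ _ (inv_mem hφ') hv' h2
  · change changeMap S g' (v * φ' G) = F
    rw [map_mul, hφφ, huF, ← mul_assoc, ← map_mul, hv, map_one, one_mul]

end IsGermFrame

/-! ### Complete local algebras -/

section PowerSeries
open MvPowerSeries
variable {N : ℕ}

theorem mem_maximalIdeal_powerSeries {φ : MvPowerSeries (Fin N) ℂ} :
    φ ∈ maximalIdeal (MvPowerSeries (Fin N) ℂ) ↔ constantCoeff φ = 0 := by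
  rw [mem_maximalIdeal, mem_nonunits_iff, MvPowerSeries.isUnit_iff_constantCoeff, isUnit_iff_ne_zero,
    not_not]

theorem mem_maximalIdeal_pow_powerSeries {k : ℕ} {φ : MvPowerSeries (Fin N) ℂ} :
    φ ∈ maximalIdeal (MvPowerSeries (Fin N) ℂ) ^ k ↔ ∀ m, m.degree < k → coeff m φ = 0 := by
  classical
  constructor
  · intro h
    induction k generalizing φ with
    | zero => simp
    | succ k ih =>
      rw [pow_succ'] at h
      induction h using Submodule.mul_induction_on' with
      | mem_mul_mem φ hφ ψ hψ =>
        intro m hm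
        rw [coeff_mul]
        refine Finset.sum_eq_zero fun p hp => ?_
        rw [Finset.HasAntidiagonal.mem_antidiagonal] at hp
        by_cases h0 : p.1 = 0
        · rw [h0, coeff_zero_eq_constantCoeff_apply, mem_maximalIdeal_powerSeries.mp hφ, zero_mul]
        · rw [ih hψ p.2, mul_zero]
          have h1 : p.1.degree ≠ 0 := fun h => h0 ((Finsupp.degree_eq_zero_iff _).mp h)
          have h2 := congrArg Finsupp.degree hp
          rw [map_add] at h2
          omega
      | add φ _ ψ _ hφ hψ =>
        intro m hm
        rw [map_add, hφ m hm, hψ m hm, add_zero]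
  · intro h
    induction k generalizing φ with
    | zero => simp
    | succ k ih =>
      have h0 : constantCoeff φ = 0 := h 0 (by simp)
      rw [eq_C_add_sum_X_mul φ, h0, map_zero, zero_add, pow_succ']
      refine sum_mem fun i _ => Ideal.mul_mem_mul ?_ (ih fun m hm => ?_)
      · rw [mem_maximalIdeal_powerSeries, constantCoeff_X]
      · rw [coeff_hadamardPart]
        split_ifs with h1
        · refine h _ ?_
          rw [map_add, Finsupp.degree_single]
          omega
        · rfl

instance : IsPrecomplete (maximalIdeal (MvPowerSeries (Fin N) ℂ)) (MvPowerSeries (Fin N) ℂ) where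
  prec' f hf := by
    let L : MvPowerSeries (Fin N) ℂ := fun m => coeff m (f (m.degree + 1))
    have hL : ∀ m, coeff m L = coeff m (f (m.degree + 1)) := fun _ => rfl
    refine ⟨L, fun n => ?_⟩
    rw [SModEq.sub_mem, smul_eq_mul, Ideal.mul_top, mem_maximalIdeal_pow_powerSeries]
    intro m hm
    have h1 := hf (show m.degree + 1 ≤ n by omega)
    rw [SModEq.sub_mem, smul_eq_mul, Ideal.mul_top, mem_maximalIdeal_pow_powerSeries] at h1
    have h2 := h1 m (by omega)
    rw [map_sub, sub_eq_zero] at h2 ⊢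
    rw [hL, h2]

theorem isPrecomplete_of_surjective {R M N : Type} [CommRing R] {I : Ideal R} [AddCommGroup M]
    [Module R M] [AddCommGroup N] [Module R N] [IsPrecomplete I M] {f : M →ₗ[R] N}
    (hf : Function.Surjective f) : IsPrecomplete I N := by
  rw [← AdicCompletion.of_surjective_iff]
  intro y
  obtain ⟨x, rfl⟩ := AdicCompletion.map_surjective I hf y
  obtain ⟨x, rfl⟩ := AdicCompletion.of_surjective I M x
  exact ⟨f x, by rw [AdicCompletion.map_of]⟩

variable {A : Type} [CommRing A] [Algebra ℂ A] [IsLocalRing A] [Module.Finite ℂ A]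

/-- Algebra homomorphisms from a power series ring to a local Artin algebra map the variables to the
maximal ideal. -/
theorem map_X_mem (u : MvPowerSeries (Fin N) ℂ →ₐ[ℂ] A) (l : Fin N) :
    u (X l) ∈ maximalIdeal A := by
  rw [← residueHom_eq_zero]
  by_contra hc
  have h1 : IsUnit (X l - algebraMap ℂ (MvPowerSeries (Fin N) ℂ) (residueHom A (u (X l)))) := by
    rw [MvPowerSeries.isUnit_iff_constantCoeff, map_sub, constantCoeff_X, zero_sub,
      MvPowerSeries.algebraMap_apply, constantCoeff_C]
    simpa using hc
  have h2 := (h1.map u).map (residueHom A)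
  rw [map_sub, map_sub, AlgHom.commutes, AlgHom.commutes] at h2
  simp at h2

/-- Evaluation of power series at elements of the maximal ideal of a local Artin algebra. -/
theorem exists_powerSeries_hom (t : Fin N → A) (ht : ∀ l, t l ∈ maximalIdeal A) :
    ∃ u : MvPowerSeries (Fin N) ℂ →ₐ[ℂ] A, ∀ l, u (X l) = t l := by
  obtain ⟨k, hk⟩ := isNilpotent_maximalIdeal (A := A)
  have hs : HasSubst (fun l => (C (t l) : MvPowerSeries (Fin 0) A)) :=
    hasSubst_of_constantCoeff_nilpotent fun l => by
      rw [constantCoeff_C]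
      refine ⟨k, ?_⟩
      have := Ideal.pow_mem_pow (ht l) k
      rwa [hk] at this
  let c : MvPowerSeries (Fin 0) A →ₐ[ℂ] A :=
    { (constantCoeff : MvPowerSeries (Fin 0) A →+* A) with
      commutes' := fun r => by
        change constantCoeff (algebraMap ℂ (MvPowerSeries (Fin 0) A) r) = _
        rw [MvPowerSeries.algebraMap_apply, constantCoeff_C] }
  refine ⟨c.comp (substAlgHom (R := ℂ) hs), fun l => ?_⟩
  rw [AlgHom.comp_apply, substAlgHom_X]
  exact constantCoeff_C _

theorem powerSeries_hom_ext {u v : MvPowerSeries (Fin N) ℂ →ₐ[ℂ] A} (h : ∀ l, u (X l) = v (X l)) :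
    u = v := by
  have key : ∀ (k : ℕ) φ, u φ - v φ ∈ maximalIdeal A ^ k := by
    intro k
    induction k with
    | zero => simp
    | succ k ih =>
      intro φ
      have h1 : ∀ w : MvPowerSeries (Fin N) ℂ →ₐ[ℂ] A,
          w φ = algebraMap ℂ A (constantCoeff φ) + ∑ i, w (X i) * w (hadamardPart φ i) := fun w => by
        conv_lhs => rw [eq_C_add_sum_X_mul φ]
        rw [map_add, map_sum, ← w.commutes]
        simp only [map_mul]
        rfl
      rw [h1 u, h1 v, add_sub_add_left_eq_sub, ← Finset.sum_sub_distrib]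
      refine sum_mem fun i _ => ?_
      rw [h i, ← mul_sub, pow_succ']
      exact Ideal.mul_mem_mul (map_X_mem v i) (ih _)
  obtain ⟨k, hk⟩ := isNilpotent_maximalIdeal (A := A)
  ext φ
  have := key k φ
  rwa [hk, Ideal.zero_eq_bot, Ideal.mem_bot, sub_eq_zero] at this

variable {𝔯 : Ideal (MvPowerSeries (Fin N) ℂ)}

theorem nontrivial_quotient (h : 𝔯 ≤ maximalIdeal _) :
    Nontrivial (MvPowerSeries (Fin N) ℂ ⧸ 𝔯) :=
  Ideal.Quotient.nontrivial_iff.mpr fun h' =>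
    Ideal.IsPrime.ne_top (inferInstance : (maximalIdeal (MvPowerSeries (Fin N) ℂ)).IsPrime)
      (top_le_iff.mp (h' ▸ h))

theorem isLocalRing_quotient (h : 𝔯 ≤ maximalIdeal _) :
    IsLocalRing (MvPowerSeries (Fin N) ℂ ⧸ 𝔯) :=
  have := nontrivial_quotient h
  IsLocalRing.of_surjective' (Ideal.Quotient.mk 𝔯) Ideal.Quotient.mk_surjective

theorem maximalIdeal_quotient (h : 𝔯 ≤ maximalIdeal _) [IsLocalRing (MvPowerSeries (Fin N) ℂ ⧸ 𝔯)] :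
    maximalIdeal (MvPowerSeries (Fin N) ℂ ⧸ 𝔯) =
      (maximalIdeal (MvPowerSeries (Fin N) ℂ)).map (Ideal.Quotient.mk 𝔯) := by
  have h1 := nontrivial_quotient h
  refine le_antisymm (fun z hz => ?_) ?_
  · obtain ⟨z, rfl⟩ := Ideal.Quotient.mk_surjective z
    refine Ideal.mem_map_of_mem _ ?_
    rw [mem_maximalIdeal, mem_nonunits_iff] at hz ⊢
    exact fun hu => hz (hu.map _)
  · refine le_maximalIdeal ?_
    rw [Ne, Ideal.eq_top_iff_one, ← map_one (Ideal.Quotient.mk 𝔯),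
      Ideal.mem_map_iff_of_surjective _ Ideal.Quotient.mk_surjective]
    rintro ⟨z, h2, h3⟩
    have h4 := sub_mem h2 (h (Ideal.Quotient.eq.mp h3))
    rw [sub_sub_cancel] at h4
    exact (Ideal.ne_top_iff_one _).mp (Ideal.IsPrime.ne_top inferInstance) h4

theorem isAdicComplete_quotient (h : 𝔯 ≤ maximalIdeal _)
    [IsLocalRing (MvPowerSeries (Fin N) ℂ ⧸ 𝔯)] :
    IsAdicComplete (maximalIdeal (MvPowerSeries (Fin N) ℂ ⧸ 𝔯)) (MvPowerSeries (Fin N) ℂ ⧸ 𝔯) := by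
  have h1 : IsHausdorff (maximalIdeal (MvPowerSeries (Fin N) ℂ ⧸ 𝔯))
    (MvPowerSeries (Fin N) ℂ ⧸ 𝔯) := inferInstance
  have h2 : IsPrecomplete (maximalIdeal (MvPowerSeries (Fin N) ℂ)) (MvPowerSeries (Fin N) ℂ ⧸ 𝔯) :=
    isPrecomplete_of_surjective (f := (Ideal.Quotient.mkₐ (MvPowerSeries (Fin N) ℂ) 𝔯).toLinearMap)
      Ideal.Quotient.mk_surjective
  rw [← IsPrecomplete.map_algebraMap_iff (S := MvPowerSeries (Fin N) ℂ ⧸ 𝔯)] at h2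
  have h3 : (maximalIdeal (MvPowerSeries (Fin N) ℂ)).map (algebraMap _ (MvPowerSeries (Fin N) ℂ ⧸ 𝔯)) =
      maximalIdeal (MvPowerSeries (Fin N) ℂ ⧸ 𝔯) := (maximalIdeal_quotient h).symm
  rw [h3] at h2
  exact { h1, h2 with }

theorem residue_bijective_quotient (h : 𝔯 ≤ maximalIdeal _)
    [IsLocalRing (MvPowerSeries (Fin N) ℂ ⧸ 𝔯)] :
    Function.Bijective (algebraMap ℂ (ResidueField (MvPowerSeries (Fin N) ℂ ⧸ 𝔯))) := by
  refine ⟨(algebraMap ℂ (ResidueField (MvPowerSeries (Fin N) ℂ ⧸ 𝔯))).injective, fun z => ?_⟩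
  obtain ⟨z, rfl⟩ := IsLocalRing.residue_surjective z
  obtain ⟨φ, rfl⟩ := Ideal.Quotient.mk_surjective z
  refine ⟨constantCoeff φ, ?_⟩
  have h1 : Ideal.Quotient.mk 𝔯 (algebraMap ℂ _ (constantCoeff φ)) - Ideal.Quotient.mk 𝔯 φ ∈
      maximalIdeal (MvPowerSeries (Fin N) ℂ ⧸ 𝔯) := by
    rw [maximalIdeal_quotient h, ← map_sub]
    refine Ideal.mem_map_of_mem _ ?_
    rw [mem_maximalIdeal_powerSeries, map_sub, MvPowerSeries.algebraMap_apply, constantCoeff_C]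
    simp
  rw [← residue_eq_zero_iff, map_sub, sub_eq_zero] at h1
  rw [← h1]
  rfl

end PowerSeries

/-! ### A criterion for the existence of a hull -/

theorem isLocalRing_of_isNilpotent_ker {C : Type} [CommRing C] [Algebra ℂ C] (ρ : C →ₐ[ℂ] ℂ)
    (h : ∀ c, ρ c = 0 → IsNilpotent c) : IsLocalRing C := by
  have : Nontrivial C := ρ.toRingHom.domain_nontrivial
  have hu : ∀ c, ρ c ≠ 0 → IsUnit c := fun c hc => by
    have h1 : IsNilpotent (c - algebraMap ℂ C (ρ c)) := h _ (by simp)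
    have h2 : IsUnit (algebraMap ℂ C (ρ c)) := (IsUnit.mk0 _ hc).map _
    have h3 := h1.isUnit_add_left_of_commute h2 (Commute.all _ _)
    rwa [add_sub_cancel] at h3
  refine IsLocalRing.of_isUnit_or_isUnit_one_sub_self fun c => ?_
  by_cases hc : ρ c = 0
  · exact Or.inr (hu _ (by simp [hc]))
  · exact Or.inl (hu _ hc)

/-- The constant term of a dual number. -/
def dualFst : dualNumbers →ₐ[ℂ] ℂ := TrivSqZeroExt.fstHom ℂ ℂ ℂ

/-- The coefficient of `ε` in a dual number. -/
def dualSnd : dualNumbers →ₗ[ℂ] ℂ := (TrivSqZeroExt.sndHom ℂ ℂ).restrictScalars ℂ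

theorem dual_ext {z z' : dualNumbers} (h : dualFst z = dualFst z') (h' : dualSnd z = dualSnd z') :
    z = z' := TrivSqZeroExt.ext h h'

theorem dualSnd_mul (z z' : dualNumbers) :
    dualSnd (z * z') = dualFst z * dualSnd z' + dualFst z' * dualSnd z := by
  refine (TrivSqZeroExt.snd_mul (R := ℂ) (M := ℂ) z z').trans ?_
  rw [op_smul_eq_smul, smul_eq_mul, smul_eq_mul]
  rfl

theorem dualSnd_one : dualSnd 1 = 0 := TrivSqZeroExt.snd_one (R := ℂ) (M := ℂ)

theorem residueHom_dualNumbers : residueHom dualNumbers = dualFst :=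
  (residueHom_unique (A := dualNumbers) dualFst).symm

/-- The dual number `a + b ε`. -/
def dualPt (a b : ℂ) : dualNumbers :=
  (TrivSqZeroExt.inl a + TrivSqZeroExt.inr b : DualNumber ℂ)

theorem dualFst_dualPt (a b : ℂ) : dualFst (dualPt a b) = a := by
  change (TrivSqZeroExt.inl a + TrivSqZeroExt.inr b : DualNumber ℂ).fst = a
  simp

theorem dualSnd_dualPt (a b : ℂ) : dualSnd (dualPt a b) = b := by
  change (TrivSqZeroExt.inl a + TrivSqZeroExt.inr b : DualNumber ℂ).snd = b
  simp

theorem dualPt_mem (c : ℂ) : dualPt 0 c ∈ maximalIdeal dualNumbers := by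
  rw [← residueHom_eq_zero, residueHom_dualNumbers, dualFst_dualPt]

theorem mul_dualPt (c : ℂ) (b : dualNumbers) (hb : b ∈ maximalIdeal dualNumbers) :
    b * dualPt 0 c = 0 := by
  rw [← residueHom_eq_zero, residueHom_dualNumbers] at hb
  refine dual_ext ?_ ?_
  · rw [map_mul, hb, zero_mul, map_zero]
  · rw [dualSnd_mul, hb, dualFst_dualPt, zero_mul, zero_mul, add_zero, map_zero]

/-- The fibre product of `B` and `ℂ[ε]` over `ℂ`. -/
def dualExtSub (B : Art) : Subalgebra ℂ (B × dualNumbers) :=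
  AlgHom.equalizer ((residueHom B).comp (AlgHom.fst ℂ B (dualNumbers)))
    ((dualFst).comp (AlgHom.snd ℂ B (dualNumbers)))

theorem mem_dualExtSub {B : Art} {z : B × dualNumbers} :
    z ∈ dualExtSub B ↔ residueHom B z.1 = dualFst z.2 := Iff.rfl

instance (B : Art) : IsLocalRing (dualExtSub B) := by
  refine isLocalRing_of_isNilpotent_ker
    (((residueHom B).comp (AlgHom.fst ℂ B (dualNumbers))).comp (dualExtSub B).val) fun c hc => ?_
  obtain ⟨⟨b, d⟩, hz⟩ := c
  have h1 : residueHom B b = 0 := hc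
  have h2 : dualFst d = 0 := (mem_dualExtSub.mp hz).symm.trans h1
  obtain ⟨k, hk⟩ := isNilpotent_maximalIdeal (A := B)
  have h3 := Ideal.pow_mem_pow (residueHom_eq_zero.mp h1) k
  rw [hk, Ideal.zero_eq_bot, Ideal.mem_bot] at h3
  have h4 : d ^ 2 = 0 := by
    rw [pow_two]
    refine dual_ext ?_ ?_
    · rw [map_mul, h2, zero_mul, map_zero]
    · rw [dualSnd_mul, h2, zero_mul, add_zero, map_zero]
  refine ⟨k + 2, ?_⟩
  apply Subtype.ext
  change (b, d) ^ (k + 2) = 0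
  rw [Prod.pow_mk, pow_add, h3, zero_mul, pow_add, h4, mul_zero]
  rfl

/-- The fibre product of `B` and `ℂ[ε]` over `ℂ`, as a local Artin algebra. -/
def dualExt (B : Art) : Art :=
  have : Module.Finite ℂ (dualExtSub B) :=
    Module.Finite.of_injective (dualExtSub B).val.toLinearMap Subtype.val_injective
  ⟨dualExtSub B⟩

/-- The projection of the fibre product to `B`. -/
def dualExtFst (B : Art) : dualExt B ⟶ B :=
  (AlgHom.fst ℂ B (dualNumbers)).comp (dualExtSub B).val

/-- The projection of the fibre product to `ℂ[ε]`. -/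
def dualExtSnd (B : Art) : dualExt B ⟶ dualNumbers :=
  (AlgHom.snd ℂ B (dualNumbers)).comp (dualExtSub B).val

/-- If `κ` lies in the socle of `B`, then `(b, r + s ε) ↦ b + s κ` is a homomorphism from the fibre
product to `B`. -/
def dualExtAdd (B : Art) (κ : B) (hκ : κ ∈ maximalIdeal B) (h : ∀ b ∈ maximalIdeal B, b * κ = 0) :
    dualExt B ⟶ B :=
  AlgHom.ofLinearMap (A := dualExtSub B)
    (((AlgHom.fst ℂ B (dualNumbers)).toLinearMap +
      (LinearMap.toSpanSingleton ℂ B κ) ∘ₗ dualSnd ∘ₗ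
        (AlgHom.snd ℂ B (dualNumbers)).toLinearMap) ∘ₗ (dualExtSub B).val.toLinearMap)
    (by
      change (1 : B) + dualSnd 1 • κ = 1
      rw [dualSnd_one, zero_smul, add_zero]) fun x y => by
      have hmul : ∀ b, b * κ = residueHom B b • κ := fun b => by
        have := h (b - algebraMap ℂ B (residueHom B b)) (residueHom_eq_zero.mp (by simp))
        rwa [sub_mul, sub_eq_zero, ← Algebra.smul_def] at this
      obtain ⟨⟨b, d⟩, hx⟩ := x
      obtain ⟨⟨b', d'⟩, hy⟩ := y
      rw [mem_dualExtSub] at hx hy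
      change b * b' + dualSnd (d * d') • κ = (b + dualSnd d • κ) * (b' + dualSnd d' • κ)
      have h1 : (b + dualSnd d • κ) * (b' + dualSnd d' • κ) = b * b' + dualSnd d' • (b * κ) +
          dualSnd d • (b' * κ) + (dualSnd d * dualSnd d') • (κ * κ) := by
        simp only [Algebra.smul_def, map_mul]; ring
      rw [h1, h κ hκ, hmul, hmul, hx, hy, dualSnd_mul]
      simp only [smul_zero, add_zero, smul_smul]
      rw [add_assoc, ← add_smul]
      congr 2
      ring

section Tangent
variable {P : Type} [CommRing P] [Algebra ℂ P] (ρ : P →ₐ[ℂ] ℂ)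

/-- The derivations of `P` with values in the residue field at the point `ρ`. -/
def tangent : Submodule ℂ (Module.Dual ℂ P) where
  carrier := {D | ∀ a b, D (a * b) = ρ a * D b + ρ b * D a}
  add_mem' {D D'} h h' a b := by
    rw [LinearMap.add_apply, LinearMap.add_apply, LinearMap.add_apply, h, h']; ring
  zero_mem' a b := by simp
  smul_mem' c D h a b := by
    rw [LinearMap.smul_apply, LinearMap.smul_apply, LinearMap.smul_apply, h]
    simp only [smul_eq_mul]; ring

variable {ρ}

/-- The homomorphism to the dual numbers given by a tangent vector. -/
def dualHom (D : tangent ρ) : P →ₐ[ℂ] dualNumbers :=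
  AlgHom.ofLinearMap
    { toFun := fun p => dualPt (ρ p) (D.1 p)
      map_add' := fun p q => by
        refine dual_ext ?_ ?_
        · rw [map_add dualFst, dualFst_dualPt, dualFst_dualPt, dualFst_dualPt, map_add]
        · rw [map_add dualSnd, dualSnd_dualPt, dualSnd_dualPt, dualSnd_dualPt, map_add]
      map_smul' := fun c p => by
        refine dual_ext ?_ ?_
        · rw [map_smul dualFst, dualFst_dualPt, dualFst_dualPt, map_smul]; rfl
        · rw [map_smul dualSnd, dualSnd_dualPt, dualSnd_dualPt, map_smul]; rfl }
    (by
      have h := D.2 1 1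
      have h1 : D.1 1 = 0 := by simpa using h
      refine dual_ext ?_ ?_
      · change dualFst (dualPt (ρ 1) (D.1 1)) = _
        rw [dualFst_dualPt, map_one, map_one]
      · change dualSnd (dualPt (ρ 1) (D.1 1)) = _
        rw [dualSnd_dualPt, h1, dualSnd_one])
    fun p q => by
      refine dual_ext ?_ ?_
      · change dualFst (dualPt (ρ (p * q)) (D.1 (p * q))) =
          dualFst (dualPt (ρ p) (D.1 p) * dualPt (ρ q) (D.1 q))
        rw [map_mul dualFst, dualFst_dualPt, dualFst_dualPt, dualFst_dualPt, map_mul]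
      · change dualSnd (dualPt (ρ (p * q)) (D.1 (p * q))) =
          dualSnd (dualPt (ρ p) (D.1 p) * dualPt (ρ q) (D.1 q))
        rw [dualSnd_mul, dualFst_dualPt, dualSnd_dualPt, dualFst_dualPt, dualSnd_dualPt,
          dualSnd_dualPt]
        exact D.2 p q

theorem dualHom_apply (D : tangent ρ) (p : P) : dualHom D p = dualPt (ρ p) (D.1 p) := rfl

/-- The homomorphism `(u, D)` to the fibre product of `B` and `ℂ[ε]`. -/
def pairHom (hρ : Subsingleton (P →ₐ[ℂ] ℂ)) {B : Art} (u : P →ₐ[ℂ] B) (D : tangent ρ) :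
    P →ₐ[ℂ] dualExt B :=
  AlgHom.codRestrict (AlgHom.prod u (dualHom D)) (dualExtSub B) fun p => by
    rw [mem_dualExtSub]
    change (residueHom B).comp u p = _
    rw [Subsingleton.elim ((residueHom B).comp u) ρ]
    exact (dualFst_dualPt _ _).symm

theorem dualExtAdd_pairHom (hρ : Subsingleton (P →ₐ[ℂ] ℂ)) {B : Art} (u : P →ₐ[ℂ] B)
    (D : tangent ρ) (κ : B) (hκ : κ ∈ maximalIdeal B) (h : ∀ b ∈ maximalIdeal B, b * κ = 0) (p : P) :
    (show dualExt B →ₐ[ℂ] B from dualExtAdd B κ hκ h) (pairHom hρ u D p) = u p + D.1 p • κ := by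
  change u p + dualSnd (dualPt (ρ p) (D.1 p)) • κ = _
  rw [dualSnd_dualPt]

end Tangent

/-! ### Small extensions suffice for smoothness -/

/-- The quotient of a local Artin algebra by a proper ideal. -/
def quotArt (B : Art) (I : Ideal B) (h : I ≠ ⊤) : Art :=
  have : Nontrivial (B ⧸ I) := Ideal.Quotient.nontrivial_iff.mpr h
  have : IsLocalRing (B ⧸ I) := IsLocalRing.of_surjective' (Ideal.Quotient.mk I)
    Ideal.Quotient.mk_surjective
  ⟨B ⧸ I⟩

/-- A non-zero proper ideal of a local Artin algebra meets the socle. -/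
theorem exists_socle_mem {B : Art} {K : Ideal B} (hK : K ≠ ⊥) :
    ∃ κ ∈ K, κ ≠ 0 ∧ ∀ b ∈ maximalIdeal B, b * κ = 0 := by
  obtain ⟨k, hk⟩ := isNilpotent_maximalIdeal (A := B)
  have key : ∀ k : ℕ, maximalIdeal B ^ k * K = ⊥ →
      ∃ κ ∈ K, κ ≠ 0 ∧ ∀ b ∈ maximalIdeal B, b * κ = 0 := by
    intro k
    induction k with
    | zero => exact fun h => absurd (by rwa [pow_zero, one_mul] at h) hK
    | succ k ih =>
      intro h
      by_cases h1 : maximalIdeal B ^ k * K = ⊥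
      · exact ih h1
      · obtain ⟨κ, h2, h3⟩ := Submodule.exists_mem_ne_zero_of_ne_bot h1
        refine ⟨κ, Ideal.mul_le_right h2, h3, fun b hb => ?_⟩
        have h4 : b * κ ∈ maximalIdeal B ^ (k + 1) * K := by
          rw [pow_succ', mul_assoc]
          exact Ideal.mul_mem_mul hb h2
        rwa [h, Ideal.mem_bot] at h4
  exact key k (by rw [hk, Ideal.zero_eq_bot, Ideal.bot_mul])

/-- Smoothness may be tested on small extensions. -/
theorem isSmooth_of_isSmallExt {G F : Art ⥤ Type} (η : G ⟶ F)
    (h : ∀ (B A : Art) (p : B ⟶ A) (κ : B), IsSmallExt (show B →ₐ[ℂ] A from p) κ →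
      ∀ (a : G.obj A) (y : F.obj B), η.app A a = F.map p y →
        ∃ x : G.obj B, G.map p x = a ∧ η.app B x = y) : IsSmooth η := by
  intro B A p hp a y hay
  induction hn : Module.finrank ℂ B using Nat.strong_induction_on generalizing B with
  | _ n ih =>
  let p' : B →ₐ[ℂ] A := p
  by_cases hK : RingHom.ker p' = ⊥
  · -- an isomorphism of bases
    have hinj : Function.Injective p' := (RingHom.injective_iff_ker_eq_bot p'.toRingHom).mpr hK
    let e : B ≃ₐ[ℂ] A := AlgEquiv.ofBijective p' ⟨hinj, hp⟩
    let q : A ⟶ B := (e.symm : A →ₐ[ℂ] B)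
    have h1 : q ≫ p = 𝟙 A := AlgHom.ext fun x => e.apply_symm_apply x
    have h2 : p ≫ q = 𝟙 B := AlgHom.ext fun x => e.symm_apply_apply x
    refine ⟨G.map q a, ?_, ?_⟩
    · rw [← Functor.map_comp_apply, h1, Functor.map_id_apply]
    · rw [NatTrans.naturality_apply, hay, ← Functor.map_comp_apply, h2,
        Functor.map_id_apply]
  · obtain ⟨κ, hκ, hκ0, hsoc⟩ := exists_socle_mem hK
    have htop : Ideal.span {κ} ≠ ⊤ := fun ht => by
      have h1 : RingHom.ker p' = ⊤ :=
        top_le_iff.mp (ht ▸ (Ideal.span_singleton_le_iff_mem _).mpr hκ)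
      exact RingHom.ker_ne_top p' h1
    let B' : Art := quotArt B (Ideal.span {κ}) htop
    let π : B ⟶ B' := Ideal.Quotient.mkₐ ℂ (Ideal.span {κ})
    have hπ : IsSmallExt (show B →ₐ[ℂ] B' from π) κ :=
      { surjective := Ideal.Quotient.mk_surjective
        ne_zero := hκ0
        map_eq_zero := Ideal.Quotient.eq_zero_iff_mem.mpr (Ideal.mem_span_singleton_self κ)
        ker := fun b hb => by
          obtain ⟨c, rfl⟩ := Ideal.mem_span_singleton'.mp (Ideal.Quotient.eq_zero_iff_mem.mp hb)
          refine ⟨residueHom B c, ?_⟩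
          have := hsoc (c - algebraMap ℂ B (residueHom B c)) (residueHom_eq_zero.mp (by simp))
          rwa [sub_mul, sub_eq_zero, ← Algebra.smul_def] at this
        socle := hsoc }
    have hle : ∀ b ∈ Ideal.span {κ}, p' b = 0 := fun b hb =>
      (Ideal.span_singleton_le_iff_mem _).mpr hκ hb
    let r : B' ⟶ A := Ideal.Quotient.liftₐ (Ideal.span {κ}) p' hle
    have hr : Function.Surjective (show B' →ₐ[ℂ] A from r) := fun x => by
      obtain ⟨b, rfl⟩ := hp x
      exact ⟨Ideal.Quotient.mk _ b, rfl⟩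
    have hcomp : π ≫ r = p := AlgHom.ext fun x => rfl
    have hlt : Module.finrank ℂ B' < n := by
      rw [← hn]
      refine lt_of_le_of_ne (LinearMap.finrank_le_finrank_of_surjective
        (f := (show B →ₐ[ℂ] B' from π).toLinearMap) hπ.surjective) fun heq => ?_
      have h1 : Function.Injective (show B →ₐ[ℂ] B' from π).toLinearMap :=
        (LinearMap.injective_iff_surjective_of_finrank_eq_finrank heq.symm).mpr hπ.surjective
      exact hκ0 (h1 (hπ.map_eq_zero.trans (map_zero _).symm))
    obtain ⟨x', hx', hx'y⟩ := ih _ hlt B' r hr (F.map π y)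
      (by rw [← Functor.map_comp_apply, hcomp, hay]) rfl
    obtain ⟨x, hx, hxy⟩ := h B B' π κ hπ x' y hx'y
    exact ⟨x, by rw [← hcomp, Functor.map_comp_apply, hx, hx'], hxy⟩

/-! ### Construction of the hull -/

/-- The residue field, as a local Artin algebra. -/
def pointArt : Art := ⟨ℂ⟩

/-- The value of a natural transformation at a homomorphism. -/
def natApp {P : Type} [CommRing P] [Algebra ℂ P] {F : Art ⥤ Type} (η : homFunctor P ⟶ F) {A : Art}
    (u : P →ₐ[ℂ] A) : F.obj A := η.app A u

theorem map_natApp {P : Type} [CommRing P] [Algebra ℂ P] {F : Art ⥤ Type} (η : homFunctor P ⟶ F)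
    {A B : Art} (p : A ⟶ B) (u : P →ₐ[ℂ] A) :
    F.map p (natApp η u) = natApp η ((show A →ₐ[ℂ] B from p).comp u) :=
  (NatTrans.naturality_apply η p u).symm

/-- The dual numbers are a small extension of the residue field. -/
theorem isSmallExt_dualNumbers : IsSmallExt (A := ℂ) dualFst (dualPt 0 1) where
  surjective := fun c => ⟨dualPt c 0, dualFst_dualPt c 0⟩
  ne_zero := fun h => by
    have := congrArg dualSnd h
    rw [dualSnd_dualPt, map_zero] at this
    exact one_ne_zero this
  map_eq_zero := dualFst_dualPt 0 1
  ker := fun b hb => by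
    refine ⟨dualSnd b, dual_ext ?_ ?_⟩
    · rw [map_smul, dualFst_dualPt, smul_zero, hb]
    · rw [map_smul, dualSnd_dualPt, smul_eq_mul, mul_one]
  socle := mul_dualPt 1

section Hull
variable {P : Type} [CommRing P] [Algebra ℂ P] {ρ : P →ₐ[ℂ] ℂ} {F : Art ⥤ Type}
  {η : homFunctor P ⟶ F}

/-- The tangent space acts compatibly on deformations over `B` through any element of the socle. -/
theorem natApp_eq_of_add (hρ : Subsingleton (P →ₐ[ℂ] ℂ))
    (hinj : ∀ (B : Art) (y y' : F.obj (dualExt B)), F.map (dualExtFst B) y = F.map (dualExtFst B) y' →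
      F.map (dualExtSnd B) y = F.map (dualExtSnd B) y' → y = y')
    {B : Art} {u u' v v' : P →ₐ[ℂ] B} {D D' : tangent ρ} {κ : B} (hκ : κ ∈ maximalIdeal B)
    (h : ∀ b ∈ maximalIdeal B, b * κ = 0) (hu : natApp η u = natApp η u')
    (hD : natApp η (dualHom D) = natApp η (dualHom D'))
    (hv : ∀ p, v p = u p + D.1 p • κ) (hv' : ∀ p, v' p = u' p + D'.1 p • κ) :
    natApp η v = natApp η v' := by
  have h1 : natApp η (pairHom hρ u D) = natApp η (pairHom hρ u' D') := by
    refine hinj B _ _ ?_ ?_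
    · rw [map_natApp, map_natApp]; exact hu
    · rw [map_natApp, map_natApp]; exact hD
  have h2 := congrArg (F.map (dualExtAdd B κ hκ h)) h1
  rw [map_natApp, map_natApp] at h2
  have h3 : ∀ (u v : P →ₐ[ℂ] B) (D : tangent ρ), (∀ p, v p = u p + D.1 p • κ) →
      (show dualExt B →ₐ[ℂ] B from dualExtAdd B κ hκ h).comp (pairHom hρ u D) = v :=
    fun u v D hv => AlgHom.ext fun p => (dualExtAdd_pairHom hρ u D κ hκ h p).trans (hv p).symm
  rwa [h3 u v D hv, h3 u' v' D' hv'] at h2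

theorem dualHom_add_smul (D D' : tangent ρ) (c : ℂ) (p : P) :
    dualHom (D + c • D') p = dualHom D p + D'.1 p • dualPt 0 c := by
  rw [dualHom_apply, dualHom_apply]
  refine dual_ext ?_ ?_
  · rw [map_add, map_smul, dualFst_dualPt, dualFst_dualPt, dualFst_dualPt, smul_zero, add_zero]
  · rw [map_add, map_smul, dualSnd_dualPt, dualSnd_dualPt, dualSnd_dualPt]
    change D.1 p + c * D'.1 p = D.1 p + D'.1 p * c
    rw [mul_comm]

theorem exists_dualHom_eq (hρ : Subsingleton (P →ₐ[ℂ] ℂ)) (ρ : P →ₐ[ℂ] ℂ)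
    (w : P →ₐ[ℂ] dualNumbers) : ∃ D : tangent ρ, dualHom D = w := by
  have h1 : ∀ p, dualFst (w p) = ρ p := fun p =>
    DFunLike.congr_fun (Subsingleton.elim (dualFst.comp w) ρ) p
  refine ⟨⟨dualSnd ∘ₗ w.toLinearMap, fun a b => ?_⟩, ?_⟩
  · change dualSnd (w (a * b)) = ρ a * dualSnd (w b) + ρ b * dualSnd (w a)
    rw [map_mul, dualSnd_mul, h1, h1]
  · ext p
    rw [dualHom_apply]
    refine dual_ext ?_ ?_
    · rw [dualFst_dualPt, h1]
    · rw [dualSnd_dualPt]; rfl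

/-- The tangent vectors along which the family is constant to first order. -/
def tangentKer (hρ : Subsingleton (P →ₐ[ℂ] ℂ)) (ρ : P →ₐ[ℂ] ℂ) (η : homFunctor P ⟶ F)
    (hinj : ∀ (B : Art) (y y' : F.obj (dualExt B)), F.map (dualExtFst B) y = F.map (dualExtFst B) y' →
      F.map (dualExtSnd B) y = F.map (dualExtSnd B) y' → y = y') :
    Submodule ℂ (tangent ρ) where
  carrier := {D | natApp η (dualHom D) = natApp η (dualHom (0 : tangent ρ))}
  zero_mem' := rfl
  add_mem' {D D'} hD hD' := by
    refine Eq.trans ?_ hD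
    refine natApp_eq_of_add hρ hinj (B := dualNumbers) (u := dualHom D) (u' := dualHom D) (D := D')
      (D' := 0) (dualPt_mem 1) (mul_dualPt 1) rfl hD' (fun p => ?_) (fun p => ?_)
    · have := dualHom_add_smul D D' 1 p
      rwa [one_smul] at this
    · rw [Submodule.coe_zero, LinearMap.zero_apply, zero_smul, add_zero]
  smul_mem' c D hD := by
    refine natApp_eq_of_add hρ hinj (B := dualNumbers) (u := dualHom (0 : tangent ρ))
      (u' := dualHom (0 : tangent ρ)) (D := D) (D' := 0) (dualPt_mem c) (mul_dualPt c) rfl hD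
      (fun p => ?_) (fun p => ?_)
    · have := dualHom_add_smul 0 D c p
      rwa [zero_add] at this
    · rw [Submodule.coe_zero, LinearMap.zero_apply, zero_smul, add_zero]

theorem mem_tangentKer {hρ : Subsingleton (P →ₐ[ℂ] ℂ)}
    {hinj : ∀ (B : Art) (y y' : F.obj (dualExt B)), F.map (dualExtFst B) y = F.map (dualExtFst B) y' →
      F.map (dualExtSnd B) y = F.map (dualExtSnd B) y' → y = y'} {D : tangent ρ} :
    D ∈ tangentKer hρ ρ η hinj ↔ natApp η (dualHom D) =
      natApp η (dualHom (0 : tangent ρ)) := Iff.rfl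

theorem sub_mem_tangentKer_iff {hρ : Subsingleton (P →ₐ[ℂ] ℂ)}
    {hinj : ∀ (B : Art) (y y' : F.obj (dualExt B)), F.map (dualExtFst B) y = F.map (dualExtFst B) y' →
      F.map (dualExtSnd B) y = F.map (dualExtSnd B) y' → y = y'} {D D' : tangent ρ} :
    D - D' ∈ tangentKer hρ ρ η hinj ↔ natApp η (dualHom D) =
      natApp η (dualHom D') := by
  constructor
  · intro h
    rw [mem_tangentKer] at h
    refine natApp_eq_of_add hρ hinj (B := dualNumbers) (u := dualHom D') (u' := dualHom D')
      (D := D - D') (D' := 0) (dualPt_mem 1) (mul_dualPt 1) rfl h (fun p => ?_) (fun p => ?_)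
    · have := dualHom_add_smul D' (D - D') 1 p
      rwa [one_smul, add_sub_cancel] at this
    · rw [Submodule.coe_zero, LinearMap.zero_apply, zero_smul, add_zero]
  · intro h
    rw [mem_tangentKer]
    refine natApp_eq_of_add hρ hinj (B := dualNumbers) (u := dualHom D) (u' := dualHom D')
      (D := D') (D' := D') (dualPt_mem (-1)) (mul_dualPt (-1)) h rfl (fun p => ?_) (fun p => ?_)
    · have := dualHom_add_smul D D' (-1) p
      rwa [neg_one_smul ℂ D', ← sub_eq_add_neg] at this
    · have := dualHom_add_smul D' D' (-1) p
      rwa [neg_one_smul ℂ D', add_neg_cancel] at this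

end Hull

/-- A homomorphism that kills the kernel of a surjection factors through it. -/
theorem exists_comp_eq_of_ker_le {P R B : Type} [CommRing P] [Algebra ℂ P] [CommRing R] [Algebra ℂ R]
    [CommRing B] [Algebra ℂ B] (q : P →ₐ[ℂ] R) (hq : Function.Surjective q) (v : P →ₐ[ℂ] B)
    (h : ∀ p, q p = 0 → v p = 0) : ∃ w : R →ₐ[ℂ] B, w.comp q = v := by
  refine ⟨(Ideal.Quotient.liftₐ (RingHom.ker q) v h).comp
    (Ideal.quotientKerAlgEquivOfSurjective hq).symm.toAlgHom, AlgHom.ext fun p => ?_⟩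
  have : (Ideal.quotientKerAlgEquivOfSurjective hq).symm (q p) =
      Ideal.Quotient.mk (RingHom.ker q) p := by
    rw [AlgEquiv.symm_apply_eq]; rfl
  change Ideal.Quotient.liftₐ _ v h ((Ideal.quotientKerAlgEquivOfSurjective hq).symm (q p)) = _
  rw [this]
  rfl

/-- Restriction of homomorphisms along `P → R`. -/
def homFunctorMap {P R : Type} [CommRing P] [Algebra ℂ P] [CommRing R] [Algebra ℂ R]
    (q : P →ₐ[ℂ] R) : homFunctor R ⟶ homFunctor P where
  app A := ↾(fun u : R →ₐ[ℂ] A => u.comp q)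
  naturality _ _ _ := rfl

/-- A subspace of a finite-dimensional space has a complement; the functions below are coordinates of
the projection to the subspace. -/
theorem exists_coordinates {V : Type} [AddCommGroup V] [Module ℂ V] [FiniteDimensional ℂ V]
    (N : Submodule ℂ V) : ∃ (k : ℕ) (ψ : Fin k → Module.Dual ℂ V),
      (∀ v ∈ N, (∀ j, ψ j v = 0) → v = 0) ∧ ∀ c : Fin k → ℂ, ∃ n ∈ N, ∀ j, ψ j n = c j := by
  obtain ⟨pr, hpr⟩ := N.subtype.exists_leftInverse_of_injective N.ker_subtype
  have hprN : ∀ n : N, pr n = n := fun n => LinearMap.congr_fun hpr n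
  let ν := Module.finBasis ℂ N
  refine ⟨_, fun j => ν.coord j ∘ₗ pr, fun v hv h => ?_, fun c =>
    ⟨ν.equivFun.symm c, Subtype.mem _, fun j => ?_⟩⟩
  · have : (⟨v, hv⟩ : N) = 0 := ν.ext_elem fun j => by
      rw [map_zero, ← hprN ⟨v, hv⟩]
      exact h j
    exact congrArg Subtype.val this
  · rw [LinearMap.comp_apply, hprN, Module.Basis.coord_apply, ← Module.Basis.equivFun_apply,
      LinearEquiv.apply_symm_apply]

section Hull
variable {P : Type} [CommRing P] [Algebra ℂ P] {ρ : P →ₐ[ℂ] ℂ} {F : Art ⥤ Type}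
  {η : homFunctor P ⟶ F}

/-- Dividing the parameter ring of a family that induces all small extensions by equations that
cut out a complement of the trivial directions gives a family that is moreover effective on tangent
vectors. -/
theorem exists_equations_of_smooth (hρ : Subsingleton (P →ₐ[ℂ] ℂ)) [FiniteDimensional ℂ (tangent ρ)]
    (hT : ∀ ψ : Module.Dual ℂ (tangent ρ), ∃ p : P, ρ p = 0 ∧ ∀ D : tangent ρ, D.1 p = ψ D)
    (hpt : Subsingleton (F.obj pointArt))
    (hsm : ∀ (B A : Art) (p : B ⟶ A) (κ : B), IsSmallExt (show B →ₐ[ℂ] A from p) κ →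
      ∀ (a : P →ₐ[ℂ] A) (y : F.obj B), natApp η a = F.map p y →
        ∃ x : P →ₐ[ℂ] B, (show B →ₐ[ℂ] A from p).comp x = a ∧ natApp η x = y)
    (hinj : ∀ (B : Art) (y y' : F.obj (dualExt B)), F.map (dualExtFst B) y = F.map (dualExtFst B) y' →
      F.map (dualExtSnd B) y = F.map (dualExtSnd B) y' → y = y') :
    ∃ G : Set P, (∀ p ∈ G, ρ p = 0) ∧ ∀ (R : Type) [CommRing R] [Algebra ℂ R] (q : P →ₐ[ℂ] R),
      Function.Surjective q → RingHom.ker q = Ideal.span G →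
        ∃ η' : homFunctor R ⟶ F, IsSmooth η' ∧ Function.Bijective (η'.app dualNumbers) := by
  obtain ⟨k, ψ, hψ, hψN⟩ := exists_coordinates (tangentKer hρ ρ η hinj)
  choose ℓ hℓ0 hℓ using fun j => hT (ψ j)
  refine ⟨Set.range ℓ, ?_, fun R _ _ q hq hker => ⟨homFunctorMap q ≫ η, ?_, ?_, ?_⟩⟩
  · rintro _ ⟨j, rfl⟩; exact hℓ0 j
  all_goals
    have hqℓ : ∀ j, q (ℓ j) = 0 := fun j =>
      (RingHom.mem_ker (f := q)).mp (hker ▸ Ideal.subset_span ⟨j, rfl⟩)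
    have hfac : ∀ {B : Art} (v : P →ₐ[ℂ] B), (∀ j, v (ℓ j) = 0) →
        ∃ w : R →ₐ[ℂ] B, w.comp q = v := fun v hv => by
      refine exists_comp_eq_of_ker_le q hq v fun p hp => ?_
      have h1 : p ∈ Ideal.span (Set.range ℓ) := hker ▸ (RingHom.mem_ker (f := q)).mpr hp
      have h2 : Ideal.span (Set.range ℓ) ≤ RingHom.ker v :=
        Ideal.span_le.mpr (by rintro _ ⟨j, rfl⟩; exact hv j)
      exact h2 h1
  · refine isSmooth_of_isSmallExt _ fun B A p κ hκ (a : R →ₐ[ℂ] A) y hay => ?_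
    obtain ⟨x, hx, hxy⟩ := hsm B A p κ hκ (a.comp q) y hay
    have h1 : ∀ j, ∃ c : ℂ, x (ℓ j) = c • κ := fun j => by
      refine hκ.ker _ ((DFunLike.congr_fun hx (ℓ j)).trans ?_)
      rw [AlgHom.comp_apply, hqℓ, map_zero]
    choose c hc using h1
    -- moving along a trivial direction makes the equations vanish and keeps the deformation
    obtain ⟨n, hnN, hn⟩ := hψN fun j => -c j
    let v : P →ₐ[ℂ] B := (show dualExt B →ₐ[ℂ] B from
      dualExtAdd B κ hκ.mem_maximalIdeal hκ.socle).comp (pairHom hρ x n)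
    have hv : ∀ p, v p = x p + n.1 p • κ := fun p =>
      dualExtAdd_pairHom hρ x n κ hκ.mem_maximalIdeal hκ.socle p
    have hvx : natApp η v = natApp η x :=
      natApp_eq_of_add hρ hinj hκ.mem_maximalIdeal hκ.socle rfl (mem_tangentKer.mp hnN) hv
        fun p => by rw [Submodule.coe_zero, LinearMap.zero_apply, zero_smul, add_zero]
    obtain ⟨w, hw⟩ := hfac v fun j => by rw [hv, hc, hℓ, hn, neg_smul, add_neg_cancel]
    refine ⟨w, ?_, ?_⟩
    · refine AlgHom.ext fun r => ?_
      obtain ⟨r, rfl⟩ := hq r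
      have h2 := DFunLike.congr_fun hw r
      have h3 := DFunLike.congr_fun hx r
      rw [AlgHom.comp_apply] at h2 h3
      change (show B →ₐ[ℂ] A from p) (w (q r)) = _
      rw [h2, hv, map_add, map_smul, hκ.map_eq_zero, smul_zero, add_zero, h3]
      rfl
    · change natApp η (w.comp q) = y
      rw [hw, hvx, hxy]
  · intro (w : R →ₐ[ℂ] dualNumbers) (w' : R →ₐ[ℂ] dualNumbers) heq
    change natApp η (w.comp q) = natApp η (w'.comp q) at heq
    obtain ⟨D, hD⟩ := exists_dualHom_eq hρ ρ (w.comp q)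
    obtain ⟨D', hD'⟩ := exists_dualHom_eq hρ ρ (w'.comp q)
    have h0 : ∀ (w : R →ₐ[ℂ] dualNumbers) (D : tangent ρ), dualHom D = w.comp q → ∀ j, ψ j D = 0 := by
      intro w D hD j
      have h1 := congrArg dualSnd (DFunLike.congr_fun hD (ℓ j))
      rwa [AlgHom.comp_apply, hqℓ, map_zero, map_zero, dualHom_apply, dualSnd_dualPt, hℓ] at h1
    rw [← hD, ← hD', ← sub_mem_tangentKer_iff (hρ := hρ) (hinj := hinj)] at heq
    have h2 : D = D' := sub_eq_zero.mp (hψ _ heq fun j => by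
      rw [map_sub, h0 w D hD, h0 w' D' hD', sub_zero])
    refine AlgHom.ext fun r => ?_
    obtain ⟨r, rfl⟩ := hq r
    exact DFunLike.congr_fun (hD.symm.trans ((congrArg dualHom h2).trans hD')) r
  · intro y
    obtain ⟨x, -, hxy⟩ := hsm dualNumbers pointArt dualFst _ isSmallExt_dualNumbers ρ y
      (Subsingleton.elim _ _)
    obtain ⟨D, rfl⟩ := exists_dualHom_eq hρ ρ x
    obtain ⟨n, hnN, hn⟩ := hψN fun j => ψ j D
    obtain ⟨w, hw⟩ := hfac (dualHom (D - n)) fun j => by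
      rw [dualHom_apply, hℓ0, hℓ, map_sub, hn, sub_self]
      exact dual_ext (by rw [dualFst_dualPt, map_zero]) (by rw [dualSnd_dualPt, map_zero])
    refine ⟨w, ?_⟩
    change natApp η (w.comp q) = y
    rw [hw, ← hxy, ← sub_mem_tangentKer_iff (hρ := hρ) (hinj := hinj), sub_sub_cancel_left]
    exact neg_mem hnN

end Hull

section Cover
open MvPowerSeries
variable {N : ℕ} {𝔠 : Ideal (MvPowerSeries (Fin N) ℂ)}

/-- A functor has a hull if it is covered by a family over a complete local algebra that lifts along
small extensions, and if `F(B ×_ℂ ℂ[ε]) → F(B) × F(ℂ[ε])` is injective for all `B`. -/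
theorem hasHull_of_cover {F : Art ⥤ Type} (h𝔠 : 𝔠 ≤ maximalIdeal (MvPowerSeries (Fin N) ℂ))
    (η : homFunctor (MvPowerSeries (Fin N) ℂ ⧸ 𝔠) ⟶ F) (hpt : Subsingleton (F.obj pointArt))
    (hsm : ∀ (B A : Art) (p : B ⟶ A) (κ : B), IsSmallExt (show B →ₐ[ℂ] A from p) κ →
      ∀ (a : (MvPowerSeries (Fin N) ℂ ⧸ 𝔠) →ₐ[ℂ] A) (y : F.obj B), natApp η a = F.map p y →
        ∃ x : (MvPowerSeries (Fin N) ℂ ⧸ 𝔠) →ₐ[ℂ] B,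
          (show B →ₐ[ℂ] A from p).comp x = a ∧ natApp η x = y)
    (hinj : ∀ (B : Art) (y y' : F.obj (dualExt B)), F.map (dualExtFst B) y = F.map (dualExtFst B) y' →
      F.map (dualExtSnd B) y = F.map (dualExtSnd B) y' → y = y') : HasHull F := by
  let π : MvPowerSeries (Fin N) ℂ →ₐ[ℂ] MvPowerSeries (Fin N) ℂ ⧸ 𝔠 := Ideal.Quotient.mkₐ ℂ 𝔠
  have hπ : Function.Surjective π := Ideal.Quotient.mk_surjective
  have hext : ∀ {A : Art} (u v : (MvPowerSeries (Fin N) ℂ ⧸ 𝔠) →ₐ[ℂ] A),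
      (∀ l, u (π (X l)) = v (π (X l))) → u = v := fun u v h => by
    have h1 := powerSeries_hom_ext (u := u.comp π) (v := v.comp π) h
    refine AlgHom.ext fun z => ?_
    obtain ⟨z, rfl⟩ := hπ z
    exact DFunLike.congr_fun h1 z
  have hmax : ∀ c ∈ maximalIdeal ℂ, c = 0 := fun c hc => by
    by_contra h
    exact (mem_maximalIdeal c).mp hc (isUnit_iff_ne_zero.mpr h)
  have hX : ∀ (u : (MvPowerSeries (Fin N) ℂ ⧸ 𝔠) →ₐ[ℂ] ℂ) l, u (π (X l)) = 0 := fun u l =>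
    hmax _ (map_X_mem (u.comp π) l)
  have hρ : Subsingleton ((MvPowerSeries (Fin N) ℂ ⧸ 𝔠) →ₐ[ℂ] ℂ) :=
    ⟨fun u v => hext (A := pointArt) u v fun l => (hX u l).trans (hX v l).symm⟩
  let ρ₀ : MvPowerSeries (Fin N) ℂ →ₐ[ℂ] ℂ :=
    { constantCoeff (σ := Fin N) (R := ℂ) with
      commutes' := fun c => by
        change constantCoeff (algebraMap ℂ (MvPowerSeries (Fin N) ℂ) c) = c
        rw [MvPowerSeries.algebraMap_apply, constantCoeff_C]; rfl }
  obtain ⟨ρ, hρπ⟩ := exists_comp_eq_of_ker_le π hπ ρ₀ fun z hz =>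
    mem_maximalIdeal_powerSeries.mp (h𝔠 (Ideal.Quotient.eq_zero_iff_mem.mp hz))
  let e : tangent ρ →ₗ[ℂ] Fin N → ℂ :=
    { toFun := fun D l => D.1 (π (X l))
      map_add' := fun _ _ => rfl
      map_smul' := fun _ _ => rfl }
  have he : Function.Injective e := fun D D' h => by
    have h1 : dualHom D = dualHom D' := hext _ _ fun l => by
      rw [dualHom_apply, dualHom_apply]
      exact congrArg _ (congrFun h l)
    refine Subtype.ext (LinearMap.ext fun p => ?_)
    have := congrArg dualSnd (DFunLike.congr_fun h1 p)
    rwa [dualHom_apply, dualHom_apply, dualSnd_dualPt, dualSnd_dualPt] at this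
  have : FiniteDimensional ℂ (tangent ρ) := FiniteDimensional.of_injective e he
  obtain ⟨r, hr⟩ := e.exists_leftInverse_of_injective (LinearMap.ker_eq_bot.mpr he)
  have hT : ∀ ψ : Module.Dual ℂ (tangent ρ), ∃ p, ρ p = 0 ∧ ∀ D : tangent ρ, D.1 p = ψ D := by
    refine fun ψ => ⟨∑ l, ψ (r (Pi.single l 1)) • π (X l), ?_, fun D => ?_⟩
    · rw [map_sum]
      refine Finset.sum_eq_zero fun l _ => ?_
      rw [map_smul, hX, smul_zero]
    · have h1 : D = r (e D) := (LinearMap.congr_fun hr D).symm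
      conv_rhs => rw [h1, ← LinearMap.comp_apply, LinearMap.pi_apply_eq_sum_univ (ψ ∘ₗ r) (e D)]
      rw [map_sum]
      refine Finset.sum_congr rfl fun l _ => ?_
      rw [map_smul, smul_eq_mul, smul_eq_mul, mul_comm]
      congr 1
      rw [LinearMap.comp_apply]
      congr 2
      ext j
      simp [Pi.single_apply, eq_comm]
  obtain ⟨G, hG, hη⟩ := exists_equations_of_smooth hρ hT hpt hsm hinj
  have h𝔯 : (Ideal.span G).comap π ≤ maximalIdeal (MvPowerSeries (Fin N) ℂ) := fun z hz => by
    rw [mem_maximalIdeal_powerSeries]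
    have h1 : Ideal.span G ≤ RingHom.ker ρ := Ideal.span_le.mpr hG
    exact (DFunLike.congr_fun hρπ z).symm.trans (h1 hz)
  have hle : 𝔠 ≤ (Ideal.span G).comap π := fun z hz => by
    rw [Ideal.mem_comap, show π z = 0 from Ideal.Quotient.eq_zero_iff_mem.mpr hz]
    exact zero_mem _
  have := isLocalRing_quotient h𝔯
  obtain ⟨η', h1, h2⟩ := hη (MvPowerSeries (Fin N) ℂ ⧸ (Ideal.span G).comap π)
    (Ideal.Quotient.factorₐ ℂ hle) (Ideal.Quotient.factor_surjective hle) (by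
      ext z
      obtain ⟨z, rfl⟩ := hπ z
      rw [RingHom.mem_ker]
      exact Ideal.Quotient.eq_zero_iff_mem.trans Ideal.mem_comap)
  exact ⟨_, inferInstance, inferInstance, this, inferInstance, isAdicComplete_quotient h𝔯,
    residue_bijective_quotient h𝔯, η', h1, h2⟩

end Cover

/-! ### Deformations over the residue field and over fibre products with the dual numbers -/

section Values
variable {S ι : Type} [CommRing S] [Algebra ℂ S] [IsLocalRing S] [IsDomain S] [Fintype ι]
  [DecidableEq ι] {x : ι → S} {pd : ι → Derivation ℂ S S} {f : S}

theorem maximalIdeal_complex : maximalIdeal ℂ = ⊥ := by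
  ext c
  rw [mem_maximalIdeal, mem_nonunits_iff, isUnit_iff_ne_zero, not_not, Ideal.mem_bot]

theorem fibreMap_injective : Function.Injective (fibreMap ℂ S) := by
  rw [injective_iff_map_eq_zero]
  intro z hz
  rwa [fibreMap_eq_zero_iff, maximalIdeal_complex, Submodule.bot_smul, Submodule.mem_bot] at hz

theorem IsGermFrame.subsingleton_pointArt (h : IsGermFrame x pd f) :
    Subsingleton ((FD (Ideal.span {f})).obj pointArt) := by
  refine ⟨fun y y' => ?_⟩
  obtain ⟨F, hF, hadm, rfl⟩ := h.exists_eq_fdMk y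
  obtain ⟨F', hF', hadm', rfl⟩ := h.exists_eq_fdMk y'
  exact fdMk_congr _ _ _ _ _ (fibreMap_injective (hF.trans hF'.symm))

/-- Over the dual numbers, the gauge group consists of the automorphisms `1 + ε D`. -/
theorem exists_der_of_gauge_dualNumbers {φ : (dualNumbers ⊗[ℂ] S) ≃ₐ[dualNumbers] (dualNumbers ⊗[ℂ] S)}
    (hφ : φ ∈ gaugeGroup dualNumbers S) :
    ∃ D : Derivation ℂ S S, ∀ z, φ z = z + dualPt 0 1 ⊗ₜ D (fibreMap dualNumbers S z) := by
  have hε : ∀ s : S, fibreMap dualNumbers S (dualPt 0 1 ⊗ₜ s) = 0 := fun s => by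
    rw [fibreMap_tmul, residueHom_eq_zero.mpr (dualPt_mem 1), zero_smul]
  have hfib : ∀ (D : Derivation ℂ S S) (z : dualNumbers ⊗[ℂ] S),
      fibreMap dualNumbers S (z + dualPt 0 1 ⊗ₜ D (fibreMap dualNumbers S z)) =
        fibreMap dualNumbers S z := fun D z => by rw [map_add, hε, add_zero]
  induction hφ using Subgroup.closure_induction with
  | mem φ hφ =>
    obtain ⟨θ, hθ, rfl⟩ := hφ
    obtain ⟨D, hD⟩ := isSmallExt_dualNumbers.exists_der_eq (δ := θ) (δ' := 0) fun z => by
      apply fibreMap_injective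
      rw [fibreMap_changeMap, Derivation.zero_apply, map_zero, map_zero]
      exact hθ z
    refine ⟨D, fun z => ?_⟩
    have h1 := expAut_sub_mem (isNilpotent_of_restrictDer_eq_zero hθ) (𝔠 := ⊥) (fun z => by
      rw [hD z, Derivation.zero_apply, zero_add, hD, hε, map_zero, TensorProduct.tmul_zero,
        Derivation.zero_apply, add_zero]
      exact zero_mem _) z
    rw [Submodule.bot_smul, Submodule.mem_bot, sub_eq_zero, hD z, Derivation.zero_apply,
      zero_add] at h1
    exact h1
  | one => exact ⟨0, fun z => by rw [Derivation.zero_apply, TensorProduct.tmul_zero, add_zero]; rfl⟩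
  | mul φ φ' _ _ ih ih' =>
    obtain ⟨D, hD⟩ := ih
    obtain ⟨D', hD'⟩ := ih'
    refine ⟨D + D', fun z => ?_⟩
    rw [AlgEquiv.mul_apply, hD, hD', hfib, Derivation.add_apply, TensorProduct.tmul_add]
    abel
  | inv φ _ ih =>
    obtain ⟨D, hD⟩ := ih
    refine ⟨-D, fun z => ?_⟩
    refine φ.injective ?_
    have h1 : φ (φ⁻¹ z) = z := φ.apply_symm_apply z
    rw [h1, hD, hfib, Derivation.neg_apply, TensorProduct.tmul_neg, add_assoc, neg_add_cancel,
      add_zero]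

/-- The element `ε` of the fibre product of `B` and `ℂ[ε]`. -/
def dualExtEps (B : Art) : dualExt B :=
  (⟨(0, dualPt 0 1), by rw [mem_dualExtSub, map_zero, dualFst_dualPt]⟩ : dualExtSub B)

theorem isSmallExt_dualExtFst (B : Art) :
    IsSmallExt (show dualExt B →ₐ[ℂ] B from dualExtFst B) (dualExtEps B) where
  surjective := fun b => ⟨(⟨(b, dualPt (residueHom B b) 0), (dualFst_dualPt _ _).symm⟩ :
    dualExtSub B), rfl⟩
  ne_zero := fun h => isSmallExt_dualNumbers.ne_zero
    (congrArg (show dualExt B →ₐ[ℂ] dualNumbers from dualExtSnd B) h)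
  map_eq_zero := rfl
  ker := fun b hb => by
    obtain ⟨⟨b, d⟩, hz⟩ := b
    change b = 0 at hb
    subst hb
    obtain ⟨c, hc⟩ := isSmallExt_dualNumbers.ker d
      ((mem_dualExtSub.mp hz).symm.trans (map_zero _))
    refine ⟨c, Subtype.ext (Prod.ext ?_ hc)⟩
    exact (smul_zero c).symm
  socle := fun b hb => by
    have h1 : (show dualExt B →ₐ[ℂ] dualNumbers from dualExtSnd B) b ∈ maximalIdeal dualNumbers := by
      rw [← residueHom_eq_zero, residueHom_comp, residueHom_eq_zero]
      exact hb
    refine Subtype.ext (Prod.ext ?_ ?_)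
    · exact mul_zero _
    · exact mul_dualPt 1 _ h1

/-- The map `FD(B ×_ℂ ℂ[ε]) → FD(B) × FD(ℂ[ε])` is injective: an infinitesimal coordinate change
over the dual numbers can be used over any base. -/
theorem IsGermFrame.injective_dualExt (h : IsGermFrame x pd f) (B : Art)
    (y y' : (FD (Ideal.span {f})).obj (dualExt B))
    (h1 : (FD (Ideal.span {f})).map (dualExtFst B) y = (FD (Ideal.span {f})).map (dualExtFst B) y')
    (h2 : (FD (Ideal.span {f})).map (dualExtSnd B) y = (FD (Ideal.span {f})).map (dualExtSnd B) y') :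
    y = y' := by
  have hκ := isSmallExt_dualExtFst B
  obtain ⟨F, hF, hadm, rfl⟩ := h.exists_eq_fdMk y
  rw [map_fdMk] at h1
  obtain ⟨G, hG, hadm', rfl, hGF⟩ := h.exists_fdMk_of_map_eq _ hκ.surjective _ _ y' h1.symm
  rw [map_fdMk, map_fdMk] at h2
  obtain ⟨g, hg⟩ := hκ.exists_eq_tmul (z := G - F) (by rw [map_sub, hGF, sub_self])
  rw [sub_eq_iff_eq_add'] at hg
  obtain ⟨φ, hφ, u, hu, huF⟩ := h.exists_gauge_of_fdMk_eq _ _ _ _ h2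
  obtain ⟨D, hD⟩ := exists_der_of_gauge_dualNumbers hφ
  have hε := isSmallExt_dualNumbers
  have hu1 : fibreMap dualNumbers S u = 1 := by
    have h3 := congrArg (fibreMap dualNumbers S) huF
    rw [fibreMap_gauge hφ, map_mul, fibreMap_changeMap, fibreMap_changeMap, hG, hF] at h3
    exact (mul_right_cancel₀ h.ne_zero (h3.symm.trans (one_mul f).symm))
  obtain ⟨v, hv⟩ := hε.exists_eq_tmul (z := u - 1) (by
    apply fibreMap_injective
    rw [fibreMap_changeMap, map_sub, map_one, hu1, sub_self, map_zero])
  rw [sub_eq_iff_eq_add'] at hv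
  have hgD : g + D f = v * f := by
    rw [hD, fibreMap_changeMap, hG, hg, map_add, changeMap_tmul, hv, add_mul, one_mul, mul_comm _ (changeMap _ _ F),
      hε.mul_tmul, fibreMap_changeMap, hF, add_assoc, add_right_inj] at huF
    have h4 : (show dualExt B →ₐ[ℂ] dualNumbers from dualExtSnd B) (dualExtEps B) = dualPt 0 1 := rfl
    rw [h4, ← TensorProduct.tmul_add] at huF
    rw [hε.tmul_injective huF, mul_comm]
  obtain ⟨φ', hφ', h5, -⟩ := hκ.exists_gauge_der D
  refine fdMk_eq_of_gauge _ _ _ _ _ hφ' (u := 1 + dualExtEps B ⊗ₜ v) ?_ ?_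
  · refine isUnit_of_fibreMap ?_
    rw [map_add, map_one, fibreMap_tmul, residueHom_eq_zero.mpr hκ.mem_maximalIdeal, zero_smul,
      add_zero]
    exact isUnit_one
  · rw [h5, hG, hg, add_assoc, ← TensorProduct.tmul_add, hgD, add_mul, one_mul, mul_comm _ F,
      hκ.mul_tmul, hF, mul_comm v]

end Values

/-! ### Families with given logarithmic vector fields -/

section Contract
variable {A S : Type} [CommRing A] [Algebra ℂ A] [CommRing S] [Algebra ℂ S]

/-- Evaluation of a linear form on the second factor of a tensor product. -/
def contract (φ : Module.Dual ℂ S) : A ⊗[ℂ] S →ₗ[ℂ] A :=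
  (TensorProduct.rid ℂ A).toLinearMap ∘ₗ φ.lTensor A

theorem contract_tmul (φ : Module.Dual ℂ S) (a : A) (s : S) :
    contract φ (a ⊗ₜ[ℂ] s) = φ s • a := by
  simp [contract]

theorem eq_zero_of_contract_eq_zero {z : A ⊗[ℂ] S}
    (h : ∀ φ : Module.Dual ℂ S, contract φ z = 0) : z = 0 := by
  classical
  let b := Module.Basis.ofVectorSpace ℂ S
  refine (TensorProduct.equivFinsuppOfBasisRight (M := A) b).injective ?_
  rw [map_zero]
  ext i
  have key : ∀ z : A ⊗[ℂ] S, TensorProduct.equivFinsuppOfBasisRight b z i = contract (b.coord i) z := by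
    intro z
    induction z using TensorProduct.induction_on with
    | zero => simp
    | add x y hx hy => rw [map_add, map_add, Finsupp.add_apply, hx, hy]
    | tmul a s => simp [contract_tmul]
  rw [key, h]
  rfl

end Contract

/-- A deformation is admissible if generators of the module of logarithmic vector fields of the
central fibre extend. -/
theorem isAdmissible_of_generators {A : Art} {S : Type} [CommRing S] [Algebra ℂ S] [IsDomain S] {f : S} (hf : f ≠ 0) {F : A ⊗[ℂ] S}
    (hF : fibreMap A S F = f) {G : Set (Derivation ℂ S S)}
    (hG : logDer ℂ S (Ideal.span {f}) = Submodule.span S G)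
    (h : ∀ d ∈ G, ∃ δ : Derivation A (A ⊗[ℂ] S) (A ⊗[ℂ] S), δ F ∈ Ideal.span {F} ∧
      ∀ s, fibreMap A S (δ (1 ⊗ₜ s)) = d s) : IsAdmissible (Ideal.span {F}) := by
  have hflat := flat_quotient_span hf hF
  have key : ∀ d ∈ Submodule.span S G, ∃ δ : Derivation A (A ⊗[ℂ] S) (A ⊗[ℂ] S),
      δ F ∈ Ideal.span {F} ∧ ∀ s, fibreMap A S (δ (1 ⊗ₜ s)) = d s := by
    intro d hd
    refine Submodule.span_induction (p := fun d _ => ∃ δ : Derivation A (A ⊗[ℂ] S) (A ⊗[ℂ] S),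
      δ F ∈ Ideal.span {F} ∧ ∀ s, fibreMap A S (δ (1 ⊗ₜ s)) = d s) h ?_ ?_ ?_ hd
    · exact ⟨0, zero_mem _, fun s => map_zero _⟩
    · rintro d d' - - ⟨δ, hδ, h1⟩ ⟨δ', hδ', h1'⟩
      refine ⟨δ + δ', add_mem hδ hδ', fun s => ?_⟩
      rw [Derivation.add_apply, Derivation.add_apply, map_add, h1, h1']
    · rintro a d - ⟨δ, hδ, h1⟩
      refine ⟨((1 : A) ⊗ₜ[ℂ] a) • δ, Ideal.mul_mem_left _ _ hδ, fun s => ?_⟩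
      rw [Derivation.smul_apply, Derivation.smul_apply, smul_eq_mul, smul_eq_mul, map_mul, h1,
        fibreMap_tmul, map_one, one_smul]
  refine isAdmissible_of_surjective (Submodule.fg_span_singleton F) fun d hd => ?_
  rw [map_fibreMap_span hF, hG] at hd
  obtain ⟨δ, hδ, h1⟩ := key d hd
  exact ⟨δ, mem_logDer_span.mpr hδ, Derivation.ext h1⟩

/-- Generators `δ_i` of the module of logarithmic vector fields of `f`, with `δ_i f = α_i f`, together
with finitely many simultaneous infinitesimal variations of `f`, the `δ_i` and the `α_i`. -/
structure LogFamily {S : Type} [CommRing S] [Algebra ℂ S] (f : S) (J : Type) (N : ℕ) where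
  der : J → Derivation ℂ S S
  mult : J → S
  eqnVar : Fin N → S
  derVar : Fin N → J → Derivation ℂ S S
  multVar : Fin N → J → S
  der_apply : ∀ i, der i f = mult i * f
  span : logDer ℂ S (Ideal.span {f}) = Submodule.span S (Set.range der)

namespace LogFamily
variable {S : Type} [CommRing S] [Algebra ℂ S] {f : S} {J : Type} {N : ℕ} (Φ : LogFamily f J N)

section Ring
variable {A : Type} [CommRing A] [Algebra ℂ A] (t : Fin N → A)

/-- The deformation of `f` with parameters `t`. -/
def eqnAt : A ⊗[ℂ] S := 1 ⊗ₜ f + ∑ l, t l ⊗ₜ Φ.eqnVar l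

/-- The deformation of the vector field `δ_i` with parameters `t`. -/
def derAt (i : J) : Derivation A (A ⊗[ℂ] S) (A ⊗[ℂ] S) :=
  extendDer A (Φ.der i) + ∑ l, t l • extendDer A (Φ.derVar l i)

/-- The deformation of the factor `α_i` with parameters `t`. -/
def multAt (i : J) : A ⊗[ℂ] S := 1 ⊗ₜ Φ.mult i + ∑ l, t l ⊗ₜ Φ.multVar l i

/-- The obstruction for the deformed vector field to be logarithmic along the deformed divisor. -/
def defect (i : J) : A ⊗[ℂ] S := Φ.derAt t i (Φ.eqnAt t) - Φ.multAt t i * Φ.eqnAt t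

/-- The linear terms of the obstruction. -/
def linTerm (i : J) (l : Fin N) : S :=
  Φ.der i (Φ.eqnVar l) + Φ.derVar l i f - Φ.mult i * Φ.eqnVar l - Φ.multVar l i * f

/-- The quadratic terms of the obstruction. -/
def quadTerm (i : J) (l m : Fin N) : S :=
  Φ.derVar l i (Φ.eqnVar m) - Φ.multVar l i * Φ.eqnVar m

theorem derAt_tmul (i : J) (a : A) (s : S) :
    Φ.derAt t i (a ⊗ₜ s) = a ⊗ₜ Φ.der i s + ∑ l, (t l * a) ⊗ₜ Φ.derVar l i s := by
  have h : ∀ d : Derivation ℂ S S, extendDer A d (a ⊗ₜ s) = a ⊗ₜ d s := fun d => rfl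
  rw [derAt, Derivation.add_apply, der_sum_apply, h]
  rfl

theorem defect_eq (i : J) : Φ.defect t i =
    ∑ l, t l ⊗ₜ Φ.linTerm i l + ∑ l, ∑ m, (t l * t m) ⊗ₜ Φ.quadTerm i l m := by
  have h1 : Φ.derAt t i (Φ.eqnAt t) = 1 ⊗ₜ Φ.der i f + ∑ l, t l ⊗ₜ Φ.derVar l i f +
      (∑ l, t l ⊗ₜ Φ.der i (Φ.eqnVar l) +
        ∑ l, ∑ m, (t l * t m) ⊗ₜ Φ.derVar l i (Φ.eqnVar m)) := by
    rw [eqnAt, map_add, map_sum, derAt_tmul]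
    simp only [derAt_tmul, mul_one]
    rw [Finset.sum_add_distrib, Finset.sum_comm]
  have h2 : Φ.multAt t i * Φ.eqnAt t = 1 ⊗ₜ Φ.der i f + ∑ l, t l ⊗ₜ (Φ.multVar l i * f) +
      (∑ l, t l ⊗ₜ (Φ.mult i * Φ.eqnVar l) +
        ∑ l, ∑ m, (t l * t m) ⊗ₜ (Φ.multVar l i * Φ.eqnVar m)) := by
    rw [eqnAt, multAt, add_mul, mul_add, mul_add, Finset.mul_sum, Finset.sum_mul,
      Finset.sum_mul_sum]
    simp only [Algebra.TensorProduct.tmul_mul_tmul, mul_one, one_mul]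
    rw [der_apply]
    abel
  rw [defect, h1, h2]
  simp only [linTerm, quadTerm, TensorProduct.tmul_sub, TensorProduct.tmul_add,
    Finset.sum_sub_distrib, Finset.sum_add_distrib]
  abel

theorem contract_defect (φ : Module.Dual ℂ S) (i : J) : contract φ (Φ.defect t i) =
    ∑ l, φ (Φ.linTerm i l) • t l + ∑ l, ∑ m, φ (Φ.quadTerm i l m) • (t l * t m) := by
  rw [defect_eq, map_add, map_sum, map_sum]
  simp only [map_sum, contract_tmul]

end Ring

open MvPowerSeries in
/-- The equations on the parameters under which the deformed vector fields are logarithmic. -/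
def quadric (i : J) (φ : Module.Dual ℂ S) : MvPowerSeries (Fin N) ℂ :=
  ∑ l, φ (Φ.linTerm i l) • X l + ∑ l, ∑ m, φ (Φ.quadTerm i l m) • (X l * X m)

/-- The ideal of the parameters for which the deformed vector fields are logarithmic. -/
def paramIdeal : Ideal (MvPowerSeries (Fin N) ℂ) :=
  Ideal.span (Set.range fun p : J × Module.Dual ℂ S => Φ.quadric p.1 p.2)

theorem map_quadric {A : Type} [CommRing A] [Algebra ℂ A] (u : MvPowerSeries (Fin N) ℂ →ₐ[ℂ] A)
    (i : J) (φ : Module.Dual ℂ S) : u (Φ.quadric i φ) =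
      contract φ (Φ.defect (fun l => u (MvPowerSeries.X l)) i) := by
  rw [contract_defect, quadric, map_add, map_sum, map_sum]
  simp only [map_sum, map_smul, map_mul]

theorem paramIdeal_le : Φ.paramIdeal ≤ maximalIdeal (MvPowerSeries (Fin N) ℂ) := by
  refine Ideal.span_le.mpr ?_
  rintro _ ⟨⟨i, φ⟩, rfl⟩
  have hX : ∀ l, (MvPowerSeries.X l : MvPowerSeries (Fin N) ℂ) ∈ maximalIdeal _ := fun l => by
    rw [mem_maximalIdeal_powerSeries, MvPowerSeries.constantCoeff_X]
  have hs : ∀ (c : ℂ) {z : MvPowerSeries (Fin N) ℂ}, z ∈ maximalIdeal (MvPowerSeries (Fin N) ℂ) →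
      c • z ∈ maximalIdeal (MvPowerSeries (Fin N) ℂ) := fun c z hz => by
    rw [Algebra.smul_def]; exact Ideal.mul_mem_left _ _ hz
  exact add_mem (sum_mem fun l _ => hs _ (hX l)) (sum_mem fun l _ => sum_mem fun m _ =>
    hs _ (Ideal.mul_mem_left _ _ (hX m)))

/-- Homomorphisms from the parameter ring are solutions of the equations. -/
theorem defect_eq_zero {A : Type} [CommRing A] [Algebra ℂ A]
    (u : (MvPowerSeries (Fin N) ℂ ⧸ Φ.paramIdeal) →ₐ[ℂ] A) (i : J) :
    Φ.defect (fun l => u (Ideal.Quotient.mk _ (MvPowerSeries.X l))) i = 0 := by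
  refine eq_zero_of_contract_eq_zero fun φ => ?_
  refine (Φ.map_quadric (u.comp (Ideal.Quotient.mkₐ ℂ _)) i φ).symm.trans ?_
  have h1 : Φ.quadric i φ ∈ Φ.paramIdeal := Ideal.subset_span ⟨(i, φ), rfl⟩
  rw [AlgHom.comp_apply, Ideal.Quotient.mkₐ_eq_mk, Ideal.Quotient.eq_zero_iff_mem.mpr h1, map_zero]

section Art
variable {A B : Type} [CommRing A] [Algebra ℂ A] [IsLocalRing A] [Module.Finite ℂ A]
  [CommRing B] [Algebra ℂ B] [IsLocalRing B] [Module.Finite ℂ B]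

/-- Solutions of the equations give homomorphisms from the parameter ring. -/
theorem exists_hom (t : Fin N → A) (ht : ∀ l, t l ∈ maximalIdeal A) (h : ∀ i, Φ.defect t i = 0) :
    ∃ u : (MvPowerSeries (Fin N) ℂ ⧸ Φ.paramIdeal) →ₐ[ℂ] A,
      ∀ l, u (Ideal.Quotient.mk _ (MvPowerSeries.X l)) = t l := by
  obtain ⟨u, hu⟩ := exists_powerSeries_hom t ht
  refine ⟨Ideal.Quotient.liftₐ _ u fun z hz => ?_, hu⟩
  have h1 : Φ.paramIdeal ≤ RingHom.ker u := by
    refine Ideal.span_le.mpr ?_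
    rintro _ ⟨⟨i, φ⟩, rfl⟩
    change u (Φ.quadric i φ) = 0
    rw [map_quadric, funext hu, h, map_zero]
  exact h1 hz

theorem hom_ext {u v : (MvPowerSeries (Fin N) ℂ ⧸ Φ.paramIdeal) →ₐ[ℂ] A}
    (h : ∀ l, u (Ideal.Quotient.mk _ (MvPowerSeries.X l)) =
      v (Ideal.Quotient.mk _ (MvPowerSeries.X l))) : u = v := by
  have h1 := powerSeries_hom_ext (u := u.comp (Ideal.Quotient.mkₐ ℂ _))
    (v := v.comp (Ideal.Quotient.mkₐ ℂ _)) h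
  refine AlgHom.ext fun z => ?_
  obtain ⟨z, rfl⟩ := Ideal.Quotient.mk_surjective z
  exact DFunLike.congr_fun h1 z

theorem map_mk_X_mem (u : (MvPowerSeries (Fin N) ℂ ⧸ Φ.paramIdeal) →ₐ[ℂ] A) (l : Fin N) :
    u (Ideal.Quotient.mk _ (MvPowerSeries.X l)) ∈ maximalIdeal A :=
  map_X_mem (u.comp (Ideal.Quotient.mkₐ ℂ _)) l

theorem fibreMap_sum_tmul (t : Fin N → A) (ht : ∀ l, t l ∈ maximalIdeal A) (s : Fin N → S) :
    fibreMap A S (∑ l, t l ⊗ₜ s l) = 0 := by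
  rw [map_sum]
  refine Finset.sum_eq_zero fun l _ => ?_
  rw [fibreMap_tmul, residueHom_eq_zero.mpr (ht l), zero_smul]

theorem fibreMap_eqnAt (t : Fin N → A) (ht : ∀ l, t l ∈ maximalIdeal A) :
    fibreMap A S (Φ.eqnAt t) = f := by
  rw [eqnAt, map_add, fibreMap_sum_tmul t ht, fibreMap_tmul, map_one, one_smul, add_zero]

theorem fibreMap_derAt (t : Fin N → A) (ht : ∀ l, t l ∈ maximalIdeal A) (i : J) (s : S) :
    fibreMap A S (Φ.derAt t i (1 ⊗ₜ s)) = Φ.der i s := by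
  rw [derAt_tmul, map_add, fibreMap_sum_tmul _ (fun l => Ideal.mul_mem_right _ _ (ht l)),
    fibreMap_tmul, map_one, one_smul, add_zero]

theorem fibreMap_multAt (t : Fin N → A) (ht : ∀ l, t l ∈ maximalIdeal A) (i : J) :
    fibreMap A S (Φ.multAt t i) = Φ.mult i := by
  rw [multAt, map_add, fibreMap_sum_tmul t ht, fibreMap_tmul, map_one, one_smul, add_zero]

theorem changeMap_eqnAt (g : B →ₐ[ℂ] A) (t : Fin N → B) :
    changeMap S g (Φ.eqnAt t) = Φ.eqnAt fun l => g (t l) := by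
  rw [eqnAt, eqnAt, map_add, map_sum, changeMap_tmul, map_one]
  simp only [changeMap_tmul]

theorem changeMap_derAt (g : B →ₐ[ℂ] A) (t : Fin N → B) (i : J) (z : B ⊗[ℂ] S) :
    changeMap S g (Φ.derAt t i z) = Φ.derAt (fun l => g (t l)) i (changeMap S g z) := by
  induction z using TensorProduct.induction_on with
  | zero => simp only [map_zero]
  | add x y hx hy => simp only [map_add, hx, hy]
  | tmul b s =>
    rw [derAt_tmul, changeMap_tmul, derAt_tmul, map_add, map_sum, changeMap_tmul]
    simp only [changeMap_tmul, map_mul]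

theorem changeMap_multAt (g : B →ₐ[ℂ] A) (t : Fin N → B) (i : J) :
    changeMap S g (Φ.multAt t i) = Φ.multAt (fun l => g (t l)) i := by
  rw [multAt, multAt, map_add, map_sum, changeMap_tmul, map_one]
  simp only [changeMap_tmul]

/-- If the deformed vector fields are logarithmic, the deformation is admissible, since they restrict
to generators of the module of logarithmic vector fields of the central fibre. -/
theorem isAdmissible_eqnAt [IsDomain S] {A : Art} (hf : f ≠ 0) (t : Fin N → A)
    (ht : ∀ l, t l ∈ maximalIdeal A) (h : ∀ i, Φ.defect t i = 0) :
    IsAdmissible (Ideal.span {Φ.eqnAt t}) := by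
  refine isAdmissible_of_generators hf (Φ.fibreMap_eqnAt t ht) Φ.span ?_
  rintro _ ⟨i, rfl⟩
  refine ⟨Φ.derAt t i, ?_, fun s => Φ.fibreMap_derAt t ht i s⟩
  rw [sub_eq_zero.mp (h i)]
  exact Ideal.mul_mem_left _ _ (Ideal.mem_span_singleton_self _)

end Art

variable [IsDomain S]

/-- The family of deformations over the parameter ring, as a natural transformation. -/
def toFD (hf : f ≠ 0) :
    homFunctor (MvPowerSeries (Fin N) ℂ ⧸ Φ.paramIdeal) ⟶ FD (Ideal.span {f}) where
  app A := ↾(fun u : (MvPowerSeries (Fin N) ℂ ⧸ Φ.paramIdeal) →ₐ[ℂ] A =>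
    fdMk hf (Φ.eqnAt fun l => u (Ideal.Quotient.mk _ (MvPowerSeries.X l)))
      (Φ.fibreMap_eqnAt _ (Φ.map_mk_X_mem u))
      (Φ.isAdmissible_eqnAt hf _ (Φ.map_mk_X_mem u) (Φ.defect_eq_zero u)))
  naturality A B g := by
    ext u
    exact ((map_fdMk hf _ _ g).trans (fdMk_congr _ _ _ _ _ (Φ.changeMap_eqnAt _ _))).symm

theorem natApp_toFD (hf : f ≠ 0) {A : Art}
    (u : (MvPowerSeries (Fin N) ℂ ⧸ Φ.paramIdeal) →ₐ[ℂ] A) :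
    natApp (Φ.toFD hf) u = fdMk hf (Φ.eqnAt fun l => u (Ideal.Quotient.mk _ (MvPowerSeries.X l)))
      (Φ.fibreMap_eqnAt _ (Φ.map_mk_X_mem u))
      (Φ.isAdmissible_eqnAt hf _ (Φ.map_mk_X_mem u) (Φ.defect_eq_zero u)) := rfl

/-- If every admissible deformation over a small extension that extends a member of the family can be
brought into the form prescribed by the family, then there is a hull. -/
theorem hasHull {ι : Type} [IsLocalRing S] [Fintype ι] [DecidableEq ι] {x : ι → S}
    {pd : ι → Derivation ℂ S S} (h : IsGermFrame x pd f)
    (H : ∀ (B A : Art) (g : B →ₐ[ℂ] A) (κ : B), IsSmallExt g κ → ∀ t : Fin N → B,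
      (∀ l, t l ∈ maximalIdeal B) → (∀ i, Φ.defect (fun l => g (t l)) i = 0) →
      ∀ G : B ⊗[ℂ] S, fibreMap B S G = f → IsAdmissible (Ideal.span {G}) →
      changeMap S g G = changeMap S g (Φ.eqnAt t) →
      ∃ c : Fin N → ℂ, (∀ i, Φ.defect (fun l => t l + c l • κ) i = 0) ∧
        ∃ φ ∈ gaugeGroup B S, ∃ u, IsUnit u ∧ φ G = u * Φ.eqnAt fun l => t l + c l • κ) :
    HasHull (FD (Ideal.span {f})) := by
  refine hasHull_of_cover Φ.paramIdeal_le (Φ.toFD h.ne_zero) h.subsingleton_pointArt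
    (fun B A p κ hκ a y hay => ?_) h.injective_dualExt
  let g : B →ₐ[ℂ] A := p
  rw [natApp_toFD] at hay
  obtain ⟨G, hG, hadm, rfl, hGF⟩ := h.exists_fdMk_of_map_eq p hκ.surjective _ _ y hay.symm
  choose t ht using fun l => hκ.surjective (a (Ideal.Quotient.mk _ (MvPowerSeries.X l)))
  have htm : ∀ l, t l ∈ maximalIdeal B := fun l => by
    rw [← residueHom_eq_zero, ← residueHom_comp g, residueHom_eq_zero]
    change (show B →ₐ[ℂ] A from p) (t l) ∈ _
    rw [ht]
    exact Φ.map_mk_X_mem a l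
  have hta : (fun l => g (t l)) = fun l => a (Ideal.Quotient.mk _ (MvPowerSeries.X l)) := funext ht
  obtain ⟨c, hc, φ, hφ, u, hu, huF⟩ := H B A g κ hκ t htm
    (by rw [hta]; exact Φ.defect_eq_zero a) G hG hadm (by rw [changeMap_eqnAt, hta]; exact hGF)
  have htm' : ∀ l, t l + c l • κ ∈ maximalIdeal B := fun l => by
    rw [← residueHom_eq_zero, map_add, map_smul, residueHom_eq_zero.mpr (htm l),
      residueHom_eq_zero.mpr hκ.mem_maximalIdeal, smul_zero, add_zero]
  obtain ⟨v, hv⟩ := Φ.exists_hom _ htm' hc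
  refine ⟨v, Φ.hom_ext fun l => ?_, ?_⟩
  · rw [AlgHom.comp_apply, hv, map_add, map_smul, hκ.map_eq_zero, smul_zero, add_zero, ht]
  · rw [natApp_toFD]
    exact fdMk_eq_of_gauge _ _ _ _ _ hφ hu (huF.trans (by rw [funext hv]))

end LogFamily

/-! ### Logarithmic vector fields of a weighted homogeneous free divisor -/

theorem sub_mem_logDer {R T : Type} [CommRing R] [CommRing T] [Algebra R T] {I : Ideal T}
    {δ δ' : Derivation R T T} (h : δ ∈ logDer R T I) (h' : δ' ∈ logDer R T I) :
    δ - δ' ∈ logDer R T I := fun g hg => I.sub_mem (h g hg) (h' g hg)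

/-- Nakayama's lemma for a set of elements that generate approximately. -/
theorem exists_finset_span_eq {R M : Type} [CommRing R] [IsLocalRing R] [AddCommGroup M] [Module R M]
    {L : Submodule R M} (hL : L.FG) {H : Set M} (hHL : H ⊆ L)
    (h : ∀ d ∈ L, ∃ s ∈ Submodule.span R H, d - s ∈ maximalIdeal R • L) :
    ∃ T : Finset M, ↑T ⊆ H ∧ L = Submodule.span R (T : Set M) := by
  have heq : L = Submodule.span R H := by
    refine le_antisymm (Submodule.le_of_le_smul_of_le_jacobson_bot hL (maximalIdeal_le_jacobson _)
      fun d hd => ?_) (Submodule.span_le.mpr hHL)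
    obtain ⟨s, hs, hds⟩ := h d hd
    rw [← sub_add_cancel d s]
    exact add_mem (Submodule.mem_sup_right hds) (Submodule.mem_sup_left hs)
  obtain ⟨T, hTH, hT⟩ := (Submodule.fg_span_iff_fg_span_finset_subset H).mp (heq ▸ hL)
  exact ⟨T, hTH, heq.trans hT⟩

section Generators
variable {n : ℕ} {w : Fin n → ℕ} {f : O n} {k : ℕ}

theorem eq_zero_of_forall_mem_wFilt {z : O n} (h : ∀ k, z ∈ wFilt w k) : z = 0 := by
  refine Subtype.ext (MvPowerSeries.ext fun m => ?_)
  exact mem_wFilt.mp (h (Finsupp.weight w m + 1)) m (Nat.lt_succ_self _)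

/-- The ring of germs of holomorphic functions has the properties required for the deformation
theory of a weighted homogeneous hypersurface. -/
theorem isGermFrame_coord (hw : ∀ i, 0 < w i) (hf : f ∈ wHom w k) (hf0 : f ≠ 0)
    (hmem : f ∈ maximalIdeal (O n)) : IsGermFrame coord pd f where
  hadamard := fun s => ⟨_, exists_eq_add_sum_coord s⟩
  der := pd_coord
  subst := fun y hy => ⟨substHom y fun i => mem_maximalIdeal_iff_evalZero.mp (hy i),
    fun i => substHom_coord y _ i⟩
  span := maximalIdeal_eq_span_coord
  ne_zero := hf0
  mem := hmem
  separated := fun _ hz => eq_zero_of_forall_mem_wFilt fun k => maximalIdeal_pow_le_wFilt hw k (hz k)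
  separated_quotient := fun _ hz => mem_span_of_forall_mem_sup hw hf hf0 hz

/-- A vector field is weighted homogeneous of degree `l` if it raises weights by `l`. -/
def IsDerHom (w : Fin n → ℕ) (l : ℤ) (d : Derivation ℂ (O n) (O n)) : Prop :=
  ∀ j, d (coord j) ∈ wHom w (l + w j)

theorem IsGermFrame.apply_eq_sum (h : IsGermFrame coord pd f) (d : Derivation ℂ (O n) (O n))
    (s : O n) : d s = ∑ j, d (coord j) * pd j s := by
  conv_lhs => rw [h.der_eq_sum d, der_sum_apply]
  rfl

theorem IsDerHom.apply_mem (h : IsGermFrame coord pd f) {l : ℤ} {d : Derivation ℂ (O n) (O n)}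
    (hd : IsDerHom w l d) {e : ℤ} {s : O n} (hs : s ∈ wHom w e) : d s ∈ wHom w (e + l) := by
  rw [h.apply_eq_sum d]
  refine sum_mem fun j _ => ?_
  have := mul_mem_wHom (hd j) (pd_mem_wHom hs j)
  rwa [show l + (w j : ℤ) + (e - w j) = e + l by ring] at this

variable (w) in
/-- The weighted homogeneous component of degree `l` of a vector field. -/
def derPart (l : ℤ) (d : Derivation ℂ (O n) (O n)) : Derivation ℂ (O n) (O n) :=
  ∑ j, wpart w {l + w j} (d (coord j)) • pd j

theorem derPart_coord (h : IsGermFrame coord pd f) (l : ℤ) (d : Derivation ℂ (O n) (O n)) (j : Fin n) :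
    derPart w l d (coord j) = wpart w {l + w j} (d (coord j)) :=
  h.sum_pd_apply (fun j => wpart w {l + w j} (d (coord j))) j

theorem isDerHom_derPart (h : IsGermFrame coord pd f) (l : ℤ) (d : Derivation ℂ (O n) (O n)) :
    IsDerHom w l (derPart w l d) := fun j => by
  rw [derPart_coord h]
  exact wpart_mem_wHom _ _

theorem derPart_apply (l : ℤ) (d : Derivation ℂ (O n) (O n))
    (h : IsGermFrame coord pd f) {e : ℤ} {s : O n} (hs : s ∈ wHom w e) :
    derPart w l d s = wpart w {e + l} (d s) := by
  rw [h.apply_eq_sum, h.apply_eq_sum d, map_sum]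
  refine Finset.sum_congr rfl fun j _ => ?_
  have := wpart_mul_singleton (e := l + w j) (pd_mem_wHom hs j) (d (coord j))
  rw [derPart_coord h, mul_comm, mul_comm (d (coord j)), ← this,
    show e - (w j : ℤ) + (l + w j) = e + l by ring]

theorem derPart_mem_logDer (h : IsGermFrame coord pd f) (hf : f ∈ wHom w k) (l : ℤ)
    {d : Derivation ℂ (O n) (O n)} (hd : d ∈ logDer ℂ (O n) (Ideal.span {f})) :
    derPart w l d ∈ logDer ℂ (O n) (Ideal.span {f}) := by
  rw [mem_logDer_span] at hd ⊢
  obtain ⟨a, ha⟩ := Ideal.mem_span_singleton.mp hd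
  rw [derPart_apply l d h hf, ha, wpart_mul_singleton hf]
  exact Ideal.mul_mem_right _ _ (Ideal.mem_span_singleton_self _)

/-- A weighted homogeneous logarithmic vector field multiplies the equation by a weighted homogeneous
germ. -/
theorem IsDerHom.exists_mult (h : IsGermFrame coord pd f) (hf : f ∈ wHom w k) {l : ℤ}
    {d : Derivation ℂ (O n) (O n)} (hd : IsDerHom w l d)
    (hlog : d ∈ logDer ℂ (O n) (Ideal.span {f})) : ∃ a ∈ wHom w l, d f = a * f := by
  obtain ⟨a, ha⟩ := Ideal.mem_span_singleton.mp (mem_logDer_span.mp hlog)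
  refine ⟨wpart w {l} a, wpart_mem_wHom _ _, ?_⟩
  rw [mul_comm, ← wpart_mul_singleton hf, ← ha, wpart_singleton_of_mem (hd.apply_mem h hf)]

/-- The homogeneous components of a vector field approximate it. -/
theorem sub_sum_derPart_mem (h : IsGermFrame coord pd f) (E : ℕ) (d : Derivation ℂ (O n) (O n))
    (j : Fin n) :
    (d - ∑ l ∈ Finset.Ico (-∑ i, (w i : ℤ)) E, derPart w l d) (coord j) ∈ wFilt w E := by
  classical
  rw [mem_wFilt]
  intro m hm
  have h1 : (w j : ℤ) ≤ ∑ i, (w i : ℤ) :=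
    Finset.single_le_sum (f := fun i => (w i : ℤ)) (fun i _ => Int.natCast_nonneg _)
      (Finset.mem_univ j)
  rw [Derivation.sub_apply, der_sum_apply]
  simp only [derPart_coord h]
  have hsum : ∀ (s : Finset ℤ) (F : ℤ → O n), (∑ l ∈ s, F l : O n).1 = ∑ l ∈ s, (F l).1 :=
    fun s F => map_sum (convergentSeries n).val F s
  change MvPowerSeries.coeff m ((d (coord j)).1 - (∑ l ∈ _, _ : O n).1) = 0
  rw [hsum, map_sub, map_sum, sub_eq_zero]
  have h2 : ((Finsupp.weight w m : ℕ) : ℤ) - w j ∈ Finset.Ico (-∑ i, (w i : ℤ)) (E : ℤ) := by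
    rw [Finset.mem_Ico]
    have h3 : (Finsupp.weight w m : ℤ) < E := by exact_mod_cast hm
    omega
  rw [Finset.sum_eq_single_of_mem _ h2]
  · rw [coeff_wpart, if_pos]
    rw [Set.mem_singleton_iff]; ring
  · intro l _ hl
    rw [coeff_wpart, if_neg]
    rw [Set.mem_singleton_iff]
    intro h4
    exact hl (by rw [h4]; ring)

section Free
variable {L : Submodule (O n) (Derivation ℂ (O n) (O n))} (hL : ∀ j, f • pd j ∈ L)

/-- `f` times any vector field is a combination of the vector fields `f ∂_j`. -/
theorem mul_repr_eq_sum (h : IsGermFrame coord pd f) {I : Type} (b : Module.Basis I (O n) L) (d : L)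
    (i : I) : f * b.repr d i = ∑ j, d.1 (coord j) * b.repr ⟨f • pd j, hL j⟩ i := by
  have he : f • d = ∑ j, d.1 (coord j) • (⟨f • pd j, hL j⟩ : L) := by
    refine Subtype.ext ?_
    have h1 : (∑ j, d.1 (coord j) • (⟨f • pd j, hL j⟩ : L) : L).1 =
        ∑ j, d.1 (coord j) • (f • pd j) := by
      rw [Submodule.coe_sum]; rfl
    rw [h1, Submodule.coe_smul]
    conv_lhs => rw [h.der_eq_sum d.1, Finset.smul_sum]
    exact Finset.sum_congr rfl fun j _ => smul_comm _ _ _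
  have h2 : b.repr (f • d) i = f * b.repr d i := by
    rw [map_smul, Finsupp.smul_apply, smul_eq_mul]
  rw [← h2, he, map_sum, Finsupp.finsetSum_apply]
  refine Finset.sum_congr rfl fun j _ => ?_
  rw [map_smul, Finsupp.smul_apply, smul_eq_mul]

include hL in
theorem finite_of_free (h : IsGermFrame coord pd f) {I : Type} (b : Module.Basis I (O n) L) :
    Finite I := by
  classical
  refine Set.finite_univ_iff.mp (((Finset.univ.biUnion fun j =>
    (b.repr ⟨f • pd j, hL j⟩).support).finite_toSet).subset fun i _ => ?_)
  rw [Finset.mem_coe, Finset.mem_biUnion]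
  by_contra! hc
  have h1 := mul_repr_eq_sum hL h b (b i) i
  rw [b.repr_self, Finsupp.single_eq_same, mul_one, Finset.sum_eq_zero] at h1
  · exact h.ne_zero h1
  · intro j _
    rw [Finsupp.notMem_support_iff.mp (hc j (Finset.mem_univ j)), mul_zero]

include hL in
/-- Coefficients of large weight only occur in `𝔪 L`: otherwise `f` would have only monomials of
weight larger than its own. -/
theorem mem_smul_of_mem_wFilt (h : IsGermFrame coord pd f) (hf : f ∈ wHom w k) {I : Type}
    [Fintype I] (b : Module.Basis I (O n) L) {d : Derivation ℂ (O n) (O n)} (hd : d ∈ L)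
    (hdw : ∀ j, d (coord j) ∈ wFilt w (k + 1)) : d ∈ maximalIdeal (O n) • L := by
  have hmem : ∀ i, b.repr ⟨d, hd⟩ i ∈ maximalIdeal (O n) := fun i => by
    by_contra hc
    rw [mem_maximalIdeal, mem_nonunits_iff, not_not] at hc
    have h1 : f ∈ wFilt w (k + 1) := by
      rw [← Ideal.mul_unit_mem_iff_mem _ hc, mul_repr_eq_sum hL h]
      exact sum_mem fun j _ => Ideal.mul_mem_right _ _ (hdw j)
    refine h.ne_zero (Subtype.ext (MvPowerSeries.ext fun m => ?_))
    by_contra h2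
    have h3 : (Finsupp.weight w m : ℤ) = k := hf m h2
    exact h2 (mem_wFilt.mp h1 m (by omega))
  have h2 := congrArg Subtype.val (b.sum_repr ⟨d, hd⟩)
  rw [Submodule.coe_sum] at h2
  change _ = d at h2
  rw [← h2]
  exact sum_mem fun i _ => Submodule.smul_mem_smul (hmem i) (b i).2

end Free

/-- The module of logarithmic vector fields of a weighted homogeneous free divisor is generated by
finitely many weighted homogeneous vector fields. -/
theorem exists_homogeneous_generators (h : IsGermFrame coord pd f) (hf : f ∈ wHom w k)
    [Module.Free (O n) (logDer ℂ (O n) (Ideal.span {f}))] :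
    ∃ (J : Type) (_ : Fintype J) (δ : J → Derivation ℂ (O n) (O n)) (l : J → ℤ),
      (∀ i, IsDerHom w (l i) (δ i)) ∧
        logDer ℂ (O n) (Ideal.span {f}) = Submodule.span (O n) (Set.range δ) := by
  have hpd : ∀ j, f • pd j ∈ logDer ℂ (O n) (Ideal.span {f}) := fun j => by
    rw [mem_logDer_span]
    exact Ideal.mul_mem_right _ _ (Ideal.mem_span_singleton_self f)
  let b := Module.Free.chooseBasis (O n) (logDer ℂ (O n) (Ideal.span {f}))
  have hfin := finite_of_free hpd h b
  have := Fintype.ofFinite (Module.Free.ChooseBasisIndex (O n) (logDer ℂ (O n) (Ideal.span {f})))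
  have hfg : (logDer ℂ (O n) (Ideal.span {f})).FG := Module.Finite.iff_fg.mp (Module.Finite.of_basis b)
  obtain ⟨T, hTH, hT⟩ := exists_finset_span_eq hfg
    (H := {d | d ∈ logDer ℂ (O n) (Ideal.span {f}) ∧ ∃ l, IsDerHom w l d}) (fun d hd => hd.1)
    fun d hd => by
      refine ⟨∑ l ∈ Finset.Ico (-∑ i, (w i : ℤ)) ((k + 1 : ℕ) : ℤ), derPart w l d, ?_, ?_⟩
      · exact Submodule.sum_mem _ fun l _ => Submodule.subset_span
          ⟨derPart_mem_logDer h hf l hd, l, isDerHom_derPart h l d⟩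
      · refine mem_smul_of_mem_wFilt hpd h hf b (sub_mem_logDer hd ?_)
          (sub_sum_derPart_mem h (k + 1) d)
        exact Submodule.sum_mem _ fun l _ => derPart_mem_logDer h hf l hd
  choose l hl using fun d : T => (hTH d.2).2
  refine ⟨T, inferInstance, fun d => d.1, l, hl, ?_⟩
  rw [hT]
  congr 1
  exact Subtype.range_coe.symm

end Generators

/-! ### Normal forms over small extensions -/

section Compare
variable {S : Type} [CommRing S] [Algebra ℂ S] [IsDomain S] {f : S} {A B : Art} {g : B →ₐ[ℂ] A}
  {κ : B}

/-- If `F + κ g₀` is admissible and the vector field `δ` is logarithmic along `F` over the smaller base,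
with factor `a`, then a first order correction `d` of `δ` is logarithmic along `F + κ g₀`. -/
theorem IsSmallExt.exists_correction (h : IsSmallExt g κ) (hf : f ≠ 0) {F : B ⊗[ℂ] S} {g₀ : S}
    (hF : fibreMap B S F = f) (hadm : IsAdmissible (Ideal.span {F + κ ⊗ₜ g₀}))
    (δ : Derivation B (B ⊗[ℂ] S) (B ⊗[ℂ] S)) (a : B ⊗[ℂ] S)
    (hδ : changeMap S g (δ F) = changeMap S g (a * F)) :
    ∃ (d : Derivation ℂ S S) (v : S), δ F + κ ⊗ₜ (restrictDer δ g₀ + d f) =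
      a * F + κ ⊗ₜ (fibreMap B S a * g₀ + v * f) := by
  have hκ0 : ∀ s : S, fibreMap B S (κ ⊗ₜ s) = 0 := fun s => by
    rw [fibreMap_tmul, residueHom_eq_zero.mpr h.mem_maximalIdeal, zero_smul]
  have hG : fibreMap B S (F + κ ⊗ₜ g₀) = f := by rw [map_add, hκ0, hF, add_zero]
  have hGF : changeMap S g (F + κ ⊗ₜ g₀) = changeMap S g F := by
    rw [map_add, h.changeMap_tmul_eq_zero, add_zero]
  obtain ⟨D, hD⟩ := restrictDer_change g δ
  have hDlog : D ∈ logDer A (A ⊗[ℂ] S) (Ideal.span {changeMap S g (F + κ ⊗ₜ g₀)}) := by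
    rw [mem_logDer_span, hGF, hD, hδ, map_mul]
    exact Ideal.mul_mem_left _ _ (Ideal.mem_span_singleton_self _)
  obtain ⟨δ', hδ', hD'⟩ := exists_logDer_lift_change h.surjective hG hadm
    (isAdmissible_changeMap hf hG hadm g) hDlog
  obtain ⟨d, hd⟩ := h.exists_der_eq (δ := δ') (δ' := δ) fun z => (hD' z).trans (hD z)
  obtain ⟨b, hb⟩ := Ideal.mem_span_singleton.mp (mem_logDer_span.mp hδ')
  have hba : changeMap S g (b - a) = 0 := by
    refine eq_zero_of_mul_eq_zero_of_fibreMap hf (F := changeMap S g F)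
      (by rw [fibreMap_changeMap, hF]) ?_
    have h1 := congrArg (changeMap S g) hb
    rw [hD', hGF, hD, hδ, map_mul, map_mul, hGF] at h1
    rw [map_sub, mul_sub, ← h1, mul_comm, sub_self]
  obtain ⟨v, hv⟩ := h.exists_eq_tmul hba
  rw [sub_eq_iff_eq_add'] at hv
  refine ⟨d, v, ?_⟩
  have hδκ : δ (κ ⊗ₜ g₀) = κ ⊗ₜ restrictDer δ g₀ := by
    have h1 : (κ ⊗ₜ g₀ : B ⊗[ℂ] S) = κ • ((1 : B) ⊗ₜ g₀) := by
      rw [TensorProduct.smul_tmul', smul_eq_mul, mul_one]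
    rw [h1, Derivation.map_smul, h.smul_tmul_eq]
    rfl
  have h2 : (F + κ ⊗ₜ g₀) * b = a * F + κ ⊗ₜ (fibreMap B S a * g₀ + v * f) := by
    have h3 : (κ ⊗ₜ g₀ : B ⊗[ℂ] S) * κ ⊗ₜ v = 0 := by
      rw [h.mul_tmul, hκ0, zero_mul, TensorProduct.tmul_zero]
    rw [hv, TensorProduct.tmul_add, ← h.mul_tmul, mul_comm v, ← hF, ← h.mul_tmul]
    linear_combination h3
  rw [hd, hG, map_add, hδκ, h2] at hb
  rw [← hb, TensorProduct.tmul_add, add_assoc]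

namespace LogFamily
variable {J : Type} {N : ℕ} (Φ : LogFamily f J N)

/-- Changing the parameters by multiples of an element of the socle. -/
theorem eqnAt_add (κ : B) (t : Fin N → B) (c : Fin N → ℂ) :
    Φ.eqnAt (fun l => t l + c l • κ) = Φ.eqnAt t + κ ⊗ₜ ∑ l, c l • Φ.eqnVar l := by
  rw [eqnAt, eqnAt, add_assoc, TensorProduct.tmul_sum, ← Finset.sum_add_distrib]
  congr 1
  refine Finset.sum_congr rfl fun l _ => ?_
  rw [TensorProduct.add_tmul, TensorProduct.smul_tmul]

theorem defect_add (h : IsSmallExt g κ) (t : Fin N → B) (ht : ∀ l, t l ∈ maximalIdeal B)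
    (c : Fin N → ℂ) (i : J) : Φ.defect (fun l => t l + c l • κ) i =
      Φ.defect t i + κ ⊗ₜ ∑ l, c l • Φ.linTerm i l := by
  have h1 : ∀ l m, (t l + c l • κ) * (t m + c m • κ) = t l * t m := fun l m => by
    have h2 : (t l + c l • κ) * (t m + c m • κ) = t l * t m + c m • (t l * κ) + c l • (t m * κ) +
        c l • c m • (κ * κ) := by
      simp only [Algebra.smul_def]; ring
    rw [h2, h.socle _ (ht l), h.socle _ (ht m), h.socle _ h.mem_maximalIdeal]
    simp only [smul_zero, add_zero]
  simp only [defect_eq, h1, TensorProduct.add_tmul, TensorProduct.smul_tmul,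
    Finset.sum_add_distrib, TensorProduct.tmul_sum]
  abel

end LogFamily

end Compare

section Weighted
variable {n : ℕ} {w : Fin n → ℕ} {f : O n} {k : ℕ} {J : Type} [Fintype J]

/-- The simultaneous variations of a weighted homogeneous equation, of homogeneous vector fields and
of homogeneous factors that preserve the degrees. -/
def variations (w : Fin n → ℕ) (k : ℕ) (l : J → ℤ) :
    Submodule ℂ (O n × (J → Derivation ℂ (O n) (O n)) × (J → O n)) where
  carrier := {u | u.1 ∈ wHom w k ∧ (∀ i, IsDerHom w (l i) (u.2.1 i)) ∧ ∀ i, u.2.2 i ∈ wHom w (l i)}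
  add_mem' h h' := ⟨add_mem h.1 h'.1, fun i j => add_mem (h.2.1 i j) (h'.2.1 i j),
    fun i => add_mem (h.2.2 i) (h'.2.2 i)⟩
  zero_mem' := ⟨zero_mem _, fun _ _ => zero_mem _, fun _ => zero_mem _⟩
  smul_mem' c _ h := ⟨Submodule.smul_mem _ c h.1, fun i j => Submodule.smul_mem _ c (h.2.1 i j),
    fun i => Submodule.smul_mem _ c (h.2.2 i)⟩

theorem finite_variations (h : IsGermFrame coord pd f) (hw : ∀ i, 0 < w i) (l : J → ℤ) :
    Module.Finite ℂ (variations w k l) := by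
  have := fun d => finite_wHom (w := w) hw d
  have h1 : Module.Finite ℂ (∀ (i : J) (j : Fin n), wHom w (l i + w j)) := inferInstance
  have h2 : Module.Finite ℂ (∀ i : J, wHom w (l i)) := inferInstance
  let e : (wHom w k × (∀ (i : J) (j : Fin n), wHom w (l i + w j)) × ∀ i : J, wHom w (l i)) →ₗ[ℂ]
      variations w k l :=
    { toFun := fun u => ⟨(u.1, fun i => ∑ j, (u.2.1 i j : O n) • pd j, fun i => u.2.2 i), u.1.2,
        fun i j => by
          rw [h.sum_pd_apply (fun j => (u.2.1 i j : O n))]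
          exact (u.2.1 i j).2, fun i => (u.2.2 i).2⟩
      map_add' := fun u u' => by
        refine Subtype.ext (Prod.ext rfl (Prod.ext (funext fun i => ?_) rfl))
        change ∑ j, ((u.2.1 i j : O n) + (u'.2.1 i j : O n)) • pd j =
          ∑ j, (u.2.1 i j : O n) • pd j + ∑ j, (u'.2.1 i j : O n) • pd j
        simp only [add_smul, Finset.sum_add_distrib]
      map_smul' := fun c u => by
        refine Subtype.ext (Prod.ext rfl (Prod.ext (funext fun i => ?_) rfl))
        change ∑ j, (c • (u.2.1 i j : O n)) • pd j = c • ∑ j, (u.2.1 i j : O n) • pd j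
        simp only [smul_assoc, Finset.smul_sum] }
  refine Module.Finite.of_surjective e fun u => ⟨(⟨u.1.1, u.2.1⟩,
    fun i j => ⟨u.1.2.1 i (coord j), u.2.2.1 i j⟩, fun i => ⟨u.1.2.2 i, u.2.2.2 i⟩), ?_⟩
  exact Subtype.ext (Prod.ext rfl (Prod.ext (funext fun i => (h.der_eq_sum (u.1.2.1 i)).symm) rfl))

end Weighted

instance {n : ℕ} : IsDomain (O n) :=
  have : IsDomain (MvPowerSeries (Fin n) ℂ) := NoZeroDivisors.to_isDomain _
  Function.Injective.isDomain (convergentSeries n).val.toRingHom Subtype.val_injective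

section Weighted
variable {n : ℕ} {w : Fin n → ℕ} {f : O n} {k : ℕ} {A B : Art} {g : B →ₐ[ℂ] A} {κ : B}

/-- The Euler vector field lifts to admissible deformations. Therefore a first order perturbation of a
weighted homogeneous deformation differs from a weighted homogeneous perturbation by a coordinate
change. -/
theorem exists_gauge_homogeneous (h : IsGermFrame coord pd f) (hk : k ≠ 0) (hf : f ∈ wHom w k)
    (hκ : IsSmallExt g κ) {F : B ⊗[ℂ] O n} (hF : fibreMap B (O n) F = f)
    (hE : extendDer B (euler w) F = algebraMap ℂ _ k * F) {g₀ : O n}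
    (hadm : IsAdmissible (Ideal.span {F + κ ⊗ₜ g₀})) :
    ∃ φ ∈ gaugeGroup B (O n), φ (F + κ ⊗ₜ g₀) = F + κ ⊗ₜ wpart w {(k : ℤ)} g₀ := by
  obtain ⟨d, v, hdv⟩ := hκ.exists_correction h.ne_zero hF hadm (extendDer B (euler w))
    (algebraMap ℂ _ k) (by rw [hE])
  rw [hE, add_right_inj] at hdv
  have h1 := hκ.tmul_injective hdv
  have h2 : restrictDer (extendDer B (euler w)) g₀ = euler w g₀ := by
    rw [restrictDer_apply, extendDer_tmul, fibreMap_tmul, map_one, one_smul]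
  have h3 : fibreMap B (O n) (algebraMap ℂ _ (k : ℂ)) = algebraMap ℂ _ (k : ℂ) :=
    AlgHom.commutes _ _
  rw [h2, h3, ← Algebra.smul_def] at h1
  -- `f` itself lies in the ideal generated by its partial derivatives
  have hfE : (k : ℂ) • f = ∑ j, pd j f * ((w j : ℂ) • coord j) := by
    have h4 := euler_of_mem (d := k) hf
    rw [h.apply_eq_sum (euler w) f] at h4
    rw [show ((k : ℤ) : ℂ) = (k : ℂ) by norm_cast] at h4
    rw [← h4]
    exact Finset.sum_congr rfl fun j _ => by rw [euler_coord, mul_comm]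
  have hk' : (k : ℂ) ≠ 0 := by exact_mod_cast hk
  have hfE' : v * f = ∑ j, pd j f * (v * ((k : ℂ)⁻¹ • (w j : ℂ) • coord j)) := by
    have h5 : f = (k : ℂ)⁻¹ • (k : ℂ) • f := by rw [smul_smul, inv_mul_cancel₀ hk', one_smul]
    conv_lhs => rw [h5, hfE, Finset.smul_sum, Finset.mul_sum]
    refine Finset.sum_congr rfl fun j _ => ?_
    rw [← mul_smul_comm, mul_left_comm]
  obtain ⟨b, hb⟩ := sub_wpart_mem_of_euler_mem (d := k) (h := g₀) (fun j => (k : ℤ) - w j)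
    (fun j => pd j f) (fun j => pd_mem_wHom hf j)
    (fun j => v * ((k : ℂ)⁻¹ • (w j : ℂ) • coord j) - d (coord j)) (by
      rw [show ((k : ℤ) : ℂ) = (k : ℂ) by norm_cast]
      simp only [mul_sub, Finset.sum_sub_distrib]
      rw [← hfE', sub_eq_iff_eq_add, sub_add_eq_add_sub, eq_sub_iff_add_eq]
      have h6 : d f = ∑ j, pd j f * d (coord j) :=
        (h.apply_eq_sum d f).trans (Finset.sum_congr rfl fun j _ => mul_comm _ _)
      rw [← h6, h1, add_comm])
  obtain ⟨φ, hφ, hφz, -⟩ := hκ.exists_gauge_der (-∑ j, b j • pd j)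
  refine ⟨φ, hφ, ?_⟩
  have h7 : (-∑ j, b j • pd j) f = wpart w {(k : ℤ)} g₀ - g₀ := by
    rw [Derivation.neg_apply, der_sum_apply, neg_eq_iff_eq_neg, neg_sub, hb]
    exact Finset.sum_congr rfl fun j _ => mul_comm _ _
  have h8 : fibreMap B (O n) (F + κ ⊗ₜ g₀) = f := by
    rw [map_add, hF, fibreMap_tmul, residueHom_eq_zero.mpr hκ.mem_maximalIdeal, zero_smul, add_zero]
  rw [hφz, h8, h7, add_assoc, ← TensorProduct.tmul_add, add_sub_cancel]

end Weighted

section Cover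
variable {n : ℕ} {w : Fin n → ℕ} {f : O n} {k : ℕ} {J : Type} [Fintype J] {l : J → ℤ} {N : ℕ}
  {A B : Art} {g : B →ₐ[ℂ] A} {κ : B}

/-- The members of the family are weighted homogeneous of degree preserving variations. -/
structure IsHomFamily (Φ : LogFamily f J N) (w : Fin n → ℕ) (k : ℕ) (l : J → ℤ) : Prop where
  der : ∀ i, IsDerHom w (l i) (Φ.der i)
  mult : ∀ i, Φ.mult i ∈ wHom w (l i)
  mem : ∀ m, (Φ.eqnVar m, Φ.derVar m, Φ.multVar m) ∈ variations w k l
  span : ∀ u ∈ variations w k l, ∃ c : Fin N → ℂ,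
    ∑ m, c m • (Φ.eqnVar m, Φ.derVar m, Φ.multVar m) = u

variable {Φ : LogFamily f J N}

theorem IsHomFamily.linTerm_mem (H : IsHomFamily Φ w k l) (h : IsGermFrame coord pd f)
    (hf : f ∈ wHom w k) (i : J) (m : Fin N) : Φ.linTerm i m ∈ wHom w (k + l i) := by
  have h1 := (H.mem m).1
  have h2 := (H.mem m).2.1 i
  have h3 := (H.mem m).2.2 i
  refine sub_mem (sub_mem (add_mem ((H.der i).apply_mem h h1) (h2.apply_mem h hf)) ?_) ?_
  · rw [add_comm]; exact mul_mem_wHom (H.mult i) h1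
  · rw [add_comm]; exact mul_mem_wHom h3 hf

theorem IsHomFamily.quadTerm_mem (H : IsHomFamily Φ w k l) (h : IsGermFrame coord pd f)
    (i : J) (m m' : Fin N) : Φ.quadTerm i m m' ∈ wHom w (k + l i) := by
  have h1 := (H.mem m').1
  have h2 := (H.mem m).2.1 i
  have h3 := (H.mem m).2.2 i
  refine sub_mem (h2.apply_mem h h1) ?_
  rw [add_comm]; exact mul_mem_wHom h3 h1

/-- The failure of the `i`-th vector field to be logarithmic along the varied equation is weighted
homogeneous. -/
theorem IsHomFamily.lTensor_defect (H : IsHomFamily Φ w k l) (h : IsGermFrame coord pd f)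
    (hf : f ∈ wHom w k) (t : Fin N → B) (i : J) :
    (wpart w {(k : ℤ) + l i}).lTensor B (Φ.defect t i) = Φ.defect t i := by
  rw [Φ.defect_eq, map_add, map_sum, map_sum]
  simp only [map_sum, LinearMap.lTensor_tmul]
  simp only [wpart_singleton_of_mem (H.linTerm_mem h hf i _),
    wpart_singleton_of_mem (H.quadTerm_mem h i _ _)]

theorem IsHomFamily.extendDer_eqnAt (H : IsHomFamily Φ w k l) (hf : f ∈ wHom w k) (t : Fin N → B) :
    extendDer B (euler w) (Φ.eqnAt t) = algebraMap ℂ _ (k : ℂ) * Φ.eqnAt t := by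
  have h1 : ∀ (b : B) {s : O n}, s ∈ wHom w k →
      extendDer B (euler w) (b ⊗ₜ s) = (k : ℂ) • (b ⊗ₜ s : B ⊗[ℂ] O n) := fun b s hs => by
    rw [extendDer_tmul, euler_of_mem hs, TensorProduct.tmul_smul]
    norm_cast
  rw [LogFamily.eqnAt, map_add, map_sum, h1 _ hf, ← Algebra.smul_def, smul_add, Finset.smul_sum]
  congr 1
  exact Finset.sum_congr rfl fun m _ => h1 _ (H.mem m).1

/-- An admissible deformation over a small extension that extends a member of the family is
equivalent to a member of the family. The homogeneous components of the lifted logarithmic vector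
fields provide the required variations. -/
theorem IsHomFamily.exists_param (H : IsHomFamily Φ w k l) (h : IsGermFrame coord pd f) (hk : k ≠ 0)
    (hf : f ∈ wHom w k) (hκ : IsSmallExt g κ) (t : Fin N → B) (ht : ∀ m, t m ∈ maximalIdeal B)
    (hdef : ∀ i, Φ.defect (fun m => g (t m)) i = 0) (G : B ⊗[ℂ] O n)
    (hG : fibreMap B (O n) G = f) (hadm : IsAdmissible (Ideal.span {G}))
    (hGt : changeMap (O n) g G = changeMap (O n) g (Φ.eqnAt t)) :
    ∃ c : Fin N → ℂ, (∀ i, Φ.defect (fun m => t m + c m • κ) i = 0) ∧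
      ∃ φ ∈ gaugeGroup B (O n), ∃ u, IsUnit u ∧
        φ G = u * Φ.eqnAt fun m => t m + c m • κ := by
  obtain ⟨h₀, hh₀⟩ := hκ.exists_eq_tmul (z := G - Φ.eqnAt t) (by rw [map_sub, hGt, sub_self])
  rw [sub_eq_iff_eq_add'] at hh₀
  subst hh₀
  have hF := Φ.fibreMap_eqnAt t ht
  obtain ⟨φ, hφ, hφG⟩ := exists_gauge_homogeneous h hk hf hκ hF (H.extendDer_eqnAt hf t) hadm
  have hp : wpart w {(k : ℤ)} h₀ ∈ wHom w k := wpart_mem_wHom _ _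
  generalize wpart w {(k : ℤ)} h₀ = p at hφG hp
  have hG' : fibreMap B (O n) (Φ.eqnAt t + κ ⊗ₜ p) = f := by
    rw [← hφG, fibreMap_gauge hφ, hG]
  have hadm' : IsAdmissible (Ideal.span {Φ.eqnAt t + κ ⊗ₜ p}) := by
    refine isAdmissible_of_gauge h.ne_zero hG' hG (inv_mem hφ) isUnit_one ?_ hadm
    rw [one_mul, ← hφG]
    exact φ.symm_apply_apply _
  have hcorr := fun i => hκ.exists_correction h.ne_zero hF hadm' (Φ.derAt t i) (Φ.multAt t i) (by
    rw [Φ.changeMap_derAt, map_mul, Φ.changeMap_multAt, Φ.changeMap_eqnAt]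
    exact sub_eq_zero.mp (hdef i))
  choose d v hdv using hcorr
  have hres : ∀ i, restrictDer (Φ.derAt t i) p = Φ.der i p := fun i => Φ.fibreMap_derAt t ht i p
  have hmul : ∀ i, fibreMap B (O n) (Φ.multAt t i) = Φ.mult i := fun i => Φ.fibreMap_multAt t ht i
  obtain ⟨c, hc⟩ := H.span (p, fun i => derPart w (l i) (d i), fun i => wpart w {l i} (v i))
    ⟨hp, fun i => isDerHom_derPart h _ _, fun i => wpart_mem_wHom _ _⟩
  have hc1 : ∑ m, c m • Φ.eqnVar m = p := by
    have := congrArg (LinearMap.fst ℂ _ _) hc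
    rwa [map_sum] at this
  have hc2 : ∀ i, ∑ m, c m • Φ.derVar m i = derPart w (l i) (d i) := fun i => by
    have := congrArg (LinearMap.proj i ∘ₗ LinearMap.fst ℂ _ _ ∘ₗ LinearMap.snd ℂ _ _) hc
    rwa [map_sum] at this
  have hc3 : ∀ i, ∑ m, c m • Φ.multVar m i = wpart w {l i} (v i) := fun i => by
    have := congrArg (LinearMap.proj i ∘ₗ LinearMap.snd ℂ _ _ ∘ₗ LinearMap.snd ℂ _ _) hc
    rwa [map_sum] at this
  have heq : Φ.eqnAt (fun m => t m + c m • κ) = Φ.eqnAt t + κ ⊗ₜ p := by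
    rw [Φ.eqnAt_add, hc1]
  refine ⟨c, fun i => ?_, φ, hφ, 1, isUnit_one, by rw [one_mul, heq, hφG]⟩
  -- the first order correction of the obstruction
  have hlin : ∑ m, c m • Φ.linTerm i m = Φ.der i p + derPart w (l i) (d i) f - Φ.mult i * p -
      wpart w {l i} (v i) * f := by
    have h1 : Φ.der i p = ∑ m, c m • Φ.der i (Φ.eqnVar m) := by
      rw [← hc1, map_sum]
      exact Finset.sum_congr rfl fun m _ => Derivation.map_smul _ _ _
    have h2 : derPart w (l i) (d i) f = ∑ m, c m • Φ.derVar m i f := by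
      rw [← hc2, der_sum_apply]; rfl
    rw [h1, h2, ← hc3, ← hc1, Finset.mul_sum, Finset.sum_mul, ← Finset.sum_add_distrib,
      ← Finset.sum_sub_distrib, ← Finset.sum_sub_distrib]
    refine Finset.sum_congr rfl fun m _ => ?_
    rw [LogFamily.linTerm, smul_sub, smul_sub, smul_add, mul_smul_comm, smul_mul_assoc]
  rw [Φ.defect_add hκ t ht, hlin]
  have hcor := hdv i
  rw [hres, hmul] at hcor
  have hdef' : Φ.defect t i = κ ⊗ₜ (Φ.mult i * p + v i * f - (Φ.der i p + d i f)) := by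
    rw [LogFamily.defect, TensorProduct.tmul_sub, sub_eq_sub_iff_add_eq_add, add_comm (κ ⊗ₜ _),
      hcor]
  -- its component of weight `k + l i`
  have h3 := congrArg ((wpart w {(k : ℤ) + l i}).lTensor B) hdef'
  rw [H.lTensor_defect h hf, LinearMap.lTensor_tmul, map_sub, map_add, map_add,
    wpart_singleton_of_mem ((H.der i).apply_mem h hp), ← derPart_apply _ _ h hf, mul_comm (v i),
    wpart_mul_singleton hf, wpart_singleton_of_mem (add_comm (l i) (k : ℤ) ▸
      mul_mem_wHom (H.mult i) hp)] at h3
  rw [h3, ← TensorProduct.tmul_add]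
  rw [show Φ.mult i * p + f * wpart w {l i} (v i) - (Φ.der i p + derPart w (l i) (d i) f) +
    (Φ.der i p + derPart w (l i) (d i) f - Φ.mult i * p - wpart w {l i} (v i) * f) = 0 by ring,
    TensorProduct.tmul_zero]

/-- The deformation functor of a weighted homogeneous free divisor has a hull. -/
theorem hasHull_of_weightedHomogeneous (hw : ∀ i, 0 < w i) (hf : f ∈ wHom w k)
    (hfree : IsFreeDivisorGerm f) : HasHull (FD (Ideal.span {f})) := by
  have h : IsGermFrame coord pd f := isGermFrame_coord hw hf hfree.ne_zero
    (mem_maximalIdeal_iff_evalZero.mpr ((evalZero_apply f).trans hfree.vanishes))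
  have hk : k ≠ 0 := by
    rintro rfl
    refine hfree.ne_zero (Subtype.ext (MvPowerSeries.ext fun m => ?_))
    by_contra hm
    have h1 : Finsupp.weight w m = 0 := by exact_mod_cast hf m hm
    rw [weight_eq_zero_iff hw] at h1
    subst h1
    exact hm hfree.vanishes
  have := hfree.free
  obtain ⟨J, _, δ, l, hδ, hspan⟩ := exists_homogeneous_generators h hf
  have hlog : ∀ i, δ i ∈ logDer ℂ (O n) (Ideal.span {f}) := fun i => by
    rw [hspan]; exact Submodule.subset_span ⟨i, rfl⟩
  choose α hα hαf using fun i => (hδ i).exists_mult h hf (hlog i)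
  have := finite_variations (k := k) h hw l
  obtain ⟨N, u, hu⟩ := Module.Finite.exists_fin (R := ℂ) (M := variations w k l)
  let Φ : LogFamily f J N :=
    { der := δ
      mult := α
      eqnVar := fun m => (u m).1.1
      derVar := fun m => (u m).1.2.1
      multVar := fun m => (u m).1.2.2
      der_apply := hαf
      span := hspan }
  have H : IsHomFamily Φ w k l :=
    { der := hδ
      mult := hα
      mem := fun m => (u m).2
      span := fun z hz => by
        have h1 : (⟨z, hz⟩ : variations w k l) ∈ Submodule.span ℂ (Set.range u) := by
          rw [hu]; trivial
        obtain ⟨c, hc⟩ := (Submodule.mem_span_range_iff_exists_fun ℂ).mp h1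
        refine ⟨c, ?_⟩
        have h2 := congrArg (variations w k l).subtype hc
        rwa [map_sum] at h2 }
  exact Φ.hasHull h fun B A g κ hκ t ht hdef G hG hadm hGt =>
    H.exists_param h hk hf hκ t ht hdef G hG hadm hGt

end Cover

/-! ### Linear free divisors are homogeneous -/

section Linear
open MvPolynomial
variable {n : ℕ}

theorem homogeneousComponent_mul_linear (e : ℕ) (c : MvPolynomial (Fin n) ℂ)
    {l : MvPolynomial (Fin n) ℂ} (hl : l.IsHomogeneous 1) :
    homogeneousComponent (e + 1) (c * l) = homogeneousComponent e c * l := by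
  conv_lhs => rw [← sum_homogeneousComponent c, Finset.sum_mul, map_sum]
  have h1 : ∀ i, homogeneousComponent (e + 1) (homogeneousComponent i c * l) =
      if i = e then homogeneousComponent i c * l else 0 := fun i => by
    rw [homogeneousComponent_of_mem ((homogeneousComponent_isHomogeneous i c).mul hl)]
    simp only [add_left_inj, eq_comm]
  simp only [h1]
  rw [Finset.sum_ite_eq']
  split_ifs with h2
  · rfl
  · rw [homogeneousComponent_eq_zero, zero_mul]
    rw [Finset.mem_range] at h2
    omega

/-- A polynomial that divides all its partial derivatives is constant. -/
theorem isUnit_of_forall_dvd_pderiv {q : MvPolynomial (Fin n) ℂ} (hq : q ≠ 0)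
    (h : ∀ j, q ∣ pderiv j q) : IsUnit q := by
  have h0 : ∀ j, pderiv j q = 0 := fun j => by
    by_contra hne
    have h1 := totalDegree_le_of_dvd_of_isDomain (h j) hne
    obtain ⟨m, hm, hm'⟩ := Finset.exists_mem_eq_sup (pderiv j q).support
      (support_nonempty.mpr hne) fun s => s.sum fun _ e => e
    have h2 : m + Finsupp.single j 1 ∈ q.support := by
      rw [mem_support_iff] at hm ⊢
      intro h3
      rw [coeff_pderiv, h3, zero_mul] at hm
      exact hm rfl
    have h3 := le_totalDegree h2
    rw [Finsupp.sum_add_index' (fun _ => rfl) (fun _ _ _ => rfl), Finsupp.sum_single_index rfl] at h3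
    change (pderiv j q).totalDegree = _ at hm'
    omega
  have h1 : q = C (coeff 0 q) := by
    ext m
    rw [coeff_C]
    split_ifs with hm
    · rw [hm]
    · obtain ⟨j, hj⟩ : ∃ j, m j ≠ 0 := by
        by_contra! hc
        exact hm (Finsupp.ext hc).symm
      have h2 : m - Finsupp.single j 1 + Finsupp.single j 1 = m := by
        refine tsub_add_cancel_of_le ?_
        rw [Finsupp.single_le_iff]
        omega
      have h3 := coeff_pderiv (i := j) q (m - Finsupp.single j 1)
      rw [h0, coeff_zero, h2] at h3
      rcases mul_eq_zero.mp h3.symm with h4 | h4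
      · exact h4
      · exact absurd h4 (Nat.cast_add_one_ne_zero _)
  rw [h1]
  refine (isUnit_iff_ne_zero.mpr fun h2 => ?_).map C
  rw [h2, map_zero] at h1
  exact hq h1

/-- The partial derivatives of a squarefree polynomial have no common factor with it. -/
theorem dvd_of_squarefree_of_forall_dvd_mul_pderiv {p : MvPolynomial (Fin n) ℂ} (hp : Squarefree p)
    {a : MvPolynomial (Fin n) ℂ} (h : ∀ j, p ∣ a * pderiv j p) : p ∣ a := by
  induction p using UniqueFactorizationMonoid.induction_on_prime with
  | h₁ => exact absurd hp not_squarefree_zero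
  | h₂ u hu => exact hu.dvd
  | h₃ r q hr hq ih =>
    have hrel : IsRelPrime q r := IsRelPrime.of_squarefree_mul hp
    have hd : ∀ j, a * pderiv j (q * r) = a * pderiv j q * r + q * (a * pderiv j r) := fun j => by
      rw [pderiv_mul]; ring
    have h1 : r ∣ a := ih hp.of_mul_right fun j => by
      have h2 := (Dvd.intro_left q rfl).trans (h j)
      rw [hd] at h2
      exact hrel.symm.dvd_of_dvd_mul_left ((dvd_add_right (Dvd.intro_left _ rfl)).mp h2)
    have h2 : q ∣ a := by
      by_contra hc
      refine hq.not_isUnit (isUnit_of_forall_dvd_pderiv hq.ne_zero fun j => ?_)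
      have h3 := (Dvd.intro r rfl).trans (h j)
      rw [hd] at h3
      have h4 := (dvd_add_left (Dvd.intro _ rfl)).mp h3
      have h5 := hrel.dvd_of_dvd_mul_right h4
      exact (hq.dvd_or_dvd h5).resolve_left hc
    exact hrel.mul_dvd h2 h1

/-- The homogeneous components of the equation of a linear free divisor give logarithmic vector
fields, since the basis fields are homogeneous. -/
theorem homogeneousComponent_smul_pderiv_mem {p : MvPolynomial (Fin n) ℂ} {ι : Type}
    (b : Module.Basis ι (MvPolynomial (Fin n) ℂ)
      (logDer ℂ (MvPolynomial (Fin n) ℂ) (Ideal.span {p})))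
    (hb : ∀ i j, ((b i).1 (X j)).IsHomogeneous 1) (e : ℕ) (j : Fin n) :
    homogeneousComponent (e + 1) p • pderiv j ∈
      logDer ℂ (MvPolynomial (Fin n) ℂ) (Ideal.span {p}) := by
  let z : logDer ℂ (MvPolynomial (Fin n) ℂ) (Ideal.span {p}) := ⟨p • pderiv j, mem_logDer_span.mpr
    (Ideal.mul_mem_right _ _ (Ideal.mem_span_singleton_self p))⟩
  have hz : ∀ k, p * pderiv j (X k) = ∑ i ∈ (b.repr z).support, b.repr z i * (b i).1 (X k) := by
    intro k
    have h1 := congrArg Subtype.val (b.linearCombination_repr z)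
    rw [Finsupp.linearCombination_apply, Finsupp.sum, Submodule.coe_sum] at h1
    have h2 := DFunLike.congr_fun h1 (X k)
    rw [der_sum_apply] at h2
    exact h2.symm
  have heq : homogeneousComponent (e + 1) p • pderiv j =
      ∑ i ∈ (b.repr z).support, homogeneousComponent e (b.repr z i) • (b i).1 := by
    refine derivation_ext fun k => ?_
    rw [der_sum_apply, Derivation.smul_apply, smul_eq_mul]
    have h1 := congrArg (homogeneousComponent (e + 1)) (hz k)
    rw [map_sum] at h1
    simp only [homogeneousComponent_mul_linear e _ (hb _ k)] at h1
    refine Eq.trans ?_ h1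
    by_cases hjk : k = j
    · rw [hjk, pderiv_X_self, mul_one, mul_one]
    · rw [pderiv_X_of_ne hjk, mul_zero, mul_zero, map_zero]
  rw [heq]
  exact Submodule.sum_mem _ fun i _ => Submodule.smul_mem _ _ (b i).2

/-- The equation of a linear free divisor is homogeneous, since it divides its non-zero homogeneous
components. -/
theorem IsLinearFreeDivisor.exists_isHomogeneous {p : MvPolynomial (Fin n) ℂ}
    (hp : IsLinearFreeDivisor p) : ∃ k, p.IsHomogeneous k := by
  obtain ⟨ι, b, hb⟩ := hp.linear
  have h0 : coeff 0 p = 0 := by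
    have h1 := hp.free.vanishes
    rw [coe_germ] at h1
    rwa [← coeff_coe, MvPowerSeries.coeff_zero_eq_constantCoeff_apply]
  refine ⟨p.totalDegree, fun m hm => ?_⟩
  have hm0 : m.degree ≠ 0 := fun h => by
    rw [Finsupp.degree_eq_zero_iff] at h
    exact hm (h ▸ h0)
  obtain ⟨e, he⟩ := Nat.exists_eq_succ_of_ne_zero hm0
  have hdvd : p ∣ homogeneousComponent (e + 1) p :=
    dvd_of_squarefree_of_forall_dvd_mul_pderiv hp.squarefree fun j => Ideal.mem_span_singleton.mp
      (mem_logDer_span.mp (homogeneousComponent_smul_pderiv_mem b hb e j))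
  have hne : homogeneousComponent (e + 1) p ≠ 0 := fun h => by
    have h1 := congrArg (coeff m) h
    rw [coeff_homogeneousComponent, if_pos he, coeff_zero] at h1
    exact hm h1
  have h1 := totalDegree_le_of_dvd_of_isDomain hdvd hne
  rw [(homogeneousComponent_isHomogeneous (e + 1) p).totalDegree hne] at h1
  have h2 := le_totalDegree (mem_support_iff.mpr hm)
  have h3 : m.degree = m.sum fun _ e => e := rfl
  have h4 : Finsupp.weight 1 m = m.degree := by rw [Finsupp.degree_eq_weight_one]; rfl
  omega

end Linear

end FreeDiv
end

theorem mainTheorem2 :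
    (∀ (n : ℕ) (p : MvPolynomial (Fin n) ℂ) (w : Fin n → ℕ) (k : ℕ),
      FreeDiv.IsFreeDivisorGerm (FreeDiv.germ p) →
      (∀ i, 0 < w i) → MvPolynomial.IsWeightedHomogeneous w p k →
      FreeDiv.HasHull (FreeDiv.FD (Ideal.span {FreeDiv.germ p}))) ∧
    (∀ (n : ℕ) (p : MvPolynomial (Fin n) ℂ),
      FreeDiv.IsLinearFreeDivisor p →
      FreeDiv.HasHull (FreeDiv.FD (Ideal.span {FreeDiv.germ p}))) := by
  have key : ∀ (n : ℕ) (p : MvPolynomial (Fin n) ℂ) (w : Fin n → ℕ) (k : ℕ),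
      FreeDiv.IsFreeDivisorGerm (FreeDiv.germ p) →
      (∀ i, 0 < w i) → MvPolynomial.IsWeightedHomogeneous w p k →
      FreeDiv.HasHull (FreeDiv.FD (Ideal.span {FreeDiv.germ p})) := fun _ _ _ _ hfree hw hp =>
    FreeDiv.hasHull_of_weightedHomogeneous hw (FreeDiv.germ_mem_wHom hp) hfree
  refine ⟨key, fun n p hp => ?_⟩
  obtain ⟨k, hk⟩ := hp.exists_isHomogeneous
  exact key n p 1 k hp.free (fun _ => one_pos) hk
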